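/- Work over $\mathbf C$. Let $R=\mathbf C[u_0,\dots,u_n]$ act on $S=\mathbf C[x_0,\dots,x_n]$ by $u_k=\partial/\partial x_k$, written $\varphi\circ F$, and let $\mathbf P^n=\mathrm{Proj}\,R=\mathbf P(S_1)$. A closed subscheme $Z\subseteq\mathbf P^n$ with saturated ideal $I_Z\subseteq R$ is *apolar* to a subspace $\Lambda\subseteq S_d$ if $\varphi\circ F=0$ for all $\varphi\in I_Z$, $F\in\Lambda$. A zero-dimensional scheme $Z\subseteq\mathbf P^n$ of length $s$ is *resolution-general* if the graded Betti numbers of $R/I_Z$ equal those of the ideal of $s$ general points of $\mathbf P^n$. A *polar $s$-hedron* of $\Lambda$ is a zero-dimensional scheme of length $s$ which is apolar to $\Lambda$ and resolution-general. A quadruple $(n,d,r,s)$ with $s\ge r\binom{n+d}{d}/(n+r)$ is *nondegenerate* if a general $\Lambda\in G(r,S_d)$ admits a polar $s$-hedron. A *grove* for points $p_1,\dots,p_8\in\mathbf P^1$ and $Q_1,\dots,Q_8\in\mathbf P^3$ is a linear system $\Gamma\subseteq\mathbf P H^0(\mathbf P^3,\mathcal O(3))$ of projective dimension $t\in\{0,1\}$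 whose base locus contains all $Q_i$, and such that either $t=0$ and the generator of $\Gamma$ is singular at all $Q_i$, or $t=1$ and there is an isomorphism $\gamma:\mathbf P^1\to\Gamma$ such that the surface $\gamma(p_i)$ is singular at $Q_i$ for every $i$. **Theorem.** 1. The quadruple $(3,3,2,8)$ is nondegenerate: a general pencil of cubic surfaces in $\mathbf P^3$ admits a polar octahedron. 2. For the points $$\begin{array}{llll}Q_1=[1,0,0,0],&Q_2=[0,1,0,0],&Q_3=[0,0,1,0],&Q_4=[0,0,0,1],\\ Q_5=[-1,1,1,1],&Q_6=[1,-1,1,1],&Q_7=[1,1,-1,1],&Q_8=[1,1,1,-1]\end{array}$$ of $\mathbf P^3$ and general points $p_1,\dots,p_8\in\mathbf P^1$ there is no grove for the data $(p_i)$, $(Q_i)$. 3. Let $E$ be an elliptic curve over $\mathbf C$, $\mathcal M$ a line bundle on $E$ of degree $4$, and $Q_1,\dots,Q_8$ distinct points of $E$. Then there are points $p_1,\dots,p_8\in\mathbf P^1$ such that no morphism $f:E\to\mathbf P^1$ satisfies both of the following conditions: (A) $2\le\deg f\le4$, and if $\deg f=4$ then $f^*\mathcal O_{\mathbf P^1}(1)\simeq\mathcal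 M$; (B) $f(Q_i)=p_i$ for at least $4+\deg f$ values of $i$. -/

import Mathlib

open MvPolynomial

noncomputable section

namespace PolarPolyhedra

/-! ### Apolarity

For `n : ℕ` both polynomial rings `R = ℂ[u₀, …, uₙ]` and `S = ℂ[x₀, …, xₙ]` are
`MvPolynomial (Fin (n + 1)) ℂ`.  A point of `ℙⁿ = ℙ(S₁) = Proj R` is given by a nonzero vector
`L : Fin (n + 1) → ℂ`, its homogeneous coordinates (the coefficients of the linear form
`∑ L k • x k`). -/

/-- The monomial differential operator `∂₀ ^ m₀ ∘ ⋯ ∘ ∂ₙ ^ mₙ`. -/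
def diffMonomial {n : ℕ} (m : Fin (n + 1) →₀ ℕ) :
    Module.End ℂ (MvPolynomial (Fin (n + 1)) ℂ) :=
  (List.ofFn fun k : Fin (n + 1) =>
    ((pderiv k).toLinearMap : Module.End ℂ (MvPolynomial (Fin (n + 1)) ℂ)) ^ m k).prod

/-- The internal product `φ ∘ F = φ(∂/∂x₀, …, ∂/∂xₙ) F`. -/
def internalProduct {n : ℕ} (φ F : MvPolynomial (Fin (n + 1)) ℂ) :
    MvPolynomial (Fin (n + 1)) ℂ :=
  ∑ m ∈ φ.support, φ.coeff m • diffMonomial m F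

/-- `Z` is apolar to `Λ`: the ideal `I` of `Z` is contained in `Λ^⊥`. -/
def IsApolar {n : ℕ} (I : Ideal (MvPolynomial (Fin (n + 1)) ℂ))
    (Λ : Submodule ℂ (MvPolynomial (Fin (n + 1)) ℂ)) : Prop :=
  ∀ φ ∈ I, ∀ F ∈ Λ, internalProduct φ F = 0

/-! ### Zero-dimensional subschemes of `ℙⁿ` and their graded Betti numbers

A closed subscheme of `ℙⁿ = Proj R` is given by its saturated homogeneous ideal. -/

/-- The degree `k` part of `R / I`. -/
def quotientPiece {n : ℕ} (I : Ideal (MvPolynomial (Fin (n + 1)) ℂ)) (k : ℕ) :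
    Submodule ℂ (MvPolynomial (Fin (n + 1)) ℂ ⧸ I) :=
  (homogeneousSubmodule (Fin (n + 1)) ℂ k).map (Ideal.Quotient.mkₐ ℂ I).toLinearMap

/-- `I` is saturated with respect to the irrelevant ideal. -/
def IsSaturated {n : ℕ} (I : Ideal (MvPolynomial (Fin (n + 1)) ℂ)) : Prop :=
  ∀ f : MvPolynomial (Fin (n + 1)) ℂ,
    (∃ k : ℕ, ∀ g : MvPolynomial (Fin (n + 1)) ℂ, g.IsHomogeneous k → g * f ∈ I) → f ∈ I

/-- `I` is the saturated homogeneous ideal of a zero-dimensional subscheme of `ℙⁿ` of length `s`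
(the Hilbert polynomial of `R / I` is the constant `s`). -/
structure IsZeroDimScheme {n : ℕ} (s : ℕ) (I : Ideal (MvPolynomial (Fin (n + 1)) ℂ)) : Prop where
  homogeneous : ∀ f ∈ I, ∀ k, homogeneousComponent k f ∈ I
  saturated : IsSaturated I
  length : ∃ k₀ : ℕ, ∀ k ≥ k₀, Module.finrank ℂ (quotientPiece I k) = s

/-- The Koszul differential on `⋀ ℂ^(n+1) ⊗ R / I`; an element `∑ c_T e_T` is given by its
coefficients `c`, and `d e_T = ∑_{k ∈ T} (-1)^#{t ∈ T | t < k} x_k e_{T \ k}`. -/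
def koszulD {n : ℕ} (I : Ideal (MvPolynomial (Fin (n + 1)) ℂ)) :
    (Finset (Fin (n + 1)) → MvPolynomial (Fin (n + 1)) ℂ ⧸ I) →ₗ[ℂ]
      (Finset (Fin (n + 1)) → MvPolynomial (Fin (n + 1)) ℂ ⧸ I) where
  toFun c := fun T => ∑ k ∈ Tᶜ,
    (-1) ^ (T.filter fun t => t < k).card * (Ideal.Quotient.mk I (X k) * c (insert k T))
  map_add' c c' := by
    funext T
    simp only [Pi.add_apply, mul_add, Finset.sum_add_distrib]
  map_smul' a c := by
    funext T
    simp only [Pi.smul_apply, mul_smul_comm, Finset.smul_sum, RingHom.id_apply]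

/-- The internal degree `j` part `⋀^i ℂ^(n+1) ⊗ (R / I)_(j - i)` of the Koszul complex. -/
def koszulChain {n : ℕ} (I : Ideal (MvPolynomial (Fin (n + 1)) ℂ)) (i j : ℕ) :
    Submodule ℂ (Finset (Fin (n + 1)) → MvPolynomial (Fin (n + 1)) ℂ ⧸ I) :=
  Submodule.pi Set.univ fun T =>
    if T.card = i ∧ i ≤ j then quotientPiece I (j - i) else ⊥

/-- The graded Betti number `β_{i,j} = dim Tor_i(R / I, ℂ)_j` of `R / I`, that is, the number of
generators of degree `j` in the `i`-th step of the minimal free resolution, computed as the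
dimension of the Koszul homology of `R / I`. -/
def bettiNumber {n : ℕ} (I : Ideal (MvPolynomial (Fin (n + 1)) ℂ)) (i j : ℕ) : ℕ :=
  Module.finrank ℂ
    (↥(koszulChain I i j ⊓ LinearMap.ker (koszulD I)) ⧸
      ((koszulChain I (i + 1) j).map (koszulD I)).submoduleOf
        (koszulChain I i j ⊓ LinearMap.ker (koszulD I)))

/-- The homogeneous ideal of a set of points of `ℙⁿ`. -/
def pointsIdeal {n s : ℕ} (L : Fin s → Fin (n + 1) → ℂ) :
    Ideal (MvPolynomial (Fin (n + 1)) ℂ) :=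
  Ideal.span {f | (∃ k, f.IsHomogeneous k) ∧ ∀ i, eval (L i) f = 0}

/-! ### General points -/

/-- `P` holds for `s` general points of `ℙⁿ`: it holds on a nonempty Zariski open subset of
`(ℙⁿ)^s`, expressed in homogeneous coordinates. -/
def ForGeneralPoints (n s : ℕ) (P : (Fin s → Fin (n + 1) → ℂ) → Prop) : Prop :=
  ∃ Φ : MvPolynomial (Fin s × Fin (n + 1)) ℂ, Φ ≠ 0 ∧
    ∀ L : Fin s → Fin (n + 1) → ℂ, (∀ i, L i ≠ 0) →
      eval (fun q => L q.1 q.2) Φ ≠ 0 → P L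

/-- `P` holds for a general point `Λ` of the Grassmannian `G(r, S_d)`: it holds on a nonempty
Zariski open subset.  The open subset is described by its preimage in the space of bases
`F₁, …, F_r`, through a nonzero polynomial in the coefficients of the `F_i`. -/
def ForGeneralSystem (n d r : ℕ)
    (P : Submodule ℂ (MvPolynomial (Fin (n + 1)) ℂ) → Prop) : Prop :=
  ∃ Φ : MvPolynomial (Fin r × {m : Fin (n + 1) →₀ ℕ // m.degree = d}) ℂ, Φ ≠ 0 ∧
    ∀ F : Fin r → MvPolynomial (Fin (n + 1)) ℂ,
      (∀ i, (F i).IsHomogeneous d) → LinearIndependent ℂ F →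
        eval (fun q => (F q.1).coeff q.2.1) Φ ≠ 0 → P (Submodule.span ℂ (Set.range F))

/-! ### Polar polyhedra and nondegeneracy -/

/-- The scheme with ideal `I` has the same graded Betti numbers as `s` general points. -/
def IsResolutionGeneral {n : ℕ} (s : ℕ) (I : Ideal (MvPolynomial (Fin (n + 1)) ℂ)) : Prop :=
  ForGeneralPoints n s fun L => ∀ i j, bettiNumber I i j = bettiNumber (pointsIdeal L) i j

/-- `I` is the ideal of a polar `s`-hedron of `Λ`. -/
structure IsPolarPolyhedron {n : ℕ} (s : ℕ) (Λ : Submodule ℂ (MvPolynomial (Fin (n + 1)) ℂ))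
    (I : Ideal (MvPolynomial (Fin (n + 1)) ℂ)) : Prop where
  scheme : IsZeroDimScheme s I
  apolar : IsApolar I Λ
  resolutionGeneral : IsResolutionGeneral s I

/-- The quadruple `(n, d, r, s)` is nondegenerate: `s ≥ r * binom (n + d) d / (n + r)`, and a
general `Λ` in `G(r, S_d)` admits a polar `s`-hedron. -/
def Nondegenerate (n d r s : ℕ) : Prop :=
  r * (n + d).choose d ≤ s * (n + r) ∧
    ForGeneralSystem n d r fun Λ => ∃ I, IsPolarPolyhedron s Λ I

/-! ### Groves -/

/-- The hypersurface `F = 0` is singular at the point `q`. -/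
def SingularAt (F : MvPolynomial (Fin 4) ℂ) (q : Fin 4 → ℂ) : Prop :=
  eval q F = 0 ∧ ∀ k, eval q (pderiv k F) = 0

/-- A grove for points `p₁, …, p₈` of `ℙ¹` and `Q₁, …, Q₈` of `ℙ³`: a linear system
`ℙ(Γ)` of cubic surfaces, of projective dimension `t = dim Γ - 1`.  An isomorphism `ℙ¹ ≃ ℙ(Γ)` is
induced by a linear isomorphism `ℂ² ≃ Γ`. -/
structure IsGrove (p : Fin 8 → Fin 2 → ℂ) (Q : Fin 8 → Fin 4 → ℂ)
    (Γ : Submodule ℂ (MvPolynomial (Fin 4) ℂ)) : Prop where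
  cubics : Γ ≤ homogeneousSubmodule (Fin 4) ℂ 3
  base : ∀ F ∈ Γ, ∀ i, eval (Q i) F = 0
  singular :
    (Module.finrank ℂ Γ = 1 ∧ ∀ F ∈ Γ, ∀ i, SingularAt F (Q i)) ∨
    (Module.finrank ℂ Γ = 2 ∧ ∃ γ : (Fin 2 → ℂ) ≃ₗ[ℂ] Γ, ∀ i, SingularAt (γ (p i)) (Q i))

/-- The points `Q₁, …, Q₈` of `ℙ³`, in the coordinates `w, x, y, z`. -/
def octad : Fin 8 → Fin 4 → ℂ :=
  ![![1, 0, 0, 0], ![0, 1, 0, 0], ![0, 0, 1, 0], ![0, 0, 0, 1],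
    ![-1, 1, 1, 1], ![1, -1, 1, 1], ![1, 1, -1, 1], ![1, 1, 1, -1]]

/-! ### Maps from an elliptic curve to `ℙ¹`

The points of the smooth projective curve with function field `K` are the places of `K / ℂ`, and
its nonconstant morphisms to `ℙ¹` are the elements of `K` outside `ℂ`. -/

/-- A place of the function field `K / ℂ`, given by its local ring. -/
@[ext]
structure Place (K : Type*) [Field K] [Algebra ℂ K] where
  localRing : ValuationSubring K
  const_mem : ∀ c : ℂ, algebraMap ℂ K c ∈ localRing
  ne_top : localRing ≠ ⊤

section

variable {K : Type*} [Field K] [Algebra ℂ K]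

/-- `g` has order `m` at `P`: `g = u * t ^ m` with `t` a uniformizer and `u` a unit at `P`. -/
def Place.HasOrder (P : Place K) (g : K) (m : ℤ) : Prop :=
  ∃ (t : P.localRing) (u : P.localRingˣ),
    IsLocalRing.maximalIdeal P.localRing = Ideal.span {t} ∧
      g = ((u : P.localRing) : K) * (t : K) ^ m

/-- The morphism `f = [f : 1]` takes the value `[a 0 : a 1]` at the point `P`. -/
def Place.TakesValue (P : Place K) (f : K) (a : Fin 2 → ℂ) : Prop :=
  (a 1 ≠ 0 ∧ P.localRing.valuation (f - algebraMap ℂ K (a 0 / a 1)) < 1) ∨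
    (a 1 = 0 ∧ 1 < P.localRing.valuation f)

/-- The degree `[K : ℂ(f)]` of the morphism `f` (for constant `f` the value is `0`). -/
def morphismDegree (f : K) : ℕ :=
  Module.finrank (IntermediateField.adjoin ℂ {f}) K

/-- `f^* 𝒪(1) ≅ 𝒪(D)`: the divisor `D` is linearly equivalent to the polar divisor of `f`. -/
def PullbackIso (f : K) (D : Place K →₀ ℤ) : Prop :=
  ∃ g : K, g ≠ 0 ∧ ∀ P : Place K, ∃ m : ℤ,
    P.HasOrder f m ∧ P.HasOrder g (D P - max (-m) 0)

end

end PolarPolyhedra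

end

/-! Terracini's lemma: the tangent vectors to the family of `r`-tuples `(∑ₐ pₐᵢ Lₐ ^ d)ᵢ`, at points
`p` and `L = Q`, span all `r`-tuples of forms unless some nonzero tuple `G` of forms of degree `d`
vanishes at all `Qₐ`, with `∑ᵢ pₐᵢ Gᵢ` singular at `Qₐ` for every `a`. A grove yields such a `G` for
`d = 3` and `r = 2`. For the octad take `pₐ = [1, 0]` at its first four points and `pₐ = [0, 1]` at
the others: a cubic singular at the coordinate points is a combination of squarefree monomials, and
vanishing at the other four points makes it zero; an involution of `ℙ³` exchanging the two halves
of the octad deals with `G₁`. Since spanning is an open condition on `p`, there is no grove for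
general `p`. Since the Betti numbers of points are constant on a dense open set, which meets every
fibre of a dominant family over a dense open subset of its target, a general pencil is apolar to
eight points with general Betti numbers.

For the elliptic curve, a morphism of degree `d` is a quotient `g / h` of elements of a linear
system of dimension `m`. At each place the leading coefficient is a linear functional `l` on the
system, and `f(Q) = c` forces `l(g) = c l(h)`. Hence the values of `f` at given places are rational
functions of the `2m - 1` coordinates of `[g, h]`, and cannot be algebraically independent at
`2m` places. Degree `2` has `m = 3`; in degree `4` the class `D` is fixed and `m = 4`; in degree
`3` either `m = 3`, or `g` and `h` are sections of `𝒪(4∞)` with a common zero, which amounts to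
`3 + 3 - 1` coordinates and one parameter for the zero. -/

noncomputable section

namespace PolarPolyhedra

/-! ### Generic ranks -/

section GenericRank

variable {K σ ι κ : Type*} [Field K]

theorem exists_mul_mul_eq_one_rank [Fintype ι] [Fintype κ] (M : Matrix ι κ K) :
    ∃ (B : Matrix (Fin M.rank) ι K) (D : Matrix κ (Fin M.rank) K), B * M * D = 1 := by
  classical
  let V := LinearMap.range M.mulVecLin
  let e : V ≃ₗ[K] (Fin M.rank → K) := (Module.finBasisOfFinrankEq K V rfl).equivFun
  obtain ⟨p, hp⟩ := V.subtype.exists_leftInverse_of_injective V.ker_subtype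
  obtain ⟨s, hs⟩ :=
    M.mulVecLin.rangeRestrict.exists_rightInverse_of_surjective M.mulVecLin.range_rangeRestrict
  refine ⟨LinearMap.toMatrix' (e.toLinearMap ∘ₗ p),
    LinearMap.toMatrix' (s ∘ₗ e.symm.toLinearMap), ?_⟩
  have hfactor : (e.toLinearMap ∘ₗ p) ∘ₗ M.mulVecLin ∘ₗ s ∘ₗ e.symm.toLinearMap = LinearMap.id := by
    refine LinearMap.ext fun x => ?_
    have hsx : M.mulVecLin (s (e.symm x)) = (e.symm x : ι → K) :=
      congrArg Subtype.val (LinearMap.congr_fun hs (e.symm x))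
    have hpx : p (e.symm x : ι → K) = e.symm x := LinearMap.congr_fun hp (e.symm x)
    simp only [LinearMap.comp_apply, LinearEquiv.coe_coe, hsx, hpx, LinearEquiv.apply_symm_apply,
      LinearMap.id_apply]
  rw [← LinearMap.toMatrix'_id, ← hfactor, LinearMap.toMatrix'_comp, LinearMap.toMatrix'_comp,
    ← Matrix.mul_assoc]
  congr
  exact (LinearMap.toMatrix'_toLin' M).symm

theorem exists_rank_map_eval_le [Finite ι] [Fintype κ] (A : Matrix ι κ (MvPolynomial σ K))
    (x₀ : σ → K) :
    ∃ Φ : MvPolynomial σ K, eval x₀ Φ ≠ 0 ∧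
      ∀ x, eval x Φ ≠ 0 → (A.map (eval x₀)).rank ≤ (A.map (eval x)).rank := by
  classical
  cases nonempty_fintype ι
  obtain ⟨B, D, hBD⟩ := exists_mul_mul_eq_one_rank (A.map (eval x₀))
  let N := (B.map C : Matrix _ _ (MvPolynomial σ K)) * A * (D.map C : Matrix _ _ (MvPolynomial σ K))
  have eval_det : ∀ x, eval x N.det = (B * A.map (eval x) * D).det := by
    intro x
    have hC : ⇑(eval x) ∘ ⇑(C : K →+* MvPolynomial σ K) = id := funext fun a => eval_C a
    simp only [N, RingHom.map_det, RingHom.mapMatrix_apply, Matrix.map_mul, Matrix.map_map, hC,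
      Matrix.map_id]
  refine ⟨N.det, by simp [eval_det, hBD], fun x hx => ?_⟩
  rw [eval_det] at hx
  calc (A.map (eval x₀)).rank
      = (B * A.map (eval x) * D).rank := by
        rw [Matrix.rank_of_det_ne_zero hx, Fintype.card_fin]
    _ ≤ (B * A.map (eval x)).rank := Matrix.rank_mul_le_left _ _
    _ ≤ (A.map (eval x)).rank := Matrix.rank_mul_le_right _ _

theorem exists_rank_map_eval_eq [Finite ι] [Fintype κ] (A : Matrix ι κ (MvPolynomial σ K)) :
    ∃ Φ : MvPolynomial σ K, Φ ≠ 0 ∧ ∀ x y, eval x Φ ≠ 0 → eval y Φ ≠ 0 →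
      (A.map (eval x)).rank = (A.map (eval y)).rank := by
  let ranks : Set ℕ := Set.range fun x => (A.map (eval x)).rank
  have hbdd : BddAbove ranks := ⟨Fintype.card κ, by
    rintro _ ⟨x, rfl⟩; exact Matrix.rank_le_card_width _⟩
  obtain ⟨x₀, hx₀⟩ : sSup ranks ∈ ranks := Nat.sSup_mem (Set.range_nonempty _) hbdd
  obtain ⟨Φ, hΦ₀, hΦ⟩ := exists_rank_map_eval_le A x₀
  have rank_eq : ∀ x, eval x Φ ≠ 0 → (A.map (eval x)).rank = sSup ranks := fun x hx =>
    le_antisymm (le_csSup hbdd ⟨x, rfl⟩) (hx₀ ▸ hΦ x hx)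
  exact ⟨Φ, ne_of_apply_ne (eval x₀) (by simpa using hΦ₀),
    fun x y hx hy => (rank_eq x hx).trans (rank_eq y hy).symm⟩

theorem linearIndependent_row_iff_rank_eq_card [Fintype ι] [Fintype κ] (A : Matrix ι κ K) :
    LinearIndependent K A.row ↔ A.rank = Fintype.card ι := by
  rw [linearIndependent_iff_card_eq_finrank_span, A.rank_eq_finrank_span_row, Set.finrank,
    eq_comm]

theorem linearIndependent_row_iff_mulVec_surjective [Finite ι] [Fintype κ] (A : Matrix ι κ K) :
    LinearIndependent K A.row ↔ Function.Surjective A.mulVec := by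
  cases nonempty_fintype ι
  rw [linearIndependent_row_iff_rank_eq_card, ← Module.finrank_fintype_fun_eq_card (R := K)]
  exact ⟨fun h => LinearMap.range_eq_top.1 (Submodule.eq_top_of_finrank_eq h),
    fun h => (LinearEquiv.ofTop _ (LinearMap.range_eq_top.2 h)).finrank_eq⟩

theorem exists_linearIndependent_row_map_eval [Finite ι] [Finite κ]
    {A : Matrix ι κ (MvPolynomial σ K)} {x₀ : σ → K}
    (h : LinearIndependent K (A.map (eval x₀)).row) :
    ∃ Φ : MvPolynomial σ K, Φ ≠ 0 ∧
      ∀ x, eval x Φ ≠ 0 → LinearIndependent K (A.map (eval x)).row := by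
  cases nonempty_fintype ι
  cases nonempty_fintype κ
  obtain ⟨Φ, hΦ₀, hΦ⟩ := exists_rank_map_eval_le A x₀
  refine ⟨Φ, ne_of_apply_ne (eval x₀) (by simpa using hΦ₀), fun x hx => ?_⟩
  rw [linearIndependent_row_iff_rank_eq_card] at h ⊢
  exact le_antisymm (Matrix.rank_le_card_height _) (h ▸ hΦ x hx)

theorem linearIndependent_row_of_map [Finite ι] [Finite κ] {R : Type*} [CommRing R] [IsDomain R]
    [Algebra K R] (f : R →ₐ[K] K) (A : Matrix ι κ R) (h : LinearIndependent K (A.map f).row) :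
    LinearIndependent R A.row := by
  classical
  cases nonempty_fintype ι
  cases nonempty_fintype κ
  obtain ⟨D, hD⟩ := Matrix.mulVec_surjective_iff_exists_right_inverse.1
    ((linearIndependent_row_iff_mulVec_surjective _).1 h)
  have hdet : (A * D.map (algebraMap K R)).det ≠ 0 := by
    refine ne_of_apply_ne f ?_
    have hf : ⇑f ∘ ⇑(algebraMap K R) = id := funext fun a => f.commutes a
    simp only [AlgHom.map_det, AlgHom.mapMatrix_apply, Matrix.map_mul, Matrix.map_map, hf,
      Matrix.map_id, hD, Matrix.det_one, map_zero, ne_eq, one_ne_zero, not_false_eq_true]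
  rw [← Matrix.vecMul_injective_iff]
  refine (injective_iff_map_eq_zero (Matrix.vecMulLinear A)).2 fun w hw => ?_
  refine Matrix.eq_zero_of_vecMul_eq_zero hdet ?_
  rw [← Matrix.vecMul_vecMul, show Matrix.vecMul w A = 0 from hw, Matrix.zero_vecMul]

end GenericRank

/-! ### The Jacobian criterion for dominance -/

theorem pderiv_aeval {R σ τ : Type*} [CommSemiring R] [Fintype τ] (ψ : τ → MvPolynomial σ R)
    (j : σ) (P : MvPolynomial τ R) :
    pderiv j (aeval ψ P) = ∑ t, aeval ψ (pderiv t P) * pderiv j (ψ t) := by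
  classical
  induction P using MvPolynomial.induction_on with
  | C a => simp
  | add p q hp hq => simp only [map_add, hp, hq, add_mul, Finset.sum_add_distrib]
  | mul_X p t hp =>
    simp only [Derivation.leibniz, pderiv_X, smul_eq_mul, map_add, map_mul, aeval_X, hp, add_mul,
      Finset.sum_add_distrib, Finset.mul_sum, Pi.single_apply, mul_assoc]
    simp

theorem totalDegree_pderiv_le {R σ : Type*} [CommSemiring R] (P : MvPolynomial σ R) (j : σ) :
    (pderiv j P).totalDegree ≤ P.totalDegree - 1 := by
  classical
  refine Finset.sup_le fun m hm => ?_
  rw [mem_support_iff, coeff_pderiv] at hm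
  have hle := le_totalDegree (mem_support_iff.2 (left_ne_zero_of_mul hm))
  rw [Finsupp.sum_add_index' (fun _ => rfl) fun _ _ _ => rfl, Finsupp.sum_single_index rfl] at hle
  omega

theorem eq_C_of_pderiv_eq_zero {R σ : Type*} [CommRing R] [IsDomain R] [CharZero R]
    {P : MvPolynomial σ R} (h : ∀ j, pderiv j P = 0) : P = C (coeff 0 P) := by
  classical
  ext m
  rw [coeff_C]
  split_ifs with hm
  · rw [hm]
  obtain ⟨j, hj⟩ : ∃ j, m j ≠ 0 := by
    by_contra! hcon
    exact hm (Finsupp.ext fun j => (hcon j).symm)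
  have hcoeff := coeff_pderiv (i := j) P (m - Finsupp.single j 1)
  rw [h j, coeff_zero, tsub_add_cancel_of_le (by simpa using Nat.one_le_iff_ne_zero.2 hj)]
    at hcoeff
  exact (mul_eq_zero.1 hcoeff.symm).resolve_right (Nat.cast_add_one_ne_zero _)

theorem algebraicIndependent_of_linearIndependent_pderiv {K σ τ : Type*} [Field K] [CharZero K]
    [Finite σ] [Finite τ] (ψ : τ → MvPolynomial σ K) (x₀ : σ → K)
    (h : LinearIndependent K fun t j => eval x₀ (pderiv j (ψ t))) : AlgebraicIndependent K ψ := by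
  cases nonempty_fintype τ
  let J : Matrix τ σ (MvPolynomial σ K) := Matrix.of fun t j => pderiv j (ψ t)
  have hJ : Function.Injective J.vecMul :=
    Matrix.vecMul_injective_iff.2 (linearIndependent_row_of_map (aeval x₀) J h)
  rw [algebraicIndependent_iff]
  intro P
  induction hd : P.totalDegree using Nat.strong_induction_on generalizing P with | _ d ih
  intro hP
  have aeval_pderiv : (fun t => aeval ψ (pderiv t P)) = 0 := by
    refine hJ (funext fun j => ?_)
    change Matrix.vecMul _ J j = Matrix.vecMul 0 J j
    rw [Matrix.zero_vecMul, Pi.zero_apply, ← map_zero (pderiv j), ← hP, pderiv_aeval]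
    rfl
  have hconst : P = C (coeff 0 P) := by
    by_cases h0 : P.totalDegree = 0
    · exact totalDegree_eq_zero_iff_eq_C.1 h0
    · refine eq_C_of_pderiv_eq_zero fun t => ih _ ?_ _ rfl (congrFun aeval_pderiv t)
      have := totalDegree_pderiv_le P t
      omega
  rw [hconst] at hP ⊢
  simpa using hP

theorem exists_basicOpen_subset_of_isConstructible {A : Type*} [CommRing A] [IsDomain A]
    {S : Set (PrimeSpectrum A)} (hS : Topology.IsConstructible S) (hbot : ⊥ ∈ S) :
    ∃ u : A, u ≠ 0 ∧ (PrimeSpectrum.basicOpen u : Set (PrimeSpectrum A)) ⊆ S := by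
  obtain ⟨data, rfl⟩ := PrimeSpectrum.exists_constructibleSetData_iff.2 hS
  simp only [PrimeSpectrum.ConstructibleSetData.toSet, Set.mem_iUnion] at hbot ⊢
  obtain ⟨D, hD, hzero, hne⟩ := hbot
  have hg : ∀ i, D.g i = 0 := fun i => by simpa using hzero (Set.mem_range_self i)
  refine ⟨D.f, fun h0 => hne (by simp [h0]), fun q hq => Set.mem_iUnion₂.2 ⟨D, hD, ?_, ?_⟩⟩
  · rintro _ ⟨i, rfl⟩
    simp [hg]
  · simpa [PrimeSpectrum.mem_basicOpen] using hq

theorem exists_forall_exists_eval_eq_of_algebraicIndependent {K σ τ : Type*} [Field K]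
    [IsAlgClosed K] [Finite σ] [Finite τ] {ψ : τ → MvPolynomial σ K}
    (hψ : AlgebraicIndependent K ψ) {v : MvPolynomial σ K} (hv : v ≠ 0) :
    ∃ u : MvPolynomial τ K, u ≠ 0 ∧ ∀ y : τ → K, eval y u ≠ 0 →
      ∃ x : σ → K, (∀ t, eval x (ψ t) = y t) ∧ eval x v ≠ 0 := by
  let f : MvPolynomial τ K →+* MvPolynomial σ K := (aeval ψ).toRingHom
  have hf : f.FinitePresentation := by
    refine RingHom.FinitePresentation.of_finiteType.1
      (RingHom.FiniteType.of_comp_finiteType (f := C) ?_)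
    rw [show f.comp C = algebraMap K (MvPolynomial σ K) by ext; simp [f]]
    exact RingHom.finiteType_algebraMap.2 inferInstance
  have hgeneric : ⊥ ∈ PrimeSpectrum.comap f '' (PrimeSpectrum.basicOpen v : Set _) :=
    ⟨⊥, by simpa [PrimeSpectrum.mem_basicOpen] using hv,
      PrimeSpectrum.ext (Ideal.ext fun P => map_eq_zero_iff f hψ)⟩
  obtain ⟨u, hu, husub⟩ := exists_basicOpen_subset_of_isConstructible
    (PrimeSpectrum.isConstructible_comap_image hf PrimeSpectrum.isConstructible_basicOpen)
    hgeneric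
  refine ⟨u, hu, fun y hy => ?_⟩
  obtain ⟨q, hqv, hqy⟩ :=
    husub (show ⟨RingHom.ker (eval y), RingHom.ker_isPrime _⟩ ∈ PrimeSpectrum.basicOpen u from hy)
  have hx : ∃ x ∈ zeroLocus K q.asIdeal, aeval x v ≠ 0 := by
    have hvq : v ∉ q.asIdeal := hqv
    rw [← IsPrime.vanishingIdeal_zeroLocus (K := K) q.asIdeal, mem_vanishingIdeal_iff] at hvq
    push Not at hvq
    exact hvq
  obtain ⟨x, hxq, hxv⟩ := hx
  refine ⟨x, fun t => ?_, by simpa [aeval_eq_eval] using hxv⟩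
  have hXt : f (X t - C (y t)) ∈ q.asIdeal := by
    have hker : X t - C (y t) ∈ RingHom.ker (eval y) := by simp
    rwa [show RingHom.ker (eval y) = Ideal.comap f q.asIdeal from
      (congrArg PrimeSpectrum.asIdeal hqy).symm] at hker
  simpa [f, aeval_eq_eval, sub_eq_zero] using hxq _ hXt

/-! ### Forms and their values -/

section Forms

variable {σ R : Type*} [CommSemiring R] {d : ℕ}

theorem eval_smul_of_isHomogeneous {f : MvPolynomial σ R} (hf : f.IsHomogeneous d) (t : R)
    (x : σ → R) : eval (t • x) f = t ^ d * eval x f := by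
  rw [eval_eq, eval_eq, Finset.mul_sum]
  refine Finset.sum_congr rfl fun m hm => ?_
  simp only [Pi.smul_apply, smul_eq_mul, mul_pow, Finset.prod_mul_distrib,
    Finset.prod_pow_eq_pow_sum, ← hf.degree_eq_sum_deg_support hm]
  ring

variable [Finite σ]

instance fintypeDegreeEq (d : ℕ) : Fintype {m : σ →₀ ℕ // m.degree = d} :=
  @Fintype.ofFinite _ (Finsupp.finite_of_degree_eq d).to_subtype

/-- The form of degree `d` with coefficients `c`. -/
def formOf : ({m : σ →₀ ℕ // m.degree = d} → R) →ₗ[R] MvPolynomial σ R :=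
  Fintype.linearCombination R fun m => monomial m.1 1

theorem formOf_apply (c : {m : σ →₀ ℕ // m.degree = d} → R) :
    formOf c = ∑ m, c m • monomial m.1 1 := rfl

theorem coeff_formOf (c : {m : σ →₀ ℕ // m.degree = d} → R) (m : {m : σ →₀ ℕ // m.degree = d}) :
    (formOf c).coeff m.1 = c m := by
  classical
  simp [formOf_apply, coeff_sum, coeff_monomial, Subtype.coe_inj]

theorem isHomogeneous_formOf (c : {m : σ →₀ ℕ // m.degree = d} → R) :
    (formOf c).IsHomogeneous d := by
  refine IsHomogeneous.sum _ _ _ fun m _ => ?_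
  rw [smul_monomial]
  exact isHomogeneous_monomial _ m.2

theorem formOf_coeff {F : MvPolynomial σ R} (hF : F.IsHomogeneous d) :
    formOf (fun m : {m : σ →₀ ℕ // m.degree = d} => F.coeff m.1) = F := by
  ext m
  by_cases hm : m.degree = d
  · exact coeff_formOf _ ⟨m, hm⟩
  · rw [(isHomogeneous_formOf _).coeff_eq_zero hm, hF.coeff_eq_zero hm]

theorem eval_formOf (c : {m : σ →₀ ℕ // m.degree = d} → R) (x : σ → R) :
    eval x (formOf c) = ∑ m, c m * eval x (monomial m.1 1) := by
  simp only [formOf_apply, map_sum, smul_eval]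

end Forms

/-! ### The ideal of a set of points -/

section Points

variable {n s : ℕ} {L : Fin s → Fin (n + 1) → ℂ}

theorem mem_pointsIdeal_of_isHomogeneous {f : MvPolynomial (Fin (n + 1)) ℂ} {k : ℕ}
    (hf : f.IsHomogeneous k) (h : ∀ a, eval (L a) f = 0) : f ∈ pointsIdeal L :=
  Ideal.subset_span ⟨⟨k, hf⟩, h⟩

theorem eval_eq_zero_of_mem_pointsIdeal {f : MvPolynomial (Fin (n + 1)) ℂ}
    (hf : f ∈ pointsIdeal L) (a : Fin s) : eval (L a) f = 0 := by
  have hle : pointsIdeal L ≤ RingHom.ker (eval (L a)) := Ideal.span_le.2 fun g hg => hg.2 a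
  exact hle hf

attribute [local instance] MvPolynomial.gradedAlgebra in
theorem homogeneousComponent_mem_pointsIdeal {f : MvPolynomial (Fin (n + 1)) ℂ}
    (hf : f ∈ pointsIdeal L) (k : ℕ) : homogeneousComponent k f ∈ pointsIdeal L :=
  homogeneousComponent_mem_of_mem (Ideal.homogeneous_span _ _ fun _ hg => hg.1) hf k

theorem mem_pointsIdeal_iff {f : MvPolynomial (Fin (n + 1)) ℂ} :
    f ∈ pointsIdeal L ↔ ∀ a k, eval (L a) (homogeneousComponent k f) = 0 := by
  refine ⟨fun hf a k => eval_eq_zero_of_mem_pointsIdeal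
    (homogeneousComponent_mem_pointsIdeal hf k) a, fun h => ?_⟩
  rw [← sum_homogeneousComponent f]
  exact Ideal.sum_mem _ fun k _ => mem_pointsIdeal_of_isHomogeneous
    (homogeneousComponent_isHomogeneous k f) fun a => h a k

attribute [local instance] MvPolynomial.gradedAlgebra in
theorem homogeneousComponent_mul_of_isHomogeneous {σ R : Type*} [CommSemiring R]
    {g : MvPolynomial σ R} {j : ℕ} (hg : g.IsHomogeneous j) (f : MvPolynomial σ R) (k : ℕ) :
    homogeneousComponent (j + k) (g * f) = g * homogeneousComponent k f := by
  simp only [← decomposition.decompose'_apply]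
  exact DirectSum.coe_decompose_mul_add_of_left_mem (homogeneousSubmodule σ R) hg

theorem exists_isHomogeneous_one_eval_eq_one {σ K : Type*} [Field K] {x : σ → K} (hx : x ≠ 0) :
    ∃ l : MvPolynomial σ K, l.IsHomogeneous 1 ∧ eval x l = 1 := by
  obtain ⟨k, hk⟩ := Function.ne_iff.1 hx
  exact ⟨C (x k)⁻¹ * X k, isHomogeneous_C_mul_X _ _, by simp [inv_mul_cancel₀ hk]⟩

theorem isSaturated_pointsIdeal (hL : ∀ a, L a ≠ 0) : IsSaturated (pointsIdeal L) := by
  rintro f ⟨j, hj⟩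
  refine mem_pointsIdeal_iff.2 fun a k => ?_
  obtain ⟨l, hl, hla⟩ := exists_isHomogeneous_one_eval_eq_one (hL a)
  have hlj : (l ^ j).IsHomogeneous j := by simpa using hl.pow j
  have heval := mem_pointsIdeal_iff.1 (hj _ hlj) a (j + k)
  rwa [homogeneousComponent_mul_of_isHomogeneous hlj, map_mul, map_pow, hla, one_pow,
    one_mul] at heval

/-- The points `L a` impose independent conditions on forms of degree `k`. -/
def ImposeIndependentConditions (L : Fin s → Fin (n + 1) → ℂ) (k : ℕ) : Prop :=
  ∀ w : Fin s → ℂ, ∃ f : MvPolynomial (Fin (n + 1)) ℂ, f.IsHomogeneous k ∧ ∀ a, eval (L a) f = w a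

theorem ImposeIndependentConditions.ne_zero {k : ℕ} (h : ImposeIndependentConditions L k)
    (hk : k ≠ 0) (a : Fin s) : L a ≠ 0 := by
  intro hLa
  obtain ⟨f, hf, hfa⟩ := h 1
  have heval := eval_smul_of_isHomogeneous hf 0 (L a)
  rw [zero_smul, zero_pow hk, zero_mul, ← hLa, hfa] at heval
  exact one_ne_zero heval

theorem ImposeIndependentConditions.mono {k l : ℕ} (h : ImposeIndependentConditions L k)
    (hL : ∀ a, L a ≠ 0) (hkl : k ≤ l) : ImposeIndependentConditions L l := by
  intro w
  choose q hq hqa using fun a : Fin s => h (Pi.single a (w a))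
  choose m hm hma using fun a : Fin s => exists_isHomogeneous_one_eval_eq_one (hL a)
  refine ⟨∑ a, q a * m a ^ (l - k), IsHomogeneous.sum _ _ _ fun a _ => ?_, fun b => ?_⟩
  · have := (hq a).mul ((hm a).pow (l - k))
    rwa [one_mul, Nat.add_sub_cancel' hkl] at this
  · rw [map_sum, Finset.sum_eq_single b]
    · rw [map_mul, map_pow, hqa, hma, Pi.single_eq_same, one_pow, mul_one]
    · intro a _ hab
      rw [map_mul, hqa, Pi.single_eq_of_ne hab.symm, zero_mul]
    · simp

/-- Evaluation of a matrix with entries polynomial in `s` points at a tuple of points. -/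
abbrev atPoints {ι κ : Type*} (A : Matrix ι κ (MvPolynomial (Fin s × Fin (n + 1)) ℂ))
    (L : Fin s → Fin (n + 1) → ℂ) : Matrix ι κ ℂ :=
  A.map (eval fun q => L q.1 q.2)

/-- The matrix, polynomial in the points, of the map sending a form of degree `d` to its values at
the points. -/
def valueMatrix (n s d : ℕ) : Matrix (Fin s) {m : Fin (n + 1) →₀ ℕ // m.degree = d}
    (MvPolynomial (Fin s × Fin (n + 1)) ℂ) :=
  Matrix.of fun a m => rename (Prod.mk a) (monomial m.1 1)

theorem valueMatrix_mulVec (L : Fin s → Fin (n + 1) → ℂ) {d : ℕ}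
    (v : {m : Fin (n + 1) →₀ ℕ // m.degree = d} → ℂ) (a : Fin s) :
    (atPoints (valueMatrix n s d) L).mulVec v a = eval (L a) (formOf v) := by
  rw [eval_formOf]
  refine Finset.sum_congr rfl fun m _ => ?_
  simp only [valueMatrix, Matrix.map_apply, Matrix.of_apply, eval_rename]
  exact mul_comm _ _

theorem imposeIndependentConditions_iff_linearIndependent {k : ℕ} :
    ImposeIndependentConditions L k ↔
      LinearIndependent ℂ (atPoints (valueMatrix n s k) L).row := by
  rw [linearIndependent_row_iff_mulVec_surjective]
  constructor
  · intro h w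
    obtain ⟨f, hf, hfw⟩ := h w
    exact ⟨fun m => f.coeff m.1, funext fun a => by rw [valueMatrix_mulVec, formOf_coeff hf, hfw]⟩
  · intro h w
    obtain ⟨v, rfl⟩ := h w
    exact ⟨formOf v, isHomogeneous_formOf v, fun a => (valueMatrix_mulVec L v a).symm⟩

theorem exists_forall_imposeIndependentConditions {L₀ : Fin s → Fin (n + 1) → ℂ} {k : ℕ}
    (h₀ : ImposeIndependentConditions L₀ k) :
    ∃ Φ : MvPolynomial (Fin s × Fin (n + 1)) ℂ, Φ ≠ 0 ∧
      ∀ L : Fin s → Fin (n + 1) → ℂ, eval (fun q => L q.1 q.2) Φ ≠ 0 →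
        ImposeIndependentConditions L k := by
  obtain ⟨Φ, hΦ, hrow⟩ := exists_linearIndependent_row_map_eval
    (imposeIndependentConditions_iff_linearIndependent.1 h₀)
  exact ⟨Φ, hΦ, fun L hL => imposeIndependentConditions_iff_linearIndependent.2 (hrow _ hL)⟩

theorem mem_quotientPiece {I : Ideal (MvPolynomial (Fin (n + 1)) ℂ)} {k : ℕ}
    {x : MvPolynomial (Fin (n + 1)) ℂ ⧸ I} :
    x ∈ quotientPiece I k ↔ ∃ f : MvPolynomial (Fin (n + 1)) ℂ, f.IsHomogeneous k ∧
      Ideal.Quotient.mk I f = x := Iff.rfl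

/-- Evaluation of the homogeneous coordinate ring at the chosen representatives of the points. -/
def evalQuotient (L : Fin s → Fin (n + 1) → ℂ) :
    (MvPolynomial (Fin (n + 1)) ℂ ⧸ pointsIdeal L) →ₐ[ℂ] (Fin s → ℂ) :=
  Ideal.Quotient.liftₐ _ (AlgHom.pi fun a => aeval (L a)) fun f hf => by
    funext a
    exact eval_eq_zero_of_mem_pointsIdeal hf a

theorem evalQuotient_mk (f : MvPolynomial (Fin (n + 1)) ℂ) (a : Fin s) :
    evalQuotient L (Ideal.Quotient.mk _ f) a = eval (L a) f := rfl

theorem eq_zero_of_evalQuotient_eq_zero {k : ℕ} {x : MvPolynomial (Fin (n + 1)) ℂ ⧸ pointsIdeal L}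
    (hx : x ∈ quotientPiece (pointsIdeal L) k) (h : evalQuotient L x = 0) : x = 0 := by
  obtain ⟨f, hf, rfl⟩ := mem_quotientPiece.1 hx
  exact Ideal.Quotient.eq_zero_iff_mem.2 (mem_pointsIdeal_of_isHomogeneous hf (congrFun h))

theorem finrank_map_of_forall_eq_zero {R V W : Type*} [Ring R] [AddCommGroup V] [Module R V]
    [AddCommGroup W] [Module R W] (f : V →ₗ[R] W) (N : Submodule R V)
    (h : ∀ x ∈ N, f x = 0 → x = 0) : Module.finrank R (N.map f) = Module.finrank R N := by
  rw [← LinearMap.range_domRestrict]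
  exact LinearMap.finrank_range_of_inj
    ((injective_iff_map_eq_zero _).2 fun x hx => Subtype.ext (h x x.2 hx))

theorem isZeroDimScheme_pointsIdeal {k : ℕ} (h : ImposeIndependentConditions L k)
    (hL : ∀ a, L a ≠ 0) : IsZeroDimScheme s (pointsIdeal L) where
  homogeneous _ hf k := homogeneousComponent_mem_pointsIdeal hf k
  saturated := isSaturated_pointsIdeal hL
  length := by
    refine ⟨k, fun l hl => ?_⟩
    have hmap : (quotientPiece (pointsIdeal L) l).map (evalQuotient L).toLinearMap = ⊤ := by
      refine eq_top_iff.2 fun w _ => ?_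
      obtain ⟨f, hf, hfw⟩ := h.mono hL hl w
      exact ⟨_, mem_quotientPiece.2 ⟨f, hf, rfl⟩, funext hfw⟩
    rw [← finrank_map_of_forall_eq_zero (evalQuotient L).toLinearMap _
      fun x hx => eq_zero_of_evalQuotient_eq_zero hx, hmap, finrank_top, Module.finrank_fin_fun]

end Points

/-! ### The Koszul complex -/

section Koszul

variable {n : ℕ} {I : Ideal (MvPolynomial (Fin (n + 1)) ℂ)} {i j : ℕ}
  {c : Finset (Fin (n + 1)) → MvPolynomial (Fin (n + 1)) ℂ ⧸ I}

theorem koszulD_apply (T : Finset (Fin (n + 1))) : koszulD I c T = ∑ k ∈ Tᶜ,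
    (-1) ^ (T.filter fun t => t < k).card * (Ideal.Quotient.mk I (X k) * c (insert k T)) := rfl

theorem neg_one_pow_card_filter_lt_mul {α R : Type*} [LinearOrder α] [CommRing R] {T : Finset α}
    {k l : α} (hk : k ∉ T) (hl : l ∉ T) (hkl : k ≠ l) :
    (-1 : R) ^ (T.filter fun t => t < k).card * (-1) ^ ((insert k T).filter fun t => t < l).card =
      -((-1) ^ (T.filter fun t => t < l).card *
        (-1) ^ ((insert l T).filter fun t => t < k).card) := by
  wlog hlt : k < l generalizing k l
  · rw [this hl hk hkl.symm (hkl.lt_or_gt.resolve_left hlt), neg_neg]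
  rw [Finset.filter_insert, Finset.filter_insert, if_pos hlt, if_neg hlt.not_gt,
    Finset.card_insert_of_notMem (by simp [hk])]
  ring

theorem koszulD_koszulD (c : Finset (Fin (n + 1)) → MvPolynomial (Fin (n + 1)) ℂ ⧸ I) :
    koszulD I (koszulD I c) = 0 := by
  funext T
  simp only [koszulD_apply, Finset.mul_sum]
  rw [Finset.sum_sigma']
  refine Finset.sum_involution (fun x _ => ⟨x.2, x.1⟩) ?_ ?_ ?_ fun _ _ => rfl
  · rintro ⟨k, l⟩ hkl
    obtain ⟨hk, hlk, hl⟩ : k ∉ T ∧ l ≠ k ∧ l ∉ T := by simpa using hkl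
    rw [Finset.insert_comm l k]
    have hsign := neg_one_pow_card_filter_lt_mul (R := MvPolynomial (Fin (n + 1)) ℂ ⧸ I) hk hl
      hlk.symm
    linear_combination (Ideal.Quotient.mk I (X k) * Ideal.Quotient.mk I (X l) *
      c (insert k (insert l T))) * hsign
  · rintro ⟨k, l⟩ hkl _ heq
    obtain ⟨-, hlk, -⟩ : k ∉ T ∧ l ≠ k ∧ l ∉ T := by simpa using hkl
    exact hlk (congrArg Sigma.fst heq)
  · rintro ⟨k, l⟩ hkl
    obtain ⟨hk, hlk, hl⟩ : k ∉ T ∧ l ≠ k ∧ l ∉ T := by simpa using hkl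
    simp [hk, hl, hlk.symm]

theorem mem_koszulChain : c ∈ koszulChain I i j ↔
    ∀ T, (T.card = i ∧ i ≤ j → c T ∈ quotientPiece I (j - i)) ∧
      (¬(T.card = i ∧ i ≤ j) → c T = 0) := by
  simp only [koszulChain, Submodule.mem_pi, Set.mem_univ, true_imp_iff]
  refine forall_congr' fun T => ?_
  split_ifs with h <;> simp [h]

theorem mem_quotientPiece_of_mem_koszulChain (hc : c ∈ koszulChain I i j)
    (T : Finset (Fin (n + 1))) : c T ∈ quotientPiece I (j - i) := by
  by_cases h : T.card = i ∧ i ≤ j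
  · exact (mem_koszulChain.1 hc T).1 h
  · rw [(mem_koszulChain.1 hc T).2 h]
    exact zero_mem _

theorem X_mul_mem_quotientPiece {d : ℕ} {x : MvPolynomial (Fin (n + 1)) ℂ ⧸ I}
    (hx : x ∈ quotientPiece I d) (k : Fin (n + 1)) :
    Ideal.Quotient.mk I (X k) * x ∈ quotientPiece I (d + 1) := by
  obtain ⟨f, hf, rfl⟩ := mem_quotientPiece.1 hx
  exact mem_quotientPiece.2
    ⟨X k * f, by simpa [add_comm] using (isHomogeneous_X ℂ k).mul hf, map_mul _ _ _⟩

theorem koszulD_mem_quotientPiece (hc : c ∈ koszulChain I i j) (T : Finset (Fin (n + 1))) :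
    koszulD I c T ∈ quotientPiece I (j - i + 1) := by
  refine Submodule.sum_mem _ fun k _ => ?_
  have hmem := X_mul_mem_quotientPiece (mem_quotientPiece_of_mem_koszulChain hc (insert k T)) k
  rcases neg_one_pow_eq_or (MvPolynomial (Fin (n + 1)) ℂ ⧸ I) (T.filter fun t => t < k).card
    with h | h
  · rwa [h, one_mul]
  · rw [h, neg_one_mul]
    exact neg_mem hmem

theorem koszulD_mem_koszulChain (hc : c ∈ koszulChain I (i + 1) j) :
    koszulD I c ∈ koszulChain I i j := by
  have eq_zero : ∀ T, ¬(T.card = i ∧ i + 1 ≤ j) → koszulD I c T = 0 := by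
    intro T hT
    refine Finset.sum_eq_zero fun k hk => ?_
    rw [(mem_koszulChain.1 hc _).2, mul_zero, mul_zero]
    rw [Finset.card_insert_of_notMem (Finset.mem_compl.1 hk)]
    omega
  refine mem_koszulChain.2 fun T => ⟨fun hT => ?_, fun hT => eq_zero T (by omega)⟩
  by_cases h : i + 1 ≤ j
  · have := koszulD_mem_quotientPiece hc T
    rwa [show j - (i + 1) + 1 = j - i by omega] at this
  · rw [eq_zero T (by omega)]
    exact zero_mem _

theorem map_koszulD_koszulChain_le (I : Ideal (MvPolynomial (Fin (n + 1)) ℂ)) (i j : ℕ) :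
    (koszulChain I (i + 1) j).map (koszulD I) ≤
      koszulChain I i j ⊓ LinearMap.ker (koszulD I) := by
  rintro _ ⟨c, hc, rfl⟩
  exact ⟨koszulD_mem_koszulChain hc, koszulD_koszulD c⟩

theorem finrank_quotient_submoduleOf {K V : Type*} [DivisionRing K] [AddCommGroup V] [Module K V]
    {B Z : Submodule K V} [FiniteDimensional K Z] (h : B ≤ Z) :
    Module.finrank K (Z ⧸ B.submoduleOf Z) = Module.finrank K Z - Module.finrank K B := by
  rw [← (Submodule.submoduleOfEquivOfLe h).finrank_eq, Submodule.finrank_quotient]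

theorem finrank_inf_ker {K V W : Type*} [DivisionRing K] [AddCommGroup V] [Module K V]
    [AddCommGroup W] [Module K W] (f : V →ₗ[K] W) (N : Submodule K V) [FiniteDimensional K N] :
    Module.finrank K (N ⊓ LinearMap.ker f : Submodule K V) =
      Module.finrank K N - Module.finrank K (N.map f) := by
  have hrank := LinearMap.finrank_range_add_finrank_ker (f.domRestrict N)
  rw [LinearMap.range_domRestrict, LinearMap.ker_domRestrict, ← Submodule.finrank_map_subtype_eq,
    Submodule.map_comap_subtype] at hrank
  omega

theorem bettiNumber_eq_finrank [FiniteDimensional ℂ (koszulChain I i j)] :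
    bettiNumber I i j = Module.finrank ℂ (koszulChain I i j) -
      Module.finrank ℂ ((koszulChain I i j).map (koszulD I)) -
      Module.finrank ℂ ((koszulChain I (i + 1) j).map (koszulD I)) := by
  have := Submodule.finiteDimensional_inf_left (koszulChain I i j) (LinearMap.ker (koszulD I))
  rw [bettiNumber, finrank_quotient_submoduleOf (map_koszulD_koszulChain_le I i j),
    finrank_inf_ker]

end Koszul

/-! ### Betti numbers of general points -/

section BettiPoints

variable {n s : ℕ}

/-- Evaluation of the Koszul complex of the homogeneous coordinate ring at the points. -/
def evalKoszul (L : Fin s → Fin (n + 1) → ℂ) :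
    (Finset (Fin (n + 1)) → MvPolynomial (Fin (n + 1)) ℂ ⧸ pointsIdeal L) →ₗ[ℂ]
      (Finset (Fin (n + 1)) × Fin s → ℂ) where
  toFun c q := evalQuotient L (c q.1) q.2
  map_add' c c' := by funext q; simp
  map_smul' a c := by funext q; simp

theorem evalKoszul_apply (L : Fin s → Fin (n + 1) → ℂ)
    (c : Finset (Fin (n + 1)) → MvPolynomial (Fin (n + 1)) ℂ ⧸ pointsIdeal L)
    (T : Finset (Fin (n + 1))) (a : Fin s) : evalKoszul L c (T, a) = evalQuotient L (c T) a := rfl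

theorem eq_zero_of_evalKoszul_eq_zero {L : Fin s → Fin (n + 1) → ℂ} {d : ℕ}
    {c : Finset (Fin (n + 1)) → MvPolynomial (Fin (n + 1)) ℂ ⧸ pointsIdeal L}
    (hc : ∀ T, c T ∈ quotientPiece (pointsIdeal L) d) (h : evalKoszul L c = 0) : c = 0 :=
  funext fun T => eq_zero_of_evalQuotient_eq_zero (hc T) (funext fun a => congrFun h (T, a))

/-- The matrix, polynomial in the points, that evaluates a Koszul chain with polynomial entries. -/
def chainMatrix (n s i j : ℕ) : Matrix (Finset (Fin (n + 1)) × Fin s)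
    (Finset (Fin (n + 1)) × {m : Fin (n + 1) →₀ ℕ // m.degree = j - i})
    (MvPolynomial (Fin s × Fin (n + 1)) ℂ) :=
  Matrix.of fun p q => if p.1 = q.1 ∧ p.1.card = i ∧ i ≤ j then
    valueMatrix n s (j - i) p.2 q.2 else 0

/-- The matrix, polynomial in the points, of the evaluated Koszul differential. -/
def differentialMatrix (n s : ℕ) : Matrix (Finset (Fin (n + 1)) × Fin s)
    (Finset (Fin (n + 1)) × Fin s) (MvPolynomial (Fin s × Fin (n + 1)) ℂ) :=
  Matrix.of fun p q => ∑ k ∈ p.1ᶜ, if (insert k p.1, p.2) = q then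
    (-1) ^ (p.1.filter fun t => t < k).card * X (p.2, k) else 0

theorem chainMatrix_mulVec (L : Fin s → Fin (n + 1) → ℂ) (i j : ℕ)
    (v : Finset (Fin (n + 1)) × {m : Fin (n + 1) →₀ ℕ // m.degree = j - i} → ℂ)
    (T : Finset (Fin (n + 1))) (a : Fin s) :
    (atPoints (chainMatrix n s i j) L).mulVec v (T, a) =
      if T.card = i ∧ i ≤ j then eval (L a) (formOf fun m => v (T, m)) else 0 := by
  rw [← valueMatrix_mulVec]
  simp only [Matrix.mulVec, dotProduct, Fintype.sum_prod_type, chainMatrix, Matrix.map_apply,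
    Matrix.of_apply, apply_ite (eval _), map_zero, ite_mul, zero_mul, ite_and]
  split_ifs <;> simp

theorem differentialMatrix_mulVec (L : Fin s → Fin (n + 1) → ℂ)
    (v : Finset (Fin (n + 1)) × Fin s → ℂ) (T : Finset (Fin (n + 1))) (a : Fin s) :
    (atPoints (differentialMatrix n s) L).mulVec v (T, a) =
      ∑ k ∈ Tᶜ, (-1) ^ (T.filter fun t => t < k).card * (L a k * v (insert k T, a)) := by
  simp only [Matrix.mulVec, dotProduct, differentialMatrix, Matrix.map_apply, Matrix.of_apply,
    map_sum, Finset.sum_mul]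
  rw [Finset.sum_comm]
  refine Finset.sum_congr rfl fun k _ => ?_
  simp only [apply_ite (eval _), map_mul, map_pow, map_neg, map_one, eval_X, map_zero, ite_mul,
    zero_mul, Finset.sum_ite_eq, Finset.mem_univ, if_true, mul_assoc]

theorem evalKoszul_koszulD (L : Fin s → Fin (n + 1) → ℂ)
    (c : Finset (Fin (n + 1)) → MvPolynomial (Fin (n + 1)) ℂ ⧸ pointsIdeal L) :
    evalKoszul L (koszulD (pointsIdeal L) c) =
      (atPoints (differentialMatrix n s) L).mulVec (evalKoszul L c) := by
  funext ⟨T, a⟩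
  rw [differentialMatrix_mulVec, evalKoszul_apply]
  simp only [koszulD_apply, map_sum, map_mul, map_pow, map_neg, map_one, Finset.sum_apply,
    Pi.mul_apply, Pi.pow_apply, Pi.neg_apply, Pi.one_apply, evalQuotient_mk, eval_X,
    evalKoszul_apply]

theorem map_evalKoszul_koszulChain (L : Fin s → Fin (n + 1) → ℂ) (i j : ℕ) :
    (koszulChain (pointsIdeal L) i j).map (evalKoszul L) =
      LinearMap.range (atPoints (chainMatrix n s i j) L).mulVecLin := by
  apply le_antisymm
  · rintro _ ⟨c, hc, rfl⟩
    choose f hf hfc using fun T => mem_quotientPiece.1 (mem_quotientPiece_of_mem_koszulChain hc T)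
    refine ⟨fun q => (f q.1).coeff q.2.1, ?_⟩
    funext ⟨T, a⟩
    rw [Matrix.mulVecLin_apply, chainMatrix_mulVec, evalKoszul_apply, ← hfc]
    split_ifs with h
    · rw [formOf_coeff (hf T), evalQuotient_mk]
    · rw [hfc, (mem_koszulChain.1 hc T).2 h, map_zero, Pi.zero_apply]
  · rintro _ ⟨v, rfl⟩
    refine ⟨fun T => if T.card = i ∧ i ≤ j then
      Ideal.Quotient.mk _ (formOf fun m => v (T, m)) else 0, ?_, ?_⟩
    · refine mem_koszulChain.2 fun T => ⟨fun h => ?_, fun h => if_neg h⟩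
      rw [if_pos h]
      exact mem_quotientPiece.2 ⟨_, isHomogeneous_formOf _, rfl⟩
    · funext ⟨T, a⟩
      rw [Matrix.mulVecLin_apply, chainMatrix_mulVec, evalKoszul_apply]
      split_ifs with h
      · rfl
      · rw [map_zero, Pi.zero_apply]

theorem finrank_koszulChain (L : Fin s → Fin (n + 1) → ℂ) (i j : ℕ) :
    Module.finrank ℂ (koszulChain (pointsIdeal L) i j) =
      (atPoints (chainMatrix n s i j) L).rank := by
  rw [← finrank_map_of_forall_eq_zero (evalKoszul L) _ fun c hc =>
    eq_zero_of_evalKoszul_eq_zero (mem_quotientPiece_of_mem_koszulChain hc),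
    map_evalKoszul_koszulChain]
  rfl

theorem finrank_map_koszulD (L : Fin s → Fin (n + 1) → ℂ) (i j : ℕ) :
    Module.finrank ℂ ((koszulChain (pointsIdeal L) i j).map (koszulD (pointsIdeal L))) =
      (atPoints (differentialMatrix n s * chainMatrix n s i j) L).rank := by
  have hcomm : (evalKoszul L).comp (koszulD (pointsIdeal L)) =
      (atPoints (differentialMatrix n s) L).mulVecLin.comp (evalKoszul L) :=
    LinearMap.ext fun c => evalKoszul_koszulD L c
  rw [← finrank_map_of_forall_eq_zero (evalKoszul L), ← Submodule.map_comp, hcomm,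
    Submodule.map_comp, map_evalKoszul_koszulChain, ← LinearMap.range_comp,
    ← Matrix.mulVecLin_mul, ← Matrix.map_mul, Matrix.rank]
  rintro _ ⟨c, hc, rfl⟩
  exact eq_zero_of_evalKoszul_eq_zero (koszulD_mem_quotientPiece hc)

instance finiteDimensional_koszulChain (L : Fin s → Fin (n + 1) → ℂ) (i j : ℕ) :
    FiniteDimensional ℂ (koszulChain (pointsIdeal L) i j) :=
  Module.Finite.of_injective ((evalKoszul L).domRestrict (koszulChain (pointsIdeal L) i j))
    ((injective_iff_map_eq_zero _).2 fun x hx => Subtype.ext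
      (eq_zero_of_evalKoszul_eq_zero (mem_quotientPiece_of_mem_koszulChain x.2) hx))

theorem bettiNumber_pointsIdeal (L : Fin s → Fin (n + 1) → ℂ) (i j : ℕ) :
    bettiNumber (pointsIdeal L) i j = (atPoints (chainMatrix n s i j) L).rank -
      (atPoints (differentialMatrix n s * chainMatrix n s i j) L).rank -
      (atPoints (differentialMatrix n s * chainMatrix n s (i + 1) j) L).rank := by
  rw [bettiNumber_eq_finrank, finrank_koszulChain, finrank_map_koszulD, finrank_map_koszulD]

theorem mem_range_chainMatrix {L : Fin s → Fin (n + 1) → ℂ} {i j : ℕ} (hij : i ≤ j)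
    (h : ImposeIndependentConditions L (j - i)) (w : Finset (Fin (n + 1)) × Fin s → ℂ) :
    w ∈ LinearMap.range (atPoints (chainMatrix n s i j) L).mulVecLin ↔
      ∀ T a, T.card ≠ i → w (T, a) = 0 := by
  constructor
  · rintro ⟨v, rfl⟩ T a hT
    rw [Matrix.mulVecLin_apply, chainMatrix_mulVec, if_neg fun h => hT h.1]
  · intro hw
    choose f hf hfw using fun T => h fun a => w (T, a)
    refine ⟨fun q => (f q.1).coeff q.2.1, ?_⟩
    funext ⟨T, a⟩
    rw [Matrix.mulVecLin_apply, chainMatrix_mulVec]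
    split_ifs with hT
    · rw [formOf_coeff (hf T), hfw]
    · exact (hw T a fun hc => hT ⟨hc, hij⟩).symm

theorem range_chainMatrix_eq {L : Fin s → Fin (n + 1) → ℂ} {i j j' k : ℕ}
    (h : ImposeIndependentConditions L k) (hL : ∀ a, L a ≠ 0) (hj : i + k ≤ j)
    (hj' : i + k ≤ j') :
    LinearMap.range (atPoints (chainMatrix n s i j) L).mulVecLin =
      LinearMap.range (atPoints (chainMatrix n s i j') L).mulVecLin := by
  ext w
  rw [mem_range_chainMatrix (by omega) (h.mono hL (by omega)),
    mem_range_chainMatrix (by omega) (h.mono hL (by omega))]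

theorem rank_atPoints_mul_eq {ι κ μ μ' : Type*} [Fintype κ] [Fintype μ] [Fintype μ']
    (A : Matrix ι κ (MvPolynomial (Fin s × Fin (n + 1)) ℂ))
    {B : Matrix κ μ (MvPolynomial (Fin s × Fin (n + 1)) ℂ)}
    {B' : Matrix κ μ' (MvPolynomial (Fin s × Fin (n + 1)) ℂ)} {L : Fin s → Fin (n + 1) → ℂ}
    (h : LinearMap.range (atPoints B L).mulVecLin = LinearMap.range (atPoints B' L).mulVecLin) :
    (atPoints (A * B) L).rank = (atPoints (A * B') L).rank := by
  rw [atPoints, atPoints, Matrix.map_mul, Matrix.map_mul, Matrix.rank, Matrix.mulVecLin_mul,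
    LinearMap.range_comp, h, ← LinearMap.range_comp, ← Matrix.mulVecLin_mul, Matrix.rank]

theorem bettiNumber_pointsIdeal_eq_of_le {L : Fin s → Fin (n + 1) → ℂ} {i j j' k : ℕ}
    (h : ImposeIndependentConditions L k) (hL : ∀ a, L a ≠ 0) (hj : i + 1 + k ≤ j)
    (hj' : i + 1 + k ≤ j') :
    bettiNumber (pointsIdeal L) i j = bettiNumber (pointsIdeal L) i j' := by
  have hrange : LinearMap.range (atPoints (chainMatrix n s i j) L).mulVecLin =
      LinearMap.range (atPoints (chainMatrix n s i j') L).mulVecLin :=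
    range_chainMatrix_eq h hL (by omega) (by omega)
  rw [bettiNumber_pointsIdeal, bettiNumber_pointsIdeal, rank_atPoints_mul_eq _ hrange,
    rank_atPoints_mul_eq _ (range_chainMatrix_eq h hL hj hj'), Matrix.rank, hrange]
  rfl

theorem chainMatrix_eq_zero {i : ℕ} (hi : n + 1 < i) (j : ℕ) : chainMatrix n s i j = 0 := by
  ext1 p q
  have := Finset.card_le_univ p.1
  rw [Fintype.card_fin] at this
  exact if_neg (by omega)

theorem bettiNumber_pointsIdeal_eq_zero (L : Fin s → Fin (n + 1) → ℂ) {i : ℕ} (hi : n + 1 < i)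
    (j : ℕ) : bettiNumber (pointsIdeal L) i j = 0 := by
  rw [bettiNumber_pointsIdeal, chainMatrix_eq_zero hi, atPoints, Matrix.map_zero _ (map_zero _),
    Matrix.rank_zero, Nat.zero_sub, Nat.zero_sub]

theorem exists_bettiNumber_pointsIdeal_eq (n s i j : ℕ) :
    ∃ Φ : MvPolynomial (Fin s × Fin (n + 1)) ℂ, Φ ≠ 0 ∧
      ∀ L L' : Fin s → Fin (n + 1) → ℂ, eval (fun q => L q.1 q.2) Φ ≠ 0 →
        eval (fun q => L' q.1 q.2) Φ ≠ 0 →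
          bettiNumber (pointsIdeal L) i j = bettiNumber (pointsIdeal L') i j := by
  obtain ⟨Φ₁, h₁, hrank₁⟩ := exists_rank_map_eval_eq (chainMatrix n s i j)
  obtain ⟨Φ₂, h₂, hrank₂⟩ := exists_rank_map_eval_eq (differentialMatrix n s * chainMatrix n s i j)
  obtain ⟨Φ₃, h₃, hrank₃⟩ :=
    exists_rank_map_eval_eq (differentialMatrix n s * chainMatrix n s (i + 1) j)
  refine ⟨Φ₁ * Φ₂ * Φ₃, mul_ne_zero (mul_ne_zero h₁ h₂) h₃, fun L L' hL hL' => ?_⟩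
  simp only [map_mul, mul_ne_zero_iff] at hL hL'
  rw [bettiNumber_pointsIdeal, bettiNumber_pointsIdeal, hrank₁ _ _ hL.1.1 hL'.1.1,
    hrank₂ _ _ hL.1.2 hL'.1.2, hrank₃ _ _ hL.2 hL'.2]

theorem exists_forall_bettiNumber_pointsIdeal_eq {L₀ : Fin s → Fin (n + 1) → ℂ} {k : ℕ}
    (hk : k ≠ 0) (h₀ : ImposeIndependentConditions L₀ k) :
    ∃ Φ : MvPolynomial (Fin s × Fin (n + 1)) ℂ, Φ ≠ 0 ∧
      ∀ L L' : Fin s → Fin (n + 1) → ℂ, eval (fun q => L q.1 q.2) Φ ≠ 0 →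
        eval (fun q => L' q.1 q.2) Φ ≠ 0 →
          ∀ i j, bettiNumber (pointsIdeal L) i j = bettiNumber (pointsIdeal L') i j := by
  obtain ⟨Ψ, hΨ, hΨL⟩ := exists_forall_imposeIndependentConditions h₀
  choose Φ hΦ hΦL using exists_bettiNumber_pointsIdeal_eq n s
  let box := Finset.range (n + 2) ×ˢ Finset.range (n + k + 4)
  refine ⟨Ψ * ∏ q ∈ box, Φ q.1 q.2, mul_ne_zero hΨ (Finset.prod_ne_zero_iff.2 fun q _ => hΦ _ _),
    fun L L' hL hL' i j => ?_⟩
  simp only [map_mul, map_prod, mul_ne_zero_iff, Finset.prod_ne_zero_iff] at hL hL'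
  have eq_of_mem_box : ∀ i j, i < n + 2 → j < n + k + 4 →
      bettiNumber (pointsIdeal L) i j = bettiNumber (pointsIdeal L') i j := fun i j hi hj =>
    have hmem : (i, j) ∈ box :=
      Finset.mk_mem_product (Finset.mem_range.2 hi) (Finset.mem_range.2 hj)
    hΦL i j L L' (hL.2 _ hmem) (hL'.2 _ hmem)
  have eq_last : ∀ M : Fin s → Fin (n + 1) → ℂ, eval (fun q => M q.1 q.2) Ψ ≠ 0 → i < n + 2 →
      n + k + 4 ≤ j → bettiNumber (pointsIdeal M) i j = bettiNumber (pointsIdeal M) i (n + k + 3) :=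
    fun M hM hi hj =>
      bettiNumber_pointsIdeal_eq_of_le (hΨL M hM) ((hΨL M hM).ne_zero hk) (by omega) (by omega)
  rcases lt_or_ge i (n + 2) with hi | hi
  · rcases lt_or_ge j (n + k + 4) with hj | hj
    · exact eq_of_mem_box i j hi hj
    · rw [eq_last L hL.1 hi hj, eq_last L' hL'.1 hi hj, eq_of_mem_box i _ hi (by omega)]
  · rw [bettiNumber_pointsIdeal_eq_zero L (by omega), bettiNumber_pointsIdeal_eq_zero L' (by omega)]

theorem exists_forall_isResolutionGeneral {L₀ : Fin s → Fin (n + 1) → ℂ} {k : ℕ} (hk : k ≠ 0)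
    (h₀ : ImposeIndependentConditions L₀ k) :
    ∃ Φ : MvPolynomial (Fin s × Fin (n + 1)) ℂ, Φ ≠ 0 ∧
      ∀ L : Fin s → Fin (n + 1) → ℂ, eval (fun q => L q.1 q.2) Φ ≠ 0 →
        IsZeroDimScheme s (pointsIdeal L) ∧ IsResolutionGeneral s (pointsIdeal L) := by
  obtain ⟨Ψ, hΨ, hΨL⟩ := exists_forall_imposeIndependentConditions h₀
  obtain ⟨Φ, hΦ, hΦL⟩ := exists_forall_bettiNumber_pointsIdeal_eq hk h₀
  refine ⟨Ψ * Φ, mul_ne_zero hΨ hΦ, fun L hL => ?_⟩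
  rw [map_mul] at hL
  have hcond := hΨL L (left_ne_zero_of_mul hL)
  exact ⟨isZeroDimScheme_pointsIdeal hcond (hcond.ne_zero hk),
    Φ, hΦ, fun L' _ hL' => hΦL L L' (right_ne_zero_of_mul hL) hL'⟩

end BettiPoints

/-! ### Apolarity of sums of powers -/

section Apolarity

variable {n : ℕ} {L : Fin (n + 1) → ℂ}

/-- The linear form with coefficients `L`. -/
def linearForm (L : Fin (n + 1) → ℂ) : MvPolynomial (Fin (n + 1)) ℂ := ∑ k, L k • X k

theorem isHomogeneous_linearForm (L : Fin (n + 1) → ℂ) : (linearForm L).IsHomogeneous 1 :=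
  IsHomogeneous.sum _ _ _ fun k _ => by
    rw [smul_eq_C_mul]
    exact isHomogeneous_C_mul_X _ _

theorem pderiv_linearForm (L : Fin (n + 1) → ℂ) (k : Fin (n + 1)) :
    pderiv k (linearForm L) = C (L k) := by
  simp [linearForm, pderiv_X, Pi.single_apply, smul_eq_C_mul]

/-- The operator `A` acts on powers of `linearForm L` as a monomial differential operator of order
`e` whose symbol has the value `c` at `L`. -/
def ActsOnPowers (L : Fin (n + 1) → ℂ) (A : Module.End ℂ (MvPolynomial (Fin (n + 1)) ℂ))
    (e : ℕ) (c : ℂ) : Prop :=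
  ∀ d, A (linearForm L ^ d) = ((d.descFactorial e : ℂ) * c) • linearForm L ^ (d - e)

namespace ActsOnPowers

variable {A B : Module.End ℂ (MvPolynomial (Fin (n + 1)) ℂ)} {e f : ℕ} {b c : ℂ}

theorem one (L : Fin (n + 1) → ℂ) : ActsOnPowers L 1 0 1 := fun d => by simp

theorem mul (hA : ActsOnPowers L A e b) (hB : ActsOnPowers L B f c) :
    ActsOnPowers L (A * B) (e + f) (b * c) := by
  intro d
  have hdesc : (d - f).descFactorial e * d.descFactorial f = d.descFactorial (e + f) := by
    simpa using Nat.descFactorial_mul_descFactorial (n := d) (Nat.le_add_left f e)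
  rw [Module.End.mul_apply, hB, map_smul, hA, smul_smul, Nat.sub_sub, add_comm f e, ← hdesc,
    Nat.cast_mul]
  congr 1
  ring

theorem pow (hA : ActsOnPowers L A 1 c) (e : ℕ) : ActsOnPowers L (A ^ e) e (c ^ e) := by
  induction e with
  | zero => simpa using one L
  | succ e ih =>
    rw [pow_succ, pow_succ]
    exact ih.mul hA

theorem pderiv (L : Fin (n + 1) → ℂ) (k : Fin (n + 1)) :
    ActsOnPowers L (MvPolynomial.pderiv k).toLinearMap 1 (L k) := by
  intro d
  rw [Derivation.coeFn_coe, pderiv_pow, pderiv_linearForm, Nat.descFactorial_one, smul_eq_C_mul,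
    map_mul, map_natCast]
  ring

theorem prod_ofFn {N : ℕ} {A : Fin N → Module.End ℂ (MvPolynomial (Fin (n + 1)) ℂ)}
    {e : Fin N → ℕ} {c : Fin N → ℂ} (h : ∀ i, ActsOnPowers L (A i) (e i) (c i)) :
    ActsOnPowers L (List.ofFn A).prod (∑ i, e i) (∏ i, c i) := by
  induction N with
  | zero => simpa using one L
  | succ N ih =>
    rw [List.ofFn_succ, List.prod_cons, Fin.sum_univ_succ, Fin.prod_univ_succ]
    exact (h 0).mul (ih fun i => h i.succ)

end ActsOnPowers

theorem diffMonomial_linearForm_pow (L : Fin (n + 1) → ℂ) (m : Fin (n + 1) →₀ ℕ) (d : ℕ) :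
    diffMonomial m (linearForm L ^ d) =
      ((d.descFactorial m.degree : ℂ) * ∏ k, L k ^ m k) • linearForm L ^ (d - m.degree) := by
  rw [Finsupp.degree_eq_sum]
  exact ActsOnPowers.prod_ofFn (fun k => (ActsOnPowers.pderiv L k).pow (m k)) d

theorem internalProduct_linearForm_pow_eq_zero {φ : MvPolynomial (Fin (n + 1)) ℂ}
    (h : ∀ k, eval L (homogeneousComponent k φ) = 0) (d : ℕ) :
    internalProduct φ (linearForm L ^ d) = 0 := by
  rw [internalProduct, ← Finset.sum_fiberwise_of_maps_to
    (fun m hm => Finset.mem_image_of_mem Finsupp.degree hm)]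
  refine Finset.sum_eq_zero fun k _ => ?_
  have heval := h k
  rw [homogeneousComponent_apply, map_sum] at heval
  calc ∑ m ∈ φ.support with m.degree = k, φ.coeff m • diffMonomial m (linearForm L ^ d)
      = ∑ m ∈ φ.support with m.degree = k, eval L (monomial m (φ.coeff m)) •
          ((d.descFactorial k : ℂ) • linearForm L ^ (d - k)) := by
        refine Finset.sum_congr rfl fun m hm => ?_
        rw [diffMonomial_linearForm_pow, (Finset.mem_filter.1 hm).2, smul_smul, smul_smul,
          eval_monomial, Finsupp.prod_fintype _ _ fun _ => pow_zero _]
        congr 1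
        ring
    _ = 0 := by rw [← Finset.sum_smul, heval, zero_smul]

theorem internalProduct_sum_smul {ι : Type*} (φ : MvPolynomial (Fin (n + 1)) ℂ) (s : Finset ι)
    (c : ι → ℂ) (F : ι → MvPolynomial (Fin (n + 1)) ℂ) :
    internalProduct φ (∑ i ∈ s, c i • F i) = ∑ i ∈ s, c i • internalProduct φ (F i) := by
  simp only [internalProduct, map_sum, map_smul, Finset.smul_sum]
  rw [Finset.sum_comm]
  exact Finset.sum_congr rfl fun i _ => Finset.sum_congr rfl fun m _ => smul_comm _ _ _

theorem isApolar_pointsIdeal {s r d : ℕ} (L : Fin s → Fin (n + 1) → ℂ) (p : Fin s → Fin r → ℂ) :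
    IsApolar (pointsIdeal L)
      (Submodule.span ℂ (Set.range fun i => ∑ a, p a i • linearForm (L a) ^ d)) := by
  intro φ hφ F hF
  obtain ⟨c, rfl⟩ := (Submodule.mem_span_range_iff_exists_fun ℂ).1 hF
  simp only [internalProduct_sum_smul, internalProduct_linearForm_pow_eq_zero
    (mem_pointsIdeal_iff.1 hφ _), smul_zero, Finset.sum_const_zero]

end Apolarity

/-! ### Terracini's lemma -/

section Terracini

variable {n d r s : ℕ} {p : Fin s → Fin r → ℂ} {Q : Fin s → Fin (n + 1) → ℂ}

/-- The coefficients of `r` linear combinations of the `d`-th powers of `s` linear forms, as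
polynomials in the coefficients of the linear forms and of the combinations. -/
def powerSumCoeff (n d r s : ℕ) (t : Fin r × {m : Fin (n + 1) →₀ ℕ // m.degree = d}) :
    MvPolynomial ((Fin s × Fin (n + 1)) ⊕ (Fin s × Fin r)) ℂ :=
  ∑ a, X (.inr (a, t.1)) *
    rename (fun k => .inl (a, k)) (monomial t.2.1 (t.2.1.multinomial : ℂ))

theorem eval_powerSumCoeff (x : (Fin s × Fin (n + 1)) ⊕ (Fin s × Fin r) → ℂ)
    (t : Fin r × {m : Fin (n + 1) →₀ ℕ // m.degree = d}) :
    eval x (powerSumCoeff n d r s t) =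
      coeff t.2.1 (∑ a, x (.inr (a, t.1)) • linearForm (fun k => x (.inl (a, k))) ^ d) := by
  have hdeg : t.2.1.sum (fun _ m => m) = d := t.2.2
  rw [powerSumCoeff, map_sum, coeff_sum]
  refine Finset.sum_congr rfl fun a _ => ?_
  rw [map_mul, eval_X, eval_rename, eval_monomial, coeff_smul, linearForm,
    coeff_linearCombination_X_pow_of_fintype, if_pos hdeg, smul_eq_mul]
  rfl

theorem pderiv_rename_of_notMem_range {σ τ R : Type*} [CommSemiring R] {f : σ → τ} {j : τ}
    (hj : j ∉ Set.range f) (F : MvPolynomial σ R) : pderiv j (rename f F) = 0 :=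
  pderiv_eq_zero_of_notMem_vars fun h =>
    let ⟨k, _, hk⟩ := mem_vars_rename _ _ h
    hj ⟨k, hk⟩

theorem eval_pderiv_inr_powerSumCoeff (x : (Fin s × Fin (n + 1)) ⊕ (Fin s × Fin r) → ℂ)
    (t : Fin r × {m : Fin (n + 1) →₀ ℕ // m.degree = d}) (a : Fin s) (i : Fin r) :
    eval x (pderiv (.inr (a, i)) (powerSumCoeff n d r s t)) = if t.1 = i then
      t.2.1.multinomial * eval (fun k => x (.inl (a, k))) (monomial t.2.1 1) else 0 := by
  have hrename : ∀ b : Fin s, pderiv (.inr (a, i) : (Fin s × Fin (n + 1)) ⊕ (Fin s × Fin r))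
      (rename (fun k => .inl (b, k)) (monomial t.2.1 (t.2.1.multinomial : ℂ))) = 0 :=
    fun b => pderiv_rename_of_notMem_range (by simp) _
  have hX : ∀ b : Fin s, pderiv (.inr (a, i) : (Fin s × Fin (n + 1)) ⊕ (Fin s × Fin r))
      (X (.inr (b, t.1)) : MvPolynomial _ ℂ) = if t.1 = i ∧ b = a then 1 else 0 := by
    intro b
    classical
    simp [pderiv_X, Pi.single_apply, and_comm]
  simp only [powerSumCoeff, map_sum, pderiv_mul, hrename, hX, mul_zero, add_zero, ite_mul, one_mul,
    zero_mul, ite_and]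
  split_ifs with hi
  · simp only [apply_ite (eval x), map_zero, Finset.sum_ite_eq', Finset.mem_univ, if_true,
      eval_rename, eval_monomial, one_mul]
    rfl
  · simp

theorem eval_pderiv_inl_powerSumCoeff (x : (Fin s × Fin (n + 1)) ⊕ (Fin s × Fin r) → ℂ)
    (t : Fin r × {m : Fin (n + 1) →₀ ℕ // m.degree = d}) (a : Fin s) (k : Fin (n + 1)) :
    eval x (pderiv (.inl (a, k)) (powerSumCoeff n d r s t)) = x (.inr (a, t.1)) *
      (t.2.1.multinomial * eval (fun k => x (.inl (a, k))) (pderiv k (monomial t.2.1 1))) := by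
  have hinj : Function.Injective
      fun k => (.inl (a, k) : (Fin s × Fin (n + 1)) ⊕ (Fin s × Fin r)) :=
    fun k l h => by simpa using h
  have hX : ∀ b : Fin s, pderiv (.inl (a, k) : (Fin s × Fin (n + 1)) ⊕ (Fin s × Fin r))
      (X (.inr (b, t.1)) : MvPolynomial _ ℂ) = 0 := fun b => pderiv_X_of_ne (by simp)
  have hmonomial : monomial t.2.1 (t.2.1.multinomial : ℂ) =
      C (t.2.1.multinomial : ℂ) * monomial t.2.1 1 := by rw [C_mul_monomial, mul_one]
  rw [powerSumCoeff, map_sum, map_sum, Finset.sum_eq_single a]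
  · rw [pderiv_mul, hX, zero_mul, zero_add, pderiv_rename hinj, map_mul, eval_X, eval_rename,
      hmonomial, pderiv_C_mul, map_mul, eval_C]
    rfl
  · intro b _ hb
    rw [pderiv_mul, hX, zero_mul, zero_add,
      pderiv_rename_of_notMem_range (by simpa using hb), mul_zero, map_zero]
  · simp

/-- Forms `G i` of degree `d` which vanish at all points `Q a`, and whose combination
`∑ i, p a i • G i` is singular at `Q a` for each `a`. These are the relations between the tangent
vectors at `(p, Q)` of the family of `r`-tuples of sums of `s` powers of linear forms. -/
structure IsSingularSystem (d : ℕ) (p : Fin s → Fin r → ℂ) (Q : Fin s → Fin (n + 1) → ℂ)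
    (G : Fin r → MvPolynomial (Fin (n + 1)) ℂ) : Prop where
  homogeneous : ∀ i, (G i).IsHomogeneous d
  base : ∀ i a, eval (Q a) (G i) = 0
  singular : ∀ a k, ∑ i, p a i * eval (Q a) (pderiv k (G i)) = 0

/-- The forms of degree `d` whose coefficients are `c`, scaled by multinomial coefficients. -/
def dualForm (c : Fin r × {m : Fin (n + 1) →₀ ℕ // m.degree = d} → ℂ) (i : Fin r) :
    MvPolynomial (Fin (n + 1)) ℂ :=
  formOf fun m => c (i, m) * m.1.multinomial

theorem dualForm_eq_zero_iff {c : Fin r × {m : Fin (n + 1) →₀ ℕ // m.degree = d} → ℂ} :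
    dualForm c = 0 ↔ c = 0 := by
  constructor
  · intro h
    funext ⟨i, m⟩
    have hcoeff := coeff_formOf (fun m => c (i, m) * (m.1.multinomial : ℂ)) m
    rw [show formOf _ = 0 from congrFun h i, coeff_zero] at hcoeff
    exact (mul_eq_zero.1 hcoeff.symm).resolve_right
      (Nat.cast_ne_zero.2 (Nat.multinomial_pos _ _).ne')
  · rintro rfl
    funext i
    simp [dualForm, formOf_apply]

theorem exists_dualForm_eq {G : Fin r → MvPolynomial (Fin (n + 1)) ℂ}
    (hG : ∀ i, (G i).IsHomogeneous d) :
    ∃ c : Fin r × {m : Fin (n + 1) →₀ ℕ // m.degree = d} → ℂ, dualForm c = G := by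
  refine ⟨fun t => (G t.1).coeff t.2.1 / t.2.1.multinomial, funext fun i => ?_⟩
  conv_rhs => rw [← formOf_coeff (hG i)]
  refine congrArg formOf (funext fun m => ?_)
  exact div_mul_cancel₀ _ (Nat.cast_ne_zero.2 (Nat.multinomial_pos _ _).ne')

theorem sum_smul_eval_pderiv_powerSumCoeff_eq_zero_iff
    {c : Fin r × {m : Fin (n + 1) →₀ ℕ // m.degree = d} → ℂ} :
    (∑ t, c t • fun j => eval (Sum.elim (fun q => Q q.1 q.2) fun q => p q.1 q.2)
      (pderiv j (powerSumCoeff n d r s t))) = 0 ↔ IsSingularSystem d p Q (dualForm c) := by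
  have hbase : ∀ i a, ∑ t, c t * eval (Sum.elim (fun q => Q q.1 q.2) fun q => p q.1 q.2)
      (pderiv (.inr (a, i)) (powerSumCoeff n d r s t)) = eval (Q a) (dualForm c i) := by
    intro i a
    simp only [eval_pderiv_inr_powerSumCoeff, Fintype.sum_prod_type_right, mul_ite, mul_zero,
      Finset.sum_ite_eq', Finset.mem_univ, if_true, dualForm, eval_formOf, Sum.elim_inl, mul_assoc]
  have hsingular : ∀ a k, ∑ t, c t * eval (Sum.elim (fun q => Q q.1 q.2) fun q => p q.1 q.2)
      (pderiv (.inl (a, k)) (powerSumCoeff n d r s t)) =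
        ∑ i, p a i * eval (Q a) (pderiv k (dualForm c i)) := by
    intro a k
    simp only [eval_pderiv_inl_powerSumCoeff, Fintype.sum_prod_type, dualForm, formOf_apply,
      map_sum, Derivation.map_smul, smul_eval, Finset.mul_sum, Sum.elim_inl, Sum.elim_inr]
    exact Finset.sum_congr rfl fun i _ => Finset.sum_congr rfl fun m _ => by ring
  simp only [funext_iff, Finset.sum_apply, Pi.smul_apply, smul_eq_mul, Pi.zero_apply, Sum.forall,
    Prod.forall, hbase, hsingular]
  exact ⟨fun h => ⟨fun i => isHomogeneous_formOf _, fun i a => h.2 a i, h.1⟩,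
    fun h => ⟨h.singular, fun a i => h.base i a⟩⟩

theorem linearIndependent_eval_pderiv_powerSumCoeff_iff :
    (LinearIndependent ℂ fun t j => eval (Sum.elim (fun q => Q q.1 q.2) fun q => p q.1 q.2)
      (pderiv j (powerSumCoeff n d r s t))) ↔ ∀ G, IsSingularSystem d p Q G → G = 0 := by
  simp only [Fintype.linearIndependent_iff, sum_smul_eval_pderiv_powerSumCoeff_eq_zero_iff]
  constructor
  · intro h G hG
    obtain ⟨c, rfl⟩ := exists_dualForm_eq hG.homogeneous
    exact dualForm_eq_zero_iff.2 (funext (h c hG))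
  · exact fun h c hc => congrFun (dualForm_eq_zero_iff.1 (h _ hc))

theorem nondegenerate_of_forall_isSingularSystem {L₀ : Fin s → Fin (n + 1) → ℂ} {k : ℕ}
    (hcount : r * (n + d).choose d ≤ s * (n + r)) (hk : k ≠ 0)
    (h₀ : ImposeIndependentConditions L₀ k) (h : ∀ G, IsSingularSystem d p Q G → G = 0) :
    Nondegenerate n d r s := by
  refine ⟨hcount, ?_⟩
  obtain ⟨Φ, hΦ, hΦL⟩ := exists_forall_isResolutionGeneral hk h₀
  have hindep := algebraicIndependent_of_linearIndependent_pderiv _ _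
    (linearIndependent_eval_pderiv_powerSumCoeff_iff.2 h)
  obtain ⟨u, hu, hsurj⟩ := exists_forall_exists_eval_eq_of_algebraicIndependent hindep
    ((map_ne_zero_iff _ (rename_injective Sum.inl Sum.inl_injective)).2 hΦ)
  refine ⟨u, hu, fun F hF _ hFu => ?_⟩
  obtain ⟨x, hx, hxΦ⟩ := hsurj _ hFu
  rw [eval_rename] at hxΦ
  let L : Fin s → Fin (n + 1) → ℂ := fun a k => x (.inl (a, k))
  have hpower : F = fun i => ∑ a, x (.inr (a, i)) • linearForm (L a) ^ d := by
    funext i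
    have hhom : (∑ a, x (.inr (a, i)) • linearForm (L a) ^ d).IsHomogeneous d :=
      Submodule.sum_mem (homogeneousSubmodule _ ℂ d) fun a _ => Submodule.smul_mem _ _ <| by
        simpa using (isHomogeneous_linearForm (L a)).pow d
    rw [← formOf_coeff (hF i), ← formOf_coeff hhom]
    congr 1
    funext m
    rw [← hx (i, m), eval_powerSumCoeff]
  rw [hpower]
  exact ⟨pointsIdeal L, (hΦL L hxΦ).1, isApolar_pointsIdeal L fun a i => x (.inr (a, i)),
    (hΦL L hxΦ).2⟩

theorem eval_bind₁ {σ τ R : Type*} [CommSemiring R] (x : τ → R) (g : σ → MvPolynomial τ R)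
    (F : MvPolynomial σ R) : eval x (bind₁ g F) = eval (fun i => eval x (g i)) F :=
  eval₂Hom_bind₁ _ _ _ _

theorem forGeneralPoints_of_forall_isSingularSystem {p : Fin s → Fin (r + 1) → ℂ}
    (h : ∀ G, IsSingularSystem d p Q G → G = 0) :
    ForGeneralPoints r s fun p => ∀ G, IsSingularSystem d p Q G → G = 0 := by
  let A : Matrix (Fin (r + 1) × {m : Fin (n + 1) →₀ ℕ // m.degree = d})
      ((Fin s × Fin (n + 1)) ⊕ (Fin s × Fin (r + 1))) (MvPolynomial (Fin s × Fin (r + 1)) ℂ) :=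
    Matrix.of fun t j => bind₁ (Sum.elim (fun q => C (Q q.1 q.2)) X)
      (pderiv j (powerSumCoeff n d (r + 1) s t))
  have hA : ∀ p : Fin s → Fin (r + 1) → ℂ, (A.map (eval fun q => p q.1 q.2)).row = fun t j =>
      eval (Sum.elim (fun q => Q q.1 q.2) fun q => p q.1 q.2)
        (pderiv j (powerSumCoeff n d (r + 1) s t)) := by
    intro p
    funext t j
    refine (eval_bind₁ _ _ _).trans (congrArg (eval · _) (funext fun i => ?_))
    cases i <;> simp
  obtain ⟨Φ, hΦ, hrow⟩ := exists_linearIndependent_row_map_eval (A := A)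
    (x₀ := fun q => p q.1 q.2) (by
      rw [hA]
      exact linearIndependent_eval_pderiv_powerSumCoeff_iff.2 h)
  refine ⟨Φ, hΦ, fun p' _ hp' => linearIndependent_eval_pderiv_powerSumCoeff_iff.1 ?_⟩
  rw [← hA]
  exact hrow _ hp'

end Terracini

/-! ### The octad -/

theorem octad_eq_append : octad = Fin.append (fun i : Fin 4 => Pi.single i 1)
    fun i : Fin 4 => 1 - 2 • Pi.single i 1 := by
  funext a k
  fin_cases a <;> fin_cases k <;> simp [octad, Fin.append, Fin.addCases] <;> norm_num

theorem imposeIndependentConditions_octad : ImposeIndependentConditions octad 3 := by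
  intro w
  let S := w 0 + w 1 + w 2 + w 3
  let v : Fin 4 → ℂ := ![w 4 - (S - 2 * w 0), w 5 - (S - 2 * w 1), w 6 - (S - 2 * w 2),
    w 7 - (S - 2 * w 3)]
  let T := (v 0 + v 1 + v 2 + v 3) / 2
  refine ⟨C (w 0) * X 0 ^ 3 + C (w 1) * X 1 ^ 3 + C (w 2) * X 2 ^ 3 + C (w 3) * X 3 ^ 3 +
    C ((v 0 - T) / 2) * (X 1 * X 2 * X 3) + C ((v 1 - T) / 2) * (X 0 * X 2 * X 3) +
    C ((v 2 - T) / 2) * (X 0 * X 1 * X 3) + C ((v 3 - T) / 2) * (X 0 * X 1 * X 2), ?_, ?_⟩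
  · have hcube (c : ℂ) (i : Fin 4) : (C c * X i ^ 3 : MvPolynomial (Fin 4) ℂ).IsHomogeneous 3 :=
      isHomogeneous_C_mul_X_pow c i 3
    have hmixed (c : ℂ) (i j k : Fin 4) :
        (C c * (X i * X j * X k) : MvPolynomial (Fin 4) ℂ).IsHomogeneous 3 :=
      (((isHomogeneous_X ℂ i).mul (isHomogeneous_X ℂ j)).mul (isHomogeneous_X ℂ k)).C_mul c
    exact (((((((hcube _ _).add (hcube _ _)).add (hcube _ _)).add (hcube _ _)).add
      (hmixed _ _ _ _)).add (hmixed _ _ _ _)).add (hmixed _ _ _ _)).add (hmixed _ _ _ _)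
  · intro a
    fin_cases a <;> simp [octad, T, v, S] <;> ring

theorem eval_single_one {σ R : Type*} [DecidableEq σ] [CommSemiring R] {F : MvPolynomial σ R}
    {d : ℕ} (hF : F.IsHomogeneous d) (i : σ) :
    eval (Pi.single i 1) F = F.coeff (Finsupp.single i d) := by
  rw [eval_eq, Finset.sum_eq_single (Finsupp.single i d)]
  · rw [Finset.prod_eq_one, mul_one]
    intro j hj
    rw [Finset.mem_singleton.1 (Finsupp.support_single_subset hj), Pi.single_eq_same, one_pow]
  · intro m hm hne
    obtain ⟨j, hj, hji⟩ : ∃ j ∈ m.support, j ≠ i := by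
      by_contra! hall
      have hsingle : m = Finsupp.single i (m i) :=
        Finsupp.support_subset_singleton.1 fun j hj => Finset.mem_singleton.2 (hall j hj)
      have hdeg : m.degree = d := (hF.degree_eq_sum_deg_support hm).symm
      rw [hsingle, Finsupp.degree_single] at hdeg
      exact hne (hdeg ▸ hsingle)
    rw [Finset.prod_eq_zero hj, mul_zero]
    rw [Pi.single_eq_of_ne hji, zero_pow (Finsupp.mem_support_iff.1 hj)]
  · intro h
    rw [notMem_support_iff.1 h, zero_mul]

theorem coeff_eq_zero_of_eval_pderiv_eq_zero {σ R : Type*} [DecidableEq σ] [CommRing R]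
    [IsDomain R] [CharZero R] {F : MvPolynomial σ R} {d : ℕ} (hF : F.IsHomogeneous (d + 1))
    {i j : σ} (h : eval (Pi.single i 1) (pderiv j F) = 0) :
    F.coeff (Finsupp.single i d + Finsupp.single j 1) = 0 := by
  rw [eval_single_one hF.pderiv, coeff_pderiv] at h
  exact (mul_eq_zero.1 h).resolve_right (Nat.cast_add_one_ne_zero _)

/-- The exponent of the squarefree cubic monomial in four variables that omits the variable `i`. -/
def omitting (i : Fin 4) : Fin 4 →₀ ℕ := Finsupp.equivFunOnFinite.symm (1 - Pi.single i 1)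

theorem omitting_apply (i j : Fin 4) : omitting i j = if j = i then 0 else 1 := by
  simp only [omitting, Finsupp.coe_equivFunOnFinite_symm, Pi.sub_apply, Pi.one_apply,
    Pi.single_apply]
  split_ifs <;> rfl

theorem omitting_injective : Function.Injective omitting := by
  intro i j h
  by_contra hij
  simpa [omitting_apply, hij] using DFunLike.congr_fun h i

theorem eq_omitting_or_eq_single_add_single {m : Fin 4 →₀ ℕ} (hm : m.degree = 3) :
    (∃ i, m = omitting i) ∨ ∃ i j, m = Finsupp.single i 2 + Finsupp.single j 1 := by
  by_cases h : ∃ i, 2 ≤ m i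
  · obtain ⟨i, hi⟩ := h
    have hm' := add_tsub_cancel_of_le (Finsupp.single_le_iff.2 hi)
    have hdeg : (m - Finsupp.single i 2).degree = 1 := by
      rw [← hm', map_add, Finsupp.degree_single] at hm
      omega
    obtain ⟨j, hj⟩ := Finsupp.range_single_one.ge hdeg
    exact .inr ⟨i, j, hm'.symm.trans (congrArg _ hj.symm)⟩
  · push Not at h
    rw [Finsupp.degree_eq_sum, Fin.sum_univ_four] at hm
    obtain ⟨i, hi⟩ : ∃ i, m i = 0 := by
      by_contra! hpos
      have := hpos 0
      have := hpos 1
      have := hpos 2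
      have := hpos 3
      omega
    refine .inl ⟨i, Finsupp.ext fun k => ?_⟩
    rw [omitting_apply]
    have := h 0
    have := h 1
    have := h 2
    have := h 3
    fin_cases i <;> fin_cases k <;> simp at hi ⊢ <;> omega

theorem eval_monomial_omitting (i j : Fin 4) (c : ℂ) :
    eval (1 - 2 • Pi.single i 1 : Fin 4 → ℂ) (monomial (omitting j) c) =
      if j = i then c else -c := by
  rw [eval_monomial, Finsupp.prod_fintype _ _ fun _ => pow_zero _, Fin.prod_univ_four]
  fin_cases i <;> fin_cases j <;> simp [omitting_apply] <;> norm_num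

theorem eq_sum_monomial_omitting {F : MvPolynomial (Fin 4) ℂ} (hF : F.IsHomogeneous 3)
    (hsing : ∀ i k, eval (Pi.single i 1) (pderiv k F) = 0) :
    F = ∑ i, monomial (omitting i) (F.coeff (omitting i)) := by
  classical
  have hsupp : F.support ⊆ Finset.univ.image omitting := by
    intro m hm
    rcases eq_omitting_or_eq_single_add_single (hF.degree_eq_sum_deg_support hm).symm with
      ⟨i, rfl⟩ | ⟨i, j, rfl⟩
    · exact Finset.mem_image_of_mem _ (Finset.mem_univ i)
    · exact absurd (coeff_eq_zero_of_eval_pderiv_eq_zero hF (hsing i j)) (mem_support_iff.1 hm)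
  rw [← Finset.sum_image (f := fun m => monomial m (F.coeff m)) omitting_injective.injOn]
  nth_rewrite 1 [F.as_sum]
  exact Finset.sum_subset hsupp fun m _ hm => by rw [notMem_support_iff.1 hm, monomial_zero]

theorem eq_zero_of_singular_at_single {F : MvPolynomial (Fin 4) ℂ}
    (hF : F.IsHomogeneous 3) (hsing : ∀ i k, eval (Pi.single i 1) (pderiv k F) = 0)
    (hbase : ∀ i : Fin 4, eval (1 - 2 • Pi.single i 1) F = 0) : F = 0 := by
  have hF' := eq_sum_monomial_omitting hF hsing
  have hval : ∀ i, 2 * F.coeff (omitting i) = ∑ j, F.coeff (omitting j) := by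
    intro i
    have heval := hbase i
    rw [hF', map_sum] at heval
    simp only [eval_monomial_omitting] at heval
    fin_cases i <;> simp [Fin.sum_univ_four] at heval ⊢ <;> linear_combination heval
  have hsum : ∑ j, F.coeff (omitting j) = 0 := by
    have htotal := Finset.sum_congr rfl fun i (_ : i ∈ Finset.univ) => hval i
    rw [← Finset.mul_sum, Finset.sum_const, Finset.card_fin, nsmul_eq_mul] at htotal
    linear_combination (-1 / 2 : ℂ) * htotal
  rw [hF']
  refine Finset.sum_eq_zero fun i _ => ?_
  rw [(mul_eq_zero.1 ((hval i).trans hsum)).resolve_left two_ne_zero, monomial_zero]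

/-- The linear map `x ↦ (∑ k, x k) • 1 - 2 • x` of `ℂ⁴`, whose square is multiplication by `4` and
which exchanges the first four points of the octad with the last four, up to scalars. -/
def octadSwap (i : Fin 4) : MvPolynomial (Fin 4) ℂ := ∑ k, X k - C 2 * X i

theorem eval_octadSwap (x : Fin 4 → ℂ) (i : Fin 4) :
    eval x (octadSwap i) = ∑ k, x k - 2 * x i := by
  simp [octadSwap]

theorem eval_single_octadSwap (i : Fin 4) :
    (fun j => eval (Pi.single i 1) (octadSwap j)) = 1 - 2 • Pi.single i 1 := by
  funext j
  simp [eval_octadSwap]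

theorem eval_eval_octadSwap (x : Fin 4 → ℂ) :
    (fun i => eval (fun j => eval x (octadSwap j)) (octadSwap i)) = (4 : ℂ) • x := by
  funext i
  simp only [eval_octadSwap, Finset.sum_sub_distrib, ← Finset.mul_sum, Finset.sum_const,
    Finset.card_fin, nsmul_eq_mul, Pi.smul_apply, smul_eq_mul]
  push_cast
  ring

theorem eq_zero_of_singular_at_one_sub_two_smul_single {F : MvPolynomial (Fin 4) ℂ}
    (hF : F.IsHomogeneous 3)
    (hsing : ∀ i k, eval (1 - 2 • Pi.single i 1 : Fin 4 → ℂ) (pderiv k F) = 0)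
    (hbase : ∀ i : Fin 4, eval (Pi.single i 1) F = 0) : F = 0 := by
  have hzero : bind₁ octadSwap F = 0 := by
    refine eq_zero_of_singular_at_single ?_ (fun i k => ?_) fun i => ?_
    · simpa using hF.aeval octadSwap fun i => (IsHomogeneous.sum _ _ _ fun k _ =>
        isHomogeneous_X ℂ k).sub (isHomogeneous_C_mul_X 2 i)
    · rw [← aeval_eq_bind₁, pderiv_aeval, map_sum]
      refine Finset.sum_eq_zero fun j _ => ?_
      rw [aeval_eq_bind₁, map_mul, eval_bind₁, eval_single_octadSwap, hsing, zero_mul]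
    · have hscale := eval_smul_of_isHomogeneous hF 4 (Pi.single i 1)
      rw [hbase, mul_zero, ← eval_eval_octadSwap, eval_single_octadSwap] at hscale
      rw [eval_bind₁, hscale]
  refine funext fun x => ?_
  have hscale := eval_smul_of_isHomogeneous hF 4 x
  rw [← eval_eval_octadSwap, ← eval_bind₁, hzero, map_zero] at hscale
  rw [map_zero]
  exact (mul_eq_zero.1 hscale.symm).resolve_left (by norm_num)

/-- Points `p₁, …, p₈` of `ℙ¹` for which the octad has no singular system of cubics: the first four
coincide, and so do the last four. -/
def octadMarking : Fin 8 → Fin 2 → ℂ :=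
  Fin.append (fun _ : Fin 4 => Pi.single 0 1) fun _ : Fin 4 => Pi.single 1 1

theorem eq_zero_of_isSingularSystem_octad {G : Fin 2 → MvPolynomial (Fin 4) ℂ}
    (hG : IsSingularSystem 3 octadMarking octad G) : G = 0 := by
  have hbase₀ (i : Fin 4) (r : Fin 2) : eval (Pi.single i 1) (G r) = 0 := by
    simpa [octad_eq_append] using hG.base r (Fin.castAdd 4 i)
  have hbase₁ (i : Fin 4) (r : Fin 2) : eval (1 - 2 • Pi.single i 1) (G r) = 0 := by
    simpa only [octad_eq_append, Fin.append_right] using hG.base r (Fin.natAdd 4 i)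
  have hsing₀ (i k : Fin 4) : eval (Pi.single i 1) (pderiv k (G 0)) = 0 := by
    simpa [octad_eq_append, octadMarking] using hG.singular (Fin.castAdd 4 i) k
  have hsing₁ (i k : Fin 4) :
      eval (1 - 2 • Pi.single i 1 : Fin 4 → ℂ) (pderiv k (G 1)) = 0 := by
    simpa [-nsmul_eq_mul, -Fin.natAdd_eq_addNat, octad_eq_append, octadMarking] using
      hG.singular (Fin.natAdd 4 i) k
  refine funext (Fin.forall_fin_two.2 ⟨?_, ?_⟩)
  · exact eq_zero_of_singular_at_single (hG.homogeneous 0) hsing₀ fun i => hbase₁ i 0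
  · exact eq_zero_of_singular_at_one_sub_two_smul_single (hG.homogeneous 1) hsing₁
      fun i => hbase₀ i 1

theorem nondegenerate_three_three_two_eight : Nondegenerate 3 3 2 8 :=
  nondegenerate_of_forall_isSingularSystem (by decide) three_ne_zero
    imposeIndependentConditions_octad fun _ => eq_zero_of_isSingularSystem_octad

/-! ### Groves -/

theorem isSingularSystem_of_singularAt {s : ℕ} {p : Fin s → Fin 2 → ℂ} {Q : Fin s → Fin 4 → ℂ}
    {F : MvPolynomial (Fin 4) ℂ} {d : ℕ} (hF : F.IsHomogeneous d) (h : ∀ a, SingularAt F (Q a)) :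
    IsSingularSystem d p Q ![F, 0] where
  homogeneous := Fin.forall_fin_two.2 ⟨hF, isHomogeneous_zero _ _ _⟩
  base := Fin.forall_fin_two.2 ⟨fun a => (h a).1, fun a => map_zero _⟩
  singular a k := by simp [(h a).2 k]

theorem isSingularSystem_of_linearMap {r s d : ℕ} {p : Fin s → Fin r → ℂ} {Q : Fin s → Fin 4 → ℂ}
    {γ : (Fin r → ℂ) →ₗ[ℂ] MvPolynomial (Fin 4) ℂ} (hhom : ∀ v, (γ v).IsHomogeneous d)
    (hbase : ∀ v a, eval (Q a) (γ v) = 0) (h : ∀ a, SingularAt (γ (p a)) (Q a)) :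
    IsSingularSystem d p Q fun i => γ (Pi.single i 1) where
  homogeneous _ := hhom _
  base _ := hbase _
  singular a k := by
    have hsing := (h a).2 k
    rw [pi_eq_sum_univ' (p a)] at hsing
    simpa only [map_sum, map_smul, Derivation.map_smul, smul_eval, Pi.single_apply] using hsing

theorem IsGrove.exists_isSingularSystem {p : Fin 8 → Fin 2 → ℂ} {Q : Fin 8 → Fin 4 → ℂ}
    {Γ : Submodule ℂ (MvPolynomial (Fin 4) ℂ)} (h : IsGrove p Q Γ) :
    ∃ G, IsSingularSystem 3 p Q G ∧ G ≠ 0 := by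
  rcases h.singular with ⟨hdim, hsing⟩ | ⟨-, γ, hγ⟩
  · have : Nontrivial Γ := Module.nontrivial_of_finrank_pos (R := ℂ) (by omega)
    obtain ⟨F, hF⟩ := exists_ne (0 : Γ)
    refine ⟨_, isSingularSystem_of_singularAt (h.cubics F.2) (hsing F F.2), fun hzero => hF ?_⟩
    exact Subtype.ext (congrFun hzero 0)
  · refine ⟨_, isSingularSystem_of_linearMap (γ := Γ.subtype ∘ₗ γ.toLinearMap)
      (fun v => h.cubics (γ v).2) (fun v => h.base _ (γ v).2) hγ, fun hzero => ?_⟩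
    have hγ0 : γ (Pi.single 0 1) = 0 := Subtype.ext (congrFun hzero 0)
    simpa using γ.map_eq_zero_iff.1 hγ0

theorem forGeneralPoints_not_exists_isGrove :
    ForGeneralPoints 1 8 fun p => ¬ ∃ Γ, IsGrove p octad Γ := by
  obtain ⟨Φ, hΦ, hG⟩ := forGeneralPoints_of_forall_isSingularSystem (r := 1)
    fun _ => eq_zero_of_isSingularSystem_octad
  refine ⟨Φ, hΦ, fun p hp hpΦ ⟨Γ, hΓ⟩ => ?_⟩
  obtain ⟨G, hsys, hne⟩ := hΓ.exists_isSingularSystem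
  exact hne (hG p hp hpΦ G hsys)

/-! ### Values in general position -/

section Generic

open Filter

variable {ι κ R : Type*} [CommRing R] [IsDomain R]

/-- The filter of the Zariski neighbourhoods of the generic point of the affine space `ι → R`:
the sets containing `{x | Φ x ≠ 0}` for some nonzero polynomial `Φ`. -/
def generic (ι R : Type*) [CommRing R] [IsDomain R] : Filter (ι → R) where
  sets := {s | ∃ Φ : MvPolynomial ι R, Φ ≠ 0 ∧ ∀ x, eval x Φ ≠ 0 → x ∈ s}
  univ_sets := ⟨1, one_ne_zero, fun _ _ => trivial⟩
  sets_of_superset := fun ⟨Φ, hΦ, h⟩ hst => ⟨Φ, hΦ, fun x hx => hst (h x hx)⟩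
  inter_sets := fun ⟨Φ, hΦ, h⟩ ⟨Ψ, hΨ, h'⟩ => ⟨Φ * Ψ, mul_ne_zero hΦ hΨ, fun x hx => by
    rw [map_mul, mul_ne_zero_iff] at hx
    exact ⟨h x hx.1, h' x hx.2⟩⟩

theorem eventually_generic_iff {p : (ι → R) → Prop} :
    (∀ᶠ x in generic ι R, p x) ↔
      ∃ Φ : MvPolynomial ι R, Φ ≠ 0 ∧ ∀ x, eval x Φ ≠ 0 → p x :=
  Iff.rfl

instance generic_neBot [Infinite R] : (generic ι R).NeBot := by
  refine neBot_iff.mpr fun h => ?_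
  obtain ⟨Φ, hΦ, hempty⟩ := eventually_generic_iff.mp (h ▸ eventually_bot (p := fun _ => False))
  exact hΦ (funext fun x => by_contra fun hx => hempty x (by simpa using hx))

theorem tendsto_comp_generic {f : κ → ι} (hf : f.Injective) :
    Tendsto (· ∘ f) (generic ι R) (generic κ R) := by
  rintro s ⟨Φ, hΦ, h⟩
  refine ⟨rename f Φ, (map_ne_zero_iff _ (rename_injective f hf)).mpr hΦ, fun x hx => h _ ?_⟩
  rwa [eval_rename] at hx

end Generic

section ParameterCount

variable {k A B : Type*} [Field k]
  [CommRing A] [Algebra k A] [CommRing B] [Algebra k B]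

theorem eventually_generic_forall_ne_of_trdeg_lt {ι : Type*} (x : ι → B)
    (h : Algebra.trdeg k B < Nat.card ι) :
    ∀ᶠ π in generic ι k, ∀ ψ : B →ₐ[k] k, π ≠ fun i => ψ (x i) := by
  have hdep : ¬ AlgebraicIndependent k x := fun hx => by
    have : Finite ι := Nat.finite_of_card_ne_zero (by rintro h0; simp [h0] at h)
    refine h.not_ge ?_
    simpa [← Nat.cast_card] using hx.lift_cardinalMk_le_trdeg
  rw [algebraicIndependent_iff] at hdep
  push Not at hdep
  obtain ⟨Φ, hΦx, hΦ⟩ := hdep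
  refine eventually_generic_iff.mpr ⟨Φ, hΦ, ?_⟩
  rintro _ hπ ψ rfl
  refine hπ ?_
  rw [← aeval_eq_eval, ← comp_aeval_apply, hΦx, map_zero]

theorem eventually_generic_forall_ne_div_of_trdeg_lt [IsDomain B] {ι : Type*} (α β : ι → B)
    (h : Algebra.trdeg k B < Nat.card ι) :
    ∀ᶠ π in generic ι k, ∀ ψ : B →ₐ[k] k, (∀ i, ψ (β i) ≠ 0) →
      π ≠ fun i => ψ (α i) / ψ (β i) := by
  by_cases hβ : ∃ i, β i = 0
  · obtain ⟨i, hi⟩ := hβ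
    exact .of_forall fun π ψ hψ => (hψ i (by rw [hi, map_zero])).elim
  push Not at hβ
  let M := Submonoid.closure (Set.range β)
  have hM : M ≤ nonZeroDivisors B := Submonoid.closure_le.mpr <| by
    rintro _ ⟨i, rfl⟩
    exact mem_nonZeroDivisors_of_ne_zero (hβ i)
  let S := Localization M
  have : IsDomain S := IsLocalization.isDomain_localization hM
  have : FaithfulSMul B S :=
    (faithfulSMul_iff_algebraMap_injective B S).mpr (IsLocalization.injective S hM)
  have : Algebra.IsAlgebraic B S := IsLocalization.isAlgebraic S M
  have trdeg_eq : Algebra.trdeg k S = Algebra.trdeg k B := by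
    rw [← trdeg_add_eq k B (A := S), trdeg_eq_zero (R := B), add_zero]
  let β' : ι → M := fun i => ⟨β i, Submonoid.subset_closure ⟨i, rfl⟩⟩
  filter_upwards [eventually_generic_forall_ne_of_trdeg_lt
    (fun i => IsLocalization.mk' S (α i) (β' i)) (trdeg_eq ▸ h)] with π hπ ψ hψ heq
  have isUnit_map : ∀ y : M, IsUnit (ψ y) := fun y =>
    Submonoid.closure_le (S := (IsUnit.submonoid k).comap ψ).mpr
      (by rintro _ ⟨i, rfl⟩; exact (hψ i).isUnit) y.2
  refine hπ (IsLocalization.liftAlgHom isUnit_map) (heq.trans (funext fun i => ?_))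
  rw [div_eq_iff (hψ i), IsLocalization.liftAlgHom_apply]
  exact ((IsLocalization.lift_mk'_spec (g := (ψ : B →+* k)) isUnit_map (α i) _ (β' i)).mp rfl).trans
    (mul_comm _ _)

theorem exists_mvPolynomial_algHom_extending {τ : Type*} (φ : A →ₐ[k] k) (v : τ → k) :
    ∃ ψ : MvPolynomial τ A →ₐ[k] k, (∀ j, ψ (X j) = v j) ∧ ∀ c, ψ (C c) = φ c := by
  let := φ.toRingHom.toAlgebra
  have : IsScalarTower k A k := .of_algebraMap_eq fun c => (φ.commutes c).symm
  exact ⟨(aeval v : MvPolynomial τ A →ₐ[A] k).restrictScalars k, aeval_X v, aeval_C v⟩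

theorem eventually_generic_forall_not_dotProduct_eq_of_apply_ne_zero [IsDomain A]
    {ι : Type*} {d n : ℕ}
    (hA : Algebra.trdeg k A ≤ d) (h : d + 2 * n ≤ Nat.card ι) (e : ι → Fin n → A) (j₀ : Fin n) :
    ∀ᶠ π in generic ι k, ∀ (φ : A →ₐ[k] k) (a b : Fin n → k), b j₀ ≠ 0 →
      (∀ i, b ⬝ᵥ φ ∘ e i ≠ 0) → ¬ ∀ i, a ⬝ᵥ φ ∘ e i = π i * (b ⬝ᵥ φ ∘ e i) := by
  let B := MvPolynomial (Fin n ⊕ {j // j ≠ j₀}) A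
  let y : Fin n → B := fun j => if hj : j = j₀ then 1 else X (.inr ⟨j, hj⟩)
  let α : ι → B := fun i => ∑ j, X (.inl j) * C (e i j)
  let β : ι → B := fun i => ∑ j, y j * C (e i j)
  have trdeg_lt : Algebra.trdeg k B < Nat.card ι := by
    rw [← trdeg_add_eq k A (A := B), trdeg_of_isDomain, Cardinal.mk_fintype]
    have card_eq : Fintype.card (Fin n ⊕ {j // j ≠ j₀}) = n + (n - 1) := by
      rw [Fintype.card_sum, Fintype.card_fin, Fintype.card_subtype_compl, Fintype.card_fin,
        Fintype.card_subtype_eq]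
    have := j₀.pos
    rw [card_eq, Cardinal.lift_natCast]
    refine (add_le_add_left hA _).trans_lt ?_
    exact_mod_cast (by omega : d + (n + (n - 1)) < Nat.card ι)
  filter_upwards [eventually_generic_forall_ne_div_of_trdeg_lt α β trdeg_lt]
    with π hπ φ a b hb hden heq
  obtain ⟨ψ, ψ_X, ψ_C⟩ := exists_mvPolynomial_algHom_extending φ
    (Sum.elim (fun j => a j / b j₀) fun j : {j // j ≠ j₀} => b j / b j₀)
  have ψ_y : ∀ j, ψ (y j) = b j / b j₀ := fun j => by
    by_cases hj : j = j₀
    · rw [show y j = 1 from dif_pos hj, map_one, hj, div_self hb]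
    · simp only [y, dif_neg hj, ψ_X, Sum.elim_inr]
  have ψ_α : ∀ i, ψ (α i) = (a ⬝ᵥ φ ∘ e i) / b j₀ := fun i => by
    simp only [α, dotProduct, Function.comp_apply, map_sum, map_mul, ψ_X, ψ_C, Sum.elim_inl,
      Finset.sum_div, div_mul_eq_mul_div]
  have ψ_β : ∀ i, ψ (β i) = (b ⬝ᵥ φ ∘ e i) / b j₀ := fun i => by
    simp only [β, dotProduct, Function.comp_apply, map_sum, map_mul, ψ_y, ψ_C,
      Finset.sum_div, div_mul_eq_mul_div]
  refine hπ ψ (fun i => ψ_β i ▸ div_ne_zero (hden i) hb) (funext fun i => ?_)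
  rw [ψ_α, ψ_β, heq, div_div_div_cancel_right₀ hb, mul_div_cancel_right₀ _ (hden i)]

theorem eventually_generic_forall_not_dotProduct_eq [IsDomain A] {ι : Type*} [Nonempty ι] {d n : ℕ}
    (hA : Algebra.trdeg k A ≤ d) (h : d + 2 * n ≤ Nat.card ι) (e : ι → Fin n → A) :
    ∀ᶠ π in generic ι k, ∀ (φ : A →ₐ[k] k) (a b : Fin n → k),
      (∀ i, b ⬝ᵥ φ ∘ e i ≠ 0) → ¬ ∀ i, a ⬝ᵥ φ ∘ e i = π i * (b ⬝ᵥ φ ∘ e i) := by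
  filter_upwards [Filter.eventually_all.mpr fun j₀ =>
    eventually_generic_forall_not_dotProduct_eq_of_apply_ne_zero hA h e j₀] with π hπ φ a b hden
  obtain ⟨j₀, hj₀⟩ : ∃ j₀, b j₀ ≠ 0 := by
    by_contra! hb
    exact hden (Classical.arbitrary ι) (by rw [show b = 0 from funext hb, zero_dotProduct])
  exact hπ j₀ φ a b hj₀ hden

end ParameterCount

/-! ### Places and residues -/

theorem isAlgebraic_adjoin_singleton_of_transcendental {k K : Type*} [Field k] [Field K]
    [Algebra k K] (hK : Algebra.trdeg k K ≤ 1) {a : K} (ha : Transcendental k a) :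
    Algebra.IsAlgebraic (Algebra.adjoin k {a}) K := by
  have indep : AlgebraicIndependent k fun _ : Unit => a :=
    algebraicIndependent_unique_type_iff.mpr ha
  have basis := indep.isTranscendenceBasis_of_lift_trdeg_le_of_finite (by simpa using hK)
  have := basis.isAlgebraic
  rwa [Set.range_const] at this

section Residues

variable {K : Type*} [Field K] [Algebra ℂ K]

instance Place.isTrivialOn (P : Place K) : P.localRing.valuation.IsTrivialOn ℂ where
  eq_one c hc := by
    have valuation_le_one (c : ℂ) : P.localRing.valuation (algebraMap ℂ K c) ≤ 1 :=
      (P.localRing.valuation_le_one_iff _).mpr (P.const_mem c)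
    refine le_antisymm (valuation_le_one c) ?_
    have := valuation_le_one c⁻¹
    rwa [map_inv₀, map_inv₀, inv_le_one₀ (by simpa [zero_lt_iff] using hc)] at this

theorem Place.exists_one_lt_valuation (P : Place K) : ∃ z, 1 < P.localRing.valuation z := by
  by_contra! h
  exact P.ne_top (eq_top_iff.mpr fun z _ => (P.localRing.valuation_le_one_iff z).mp (h z))

theorem Place.valuation_aeval_eq_one (P : Place K) {a : K}
    (ha : ∀ c : ℂ, P.localRing.valuation (a - algebraMap ℂ K c) = 1) {p : Polynomial ℂ}
    (hp : p ≠ 0) : P.localRing.valuation (Polynomial.aeval a p) = 1 := by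
  rw [(IsAlgClosed.splits p).eq_prod_roots, map_mul, Polynomial.aeval_C, map_mul,
    Valuation.IsTrivialOn.eq_one _ (by simpa using hp), one_mul, map_multiset_prod,
    map_multiset_prod]
  refine Multiset.prod_eq_one fun x hx => ?_
  simp only [Multiset.map_map, Multiset.mem_map, Function.comp_apply, map_sub,
    Polynomial.aeval_X, Polynomial.aeval_C] at hx
  obtain ⟨c, -, rfl⟩ := hx
  exact ha c

theorem Place.exists_valuation_sub_lt_one (hK : Algebra.trdeg ℂ K ≤ 1) (P : Place K) {a : K}
    (ha : P.localRing.valuation a ≤ 1) :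
    ∃ c : ℂ, P.localRing.valuation (a - algebraMap ℂ K c) < 1 := by
  set v := P.localRing.valuation
  by_contra! h
  have aeval_eq_one {p : Polynomial ℂ} (hp : p ≠ 0) : v (Polynomial.aeval a p) = 1 :=
    P.valuation_aeval_eq_one (fun c => le_antisymm ((v.map_sub _ _).trans
      (max_le ha (Valuation.IsTrivialOn.valuation_algebraMap_le_one _ c))) (h c)) hp
  have transcendental : Transcendental ℂ a := transcendental_iff.mpr fun p hp => by
    by_contra hp0
    simpa [hp] using aeval_eq_one hp0
  have := isAlgebraic_adjoin_singleton_of_transcendental hK transcendental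
  have : v.IsTrivialOn (Algebra.adjoin ℂ {a}) := ⟨by
    rintro ⟨w, hw⟩ hw0
    rw [Algebra.adjoin_singleton_eq_range_aeval] at hw
    obtain ⟨p, rfl⟩ := hw
    exact aeval_eq_one fun hp => hw0 (Subtype.ext (by simp [hp]))⟩
  obtain ⟨z, hz⟩ := P.exists_one_lt_valuation
  have hz0 : z ≠ 0 := by rintro rfl; simp at hz
  exact Valuation.transcendental_of_ne_one (Algebra.adjoin ℂ {a}) (v := v) z hz0 hz.ne'
    (Algebra.IsAlgebraic.isAlgebraic z)

theorem Place.exists_residueHom (hK : Algebra.trdeg ℂ K ≤ 1) (P : Place K) :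
    ∃ ρ : P.localRing →+* ℂ, ∀ a c,
      ρ a = c ↔ P.localRing.valuation ((a : K) - algebraMap ℂ K c) < 1 := by
  let const : ℂ →+* P.localRing := (algebraMap ℂ K).codRestrict P.localRing.toSubring P.const_mem
  let residue := IsLocalRing.residue P.localRing
  have residue_eq_iff (a : P.localRing) (c : ℂ) : residue a = residue (const c) ↔
      P.localRing.valuation ((a : K) - algebraMap ℂ K c) < 1 := by
    rw [← sub_eq_zero, ← map_sub, IsLocalRing.residue_eq_zero_iff,
      ValuationSubring.valuation_lt_one_iff]
    rfl
  have bijective : Function.Bijective (residue.comp const) := by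
    refine ⟨(residue.comp const).injective, fun r => ?_⟩
    obtain ⟨a, rfl⟩ := IsLocalRing.residue_surjective r
    obtain ⟨c, hc⟩ := P.exists_valuation_sub_lt_one hK
      ((P.localRing.valuation_le_one_iff (a : K)).mpr a.2)
    exact ⟨c, ((residue_eq_iff a c).mpr hc).symm⟩
  let e := RingEquiv.ofBijective _ bijective
  refine ⟨e.symm.toRingHom.comp residue, fun a c => ?_⟩
  rw [← residue_eq_iff]
  exact e.symm_apply_eq

/-- The elements of valuation at most `γ` at `P`. -/
def Place.closedBall (P : Place K) (γ : P.localRing.ValueGroup) : Submodule ℂ K where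
  carrier := {z | P.localRing.valuation z ≤ γ}
  zero_mem' := by simp
  add_mem' := fun ha hb => (P.localRing.valuation.map_add _ _).trans (max_le ha hb)
  smul_mem' := fun c z hz => by
    rw [Set.mem_ofPred_eq, Algebra.smul_def, map_mul]
    exact (mul_le_of_le_one_left' (Valuation.IsTrivialOn.valuation_algebraMap_le_one _ c)).trans hz

theorem Place.exists_le_closedBall (P : Place K) {V : Submodule ℂ K} [FiniteDimensional ℂ V]
    (hV : V ≠ ⊥) : ∃ s ∈ V, s ≠ 0 ∧ V ≤ P.closedBall (P.localRing.valuation s) := by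
  let b := Module.finBasis ℂ V
  have : Nontrivial V := Submodule.nontrivial_iff_ne_bot.mpr hV
  have : Nonempty (Fin (Module.finrank ℂ V)) := Fin.pos_iff_nonempty.mp Module.finrank_pos
  obtain ⟨j, hj⟩ := Finite.exists_max fun j => P.localRing.valuation (b j : K)
  refine ⟨b j, (b j).2, fun h => b.ne_zero j (Subtype.ext h), ?_⟩
  calc V = (Submodule.span ℂ (Set.range b)).map V.subtype := by simp [b.span_eq]
    _ ≤ P.closedBall (P.localRing.valuation (b j)) := by
      rw [Submodule.map_span, Submodule.span_le]
      rintro _ ⟨_, ⟨i, rfl⟩, rfl⟩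
      exact hj i

theorem Place.exists_leadingFunctional (hK : Algebra.trdeg ℂ K ≤ 1) (P : Place K)
    {V : Submodule ℂ K} [FiniteDimensional ℂ V] (hV : V ≠ ⊥) :
    ∃ l : V →ₗ[ℂ] ℂ, l ≠ 0 ∧ ∀ (g h : V) (f : K) (c : ℂ), f * h = g →
      P.TakesValue f ![c, 1] → l g = c * l h := by
  set v := P.localRing.valuation
  obtain ⟨ρ, hρ⟩ := P.exists_residueHom hK
  have ρ_eq {a : P.localRing} {c : ℂ} (h : v ((a : K) - algebraMap ℂ K c) < 1) : ρ a = c :=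
    (hρ a c).mpr h
  obtain ⟨s, hsV, hs, hVs⟩ := P.exists_le_closedBall hV
  have v_div_le (g : V) : v ((g : K) / s) ≤ 1 := by
    rw [map_div₀]
    exact div_le_one_of_le₀ (hVs g.2) zero_le
  let quot (g : V) : P.localRing := ⟨g / s, (P.localRing.valuation_le_one_iff _).mp (v_div_le g)⟩
  let l : V →ₗ[ℂ] ℂ :=
    { toFun := fun g => ρ (quot g)
      map_add' := fun g h => by
        rw [← map_add]
        exact congrArg ρ (Subtype.ext (add_div _ _ _))
      map_smul' := fun c g => by
        have ρ_const : ρ ⟨_, P.const_mem c⟩ = c := ρ_eq (by simp)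
        rw [RingHom.id_apply, smul_eq_mul, ← ρ_const, ← map_mul, ρ_const]
        refine congrArg ρ (Subtype.ext ?_)
        simp [quot, Algebra.smul_def, mul_div_assoc] }
  refine ⟨l, fun hl => ?_, fun g h f c hfg hf => ?_⟩
  · have l_s : l ⟨s, hsV⟩ = 1 := ρ_eq (by simp [quot, div_self hs])
    simp [hl] at l_s
  · obtain ⟨-, hf⟩ | ⟨h10, -⟩ := hf
    swap
    · exact absurd h10 one_ne_zero
    rw [← sub_eq_zero, ← smul_eq_mul, ← map_smul, ← map_sub]
    refine ρ_eq ?_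
    have : ((g - c • h : V) : K) / s = (f - algebraMap ℂ K c) * (h / s) := by
      rw [Submodule.coe_sub, Submodule.coe_smul, Algebra.smul_def, ← hfg]
      ring
    change v (((g - c • h : V) : K) / s - algebraMap ℂ K 0) < 1
    rw [map_zero, sub_zero, this, map_mul]
    refine (mul_le_of_le_one_right' (v_div_le h)).trans_lt ?_
    simpa using hf

end Residues

section QuotientValues

variable {K : Type*} [Field K] [Algebra ℂ K]

/-- The quotients `g / h` of elements `g` and `h ≠ 0` of `V`: the rational functions cut out by the
pencils in the linear system `V`. -/
def quotients (V : Submodule ℂ K) : Set K :=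
  {f | ∃ h ∈ V, h ≠ 0 ∧ f * h ∈ V}

theorem exists_eventually_leadingFunctional {ι : Type*} [Finite ι] (hK : Algebra.trdeg ℂ K ≤ 1)
    (Q : ι → Place K) {V : Submodule ℂ K} [FiniteDimensional ℂ V] (hV : V ≠ ⊥)
    (hsub : ∀ U ≤ V, Module.finrank ℂ U < Module.finrank ℂ V →
      ∀ᶠ π in generic ι ℂ, ∀ f ∈ quotients U, ¬ ∀ i, (Q i).TakesValue f ![π i, 1]) :
    ∃ l : ι → V →ₗ[ℂ] ℂ, ∀ᶠ π in generic ι ℂ, ∀ (g h : V) (f : K), (h : K) ≠ 0 → f * h = g →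
      (∀ i, (Q i).TakesValue f ![π i, 1]) → ∀ i, l i h ≠ 0 ∧ l i g = π i * l i h := by
  choose l hl_ne hl using fun i => (Q i).exists_leadingFunctional hK hV
  let U (i : ι) : Submodule ℂ K := (LinearMap.ker (l i)).map V.subtype
  have finrank_U (i : ι) : Module.finrank ℂ (U i) < Module.finrank ℂ V := by
    rw [Submodule.finrank_map_subtype_eq]
    exact Submodule.finrank_lt fun h => hl_ne i (LinearMap.ker_eq_top.mp h)
  refine ⟨l, ?_⟩
  filter_upwards [Filter.eventually_all.mpr fun i =>
    hsub (U i) (Submodule.map_subtype_le V _) (finrank_U i)] with π hπ g h f hh hfg hf i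
  have l_g : l i g = π i * l i h := hl i g h f (π i) hfg (hf i)
  refine ⟨fun l_h => hπ i f ?_ hf, l_g⟩
  rw [l_h, mul_zero] at l_g
  exact ⟨h, ⟨h, l_h, rfl⟩, hh, ⟨g, l_g, hfg.symm⟩⟩

theorem eventually_generic_forall_quotients_not_takesValue {ι : Type*}
    (hK : Algebra.trdeg ℂ K ≤ 1) (Q : ι → Place K) (V : Submodule ℂ K) [FiniteDimensional ℂ V]
    (hV : 2 * Module.finrank ℂ V ≤ Nat.card ι) :
    ∀ᶠ π in generic ι ℂ, ∀ f ∈ quotients V, ¬ ∀ i, (Q i).TakesValue f ![π i, 1] := by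
  induction hn : Module.finrank ℂ V using Nat.strong_induction_on generalizing V with
  | _ n ih =>
  obtain rfl | hV0 := eq_or_ne V ⊥
  · exact .of_forall fun π f ⟨h, hh, hh0, _⟩ => absurd ((Submodule.mem_bot ℂ).mp hh) hh0
  have finrank_pos : 0 < Module.finrank ℂ V := Submodule.one_le_finrank_iff.mpr hV0
  have : Finite ι := Nat.finite_of_card_ne_zero (by omega)
  have : Nonempty ι := (Nat.card_pos_iff.mp (by omega)).1
  obtain ⟨l, hl⟩ := exists_eventually_leadingFunctional hK Q hV0 fun U hU hlt =>
    have := Submodule.finiteDimensional_of_le hU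
    ih _ (hn ▸ hlt) U (by omega) rfl
  let b := Module.finBasis ℂ V
  let e (i : ι) (j : Fin (Module.finrank ℂ V)) : ℂ := l i (b j)
  have l_eq (i : ι) (r : V) : l i r = b.repr r ⬝ᵥ e i := by
    conv_lhs => rw [← b.sum_repr r]
    rw [map_sum]
    simp only [map_smul, smul_eq_mul, dotProduct, e]
  filter_upwards [hl, eventually_generic_forall_not_dotProduct_eq (d := 0) (k := ℂ) (A := ℂ)
    (by simp [trdeg_eq_zero]) (by omega) e] with π hl hπ
  rintro f ⟨h, hh, hh0, hg⟩ hf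
  have hlf := hl ⟨f * h, hg⟩ ⟨h, hh⟩ f hh0 rfl hf
  simp only [l_eq] at hlf
  exact hπ (AlgHom.id ℂ ℂ) (b.repr ⟨f * h, hg⟩) (b.repr ⟨h, hh⟩) (fun i => (hlf i).1)
    fun i => (hlf i).2

theorem exists_eq_smul_add_sum_smul {k E : Type*} [Field k] [AddCommGroup E] [Module k E]
    (V : Submodule k E) [FiniteDimensional k V] {v : E} (hv : v ∈ V) (hv0 : v ≠ 0) :
    ∃ b : Fin (Module.finrank k V - 1) → V, ∀ r ∈ V, ∃ (a₀ : k) (a : Fin _ → k),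
      r = a₀ • v + ∑ j, a j • (b j : E) := by
  let L := Submodule.span k {(⟨v, hv⟩ : V)}
  have finrank_quotient : Module.finrank k (V ⧸ L) = Module.finrank k V - 1 := by
    rw [← L.finrank_quotient_add_finrank, finrank_span_singleton (by simpa using hv0),
      Nat.add_sub_cancel]
  let b := Module.finBasisOfFinrankEq k (V ⧸ L) finrank_quotient
  choose b' hb' using fun j => L.mkQ_surjective (b j)
  refine ⟨b', fun r hr => ?_⟩
  let a := b.repr (L.mkQ ⟨r, hr⟩)
  have : (⟨r, hr⟩ - ∑ j, a j • b' j : V) ∈ L := by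
    rw [← L.ker_mkQ, LinearMap.mem_ker, map_sub, map_sum]
    simp [hb', a, b.sum_repr, -Submodule.mkQ_apply]
  obtain ⟨a₀, ha₀⟩ := Submodule.mem_span_singleton.mp this
  refine ⟨a₀, a, ?_⟩
  have := congrArg Subtype.val (eq_add_of_sub_eq ha₀.symm)
  simpa using this

theorem exists_forall_apply_eq_dotProduct_of_apply_eq_zero {k ι B : Type*} [Field k] [CommRing B]
    [Nontrivial B] [Algebra k B] {V : Submodule k B} [FiniteDimensional k V] (h1 : 1 ∈ V)
    (m : ι → V →ₗ[k] k) :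
    ∃ e : ι → Fin (Module.finrank k V - 1) → B, ∀ (φ : B →ₐ[k] k) (r : V), φ r = 0 →
      ∃ a : Fin (Module.finrank k V - 1) → k, ∀ i, m i r = a ⬝ᵥ φ ∘ e i := by
  obtain ⟨b, hb⟩ := exists_eq_smul_add_sum_smul V h1 one_ne_zero
  -- For `r = a₀ + ∑ aⱼ bⱼ` with `φ r = 0`, eliminating `a₀` turns `mᵢ r` into
  -- `∑ aⱼ φ (mᵢ bⱼ - (mᵢ 1) bⱼ)`.
  refine ⟨fun i j => algebraMap k B (m i (b j)) - m i ⟨1, h1⟩ • (b j : B), fun φ r hφ => ?_⟩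
  obtain ⟨a₀, a, ha⟩ := hb r r.2
  have a₀_eq : a₀ = - ∑ j, a j * φ (b j) := by
    rw [ha] at hφ
    simpa [eq_neg_iff_add_eq_zero] using hφ
  refine ⟨a, fun i => ?_⟩
  have r_eq : r = a₀ • ⟨1, h1⟩ + ∑ j, a j • b j := Subtype.ext (by simpa using ha)
  rw [r_eq, a₀_eq]
  simp only [map_add, map_smul, map_sum, smul_eq_mul, dotProduct, Function.comp_apply,
    map_sub, AlgHom.commutes, Algebra.algebraMap_self_apply, mul_sub, Finset.sum_sub_distrib,
    neg_mul, Finset.sum_mul]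
  rw [neg_add_eq_sub]
  congr 1
  exact Finset.sum_congr rfl fun j _ => by ring

theorem eventually_generic_forall_common_zero_not_takesValue {ι B : Type*} [CommRing B]
    [IsDomain B] [Algebra ℂ B] [Algebra B K] [IsScalarTower ℂ B K] [FaithfulSMul B K]
    (hK : Algebra.trdeg ℂ K ≤ 1) (hB : Algebra.trdeg ℂ B ≤ 1) (Q : ι → Place K)
    (V : Submodule ℂ B) [FiniteDimensional ℂ V] (h1 : 1 ∈ V)
    (hV : 2 * Module.finrank ℂ V ≤ Nat.card ι + 1) :
    ∀ᶠ π in generic ι ℂ, ∀ φ : B →ₐ[ℂ] ℂ, ∀ g ∈ V, ∀ h ∈ V, φ g = 0 → φ h = 0 → h ≠ 0 →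
      ∀ f, f * algebraMap B K h = algebraMap B K g → ¬ ∀ i, (Q i).TakesValue f ![π i, 1] := by
  let j : B →ₗ[ℂ] K := (IsScalarTower.toAlgHom ℂ B K).toLinearMap
  have j_injective : Function.Injective j := FaithfulSMul.algebraMap_injective B K
  have finrank_map : Module.finrank ℂ (V.map j) = Module.finrank ℂ V :=
    (V.equivMapOfInjective j j_injective).finrank_eq.symm
  have finrank_pos : 0 < Module.finrank ℂ V :=
    Submodule.one_le_finrank_iff.mpr (V.ne_bot_iff.mpr ⟨1, h1, one_ne_zero⟩)
  have : Finite ι := Nat.finite_of_card_ne_zero (by omega)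
  have : Nonempty ι := (Nat.card_pos_iff.mp (by omega)).1
  obtain ⟨l, hl⟩ := exists_eventually_leadingFunctional hK Q (V := V.map j)
    (Submodule.one_le_finrank_iff.mp (finrank_map ▸ finrank_pos)) fun U hU hlt =>
      have := Submodule.finiteDimensional_of_le hU
      eventually_generic_forall_quotients_not_takesValue hK Q U (by omega)
  obtain ⟨e, m_eq⟩ := exists_forall_apply_eq_dotProduct_of_apply_eq_zero h1
    fun i => l i ∘ₗ j.submoduleMap V
  filter_upwards [hl, eventually_generic_forall_not_dotProduct_eq (d := 1) (k := ℂ)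
    (by simpa using hB) (by omega) e] with π hl hπ φ g hg h hh hφg hφh hh0 f hfg hf
  obtain ⟨a, ha⟩ := m_eq φ ⟨g, hg⟩ hφg
  obtain ⟨a', ha'⟩ := m_eq φ ⟨h, hh⟩ hφh
  have hlf := hl (j.submoduleMap V ⟨g, hg⟩) (j.submoduleMap V ⟨h, hh⟩) f
    ((map_ne_zero_iff _ j_injective).mpr hh0) hfg hf
  exact hπ φ a a' (fun i => ha' i ▸ (hlf i).1) fun i => ha' i ▸ ha i ▸ (hlf i).2

end QuotientValues

/-! ### The coordinate ring of an elliptic curve -/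

section QuadraticExtension

variable {A L : Type*} [CommRing A] [IsDomain A] [Field L] [Algebra A L] [FaithfulSMul A L]

theorem dvd_of_isIntegral_of_mul_eq [IsIntegrallyClosed A] {w : L} (hw : IsIntegral A w) {s a : A}
    (hs : s ≠ 0) (h : algebraMap A L s * w = algebraMap A L a) : s ∣ a := by
  let := FractionRing.liftAlgebra A L
  have hs' : algebraMap A L s ≠ 0 := by simpa using hs
  have w_eq : w = algebraMap (FractionRing A) L (algebraMap A _ a / algebraMap A _ s) := by
    rw [map_div₀, ← IsScalarTower.algebraMap_apply, ← IsScalarTower.algebraMap_apply, ← h,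
      mul_div_cancel_left₀ _ hs']
  rw [w_eq, isIntegral_algebraMap_iff (algebraMap (FractionRing A) L).injective,
    IsIntegrallyClosed.isIntegral_iff] at hw
  obtain ⟨b, hb⟩ := hw
  refine ⟨b, FaithfulSMul.algebraMap_injective A L ?_⟩
  rw [map_mul, IsScalarTower.algebraMap_apply A (FractionRing A) L b, hb, ← w_eq, h]

theorem dvd_of_sq_dvd_sq_mul_of_squarefree [UniqueFactorizationMonoid A] {s q ψ : A} (hs : s ≠ 0)
    (hψ : Squarefree ψ) (h : s ^ 2 ∣ q ^ 2 * ψ) : s ∣ q := by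
  obtain ⟨s', q', c, coprime, rfl, rfl⟩ :=
    UniqueFactorizationMonoid.exists_reduced_factors s hs q
  rw [mul_pow, mul_pow, mul_assoc, mul_dvd_mul_iff_left (pow_ne_zero 2 (left_ne_zero_of_mul hs))]
    at h
  have : s' ^ 2 ∣ ψ := coprime.pow.dvd_of_dvd_mul_left h
  exact mul_dvd_mul_left c (hψ s' (sq s' ▸ this)).dvd

theorem exists_eq_add_mul_of_isIntegral [UniqueFactorizationMonoid A] (h2 : IsUnit (2 : A)) {ψ : A}
    (hψ : Squarefree ψ) {η : L} (hη : η ^ 2 = algebraMap A L ψ) {σ : L →ₐ[A] L} (hσ : σ η = -η)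
    {z : L} (hz : IsIntegral A z) {s p q : A} (hs : s ≠ 0)
    (h : algebraMap A L s * z = algebraMap A L p + algebraMap A L q * η) :
    ∃ p' q' : A, z = algebraMap A L p' + algebraMap A L q' * η := by
  have hσz : IsIntegral A (σ z) := hz.map σ
  have h' : algebraMap A L s * σ z = algebraMap A L p - algebraMap A L q * η := by
    simpa [hσ, ← sub_eq_add_neg] using congrArg σ h
  have trace : s ∣ 2 * p := dvd_of_isIntegral_of_mul_eq (hz.add hσz) hs (by
    rw [map_mul, map_ofNat]
    linear_combination h + h')
  have discr : s ^ 2 ∣ (2 * q) ^ 2 * ψ :=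
    dvd_of_isIntegral_of_mul_eq ((hz.sub hσz).pow 2) (pow_ne_zero 2 hs) (by
      have : algebraMap A L s * (z - σ z) = 2 * algebraMap A L q * η := by
        linear_combination h - h'
      rw [map_pow, ← mul_pow, this, mul_pow, hη, map_mul, map_pow, map_mul, map_ofNat])
  obtain ⟨p', rfl⟩ := h2.dvd_mul_left.mp trace
  obtain ⟨q', rfl⟩ := h2.dvd_mul_left.mp (dvd_of_sq_dvd_sq_mul_of_squarefree hs hψ discr)
  have hs' : algebraMap A L s ≠ 0 := by simpa using hs
  refine ⟨p', q', mul_left_cancel₀ hs' ?_⟩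
  rw [h, map_mul, map_mul]
  ring

end QuadraticExtension

section CoordinateRing

open WeierstrassCurve.Affine
open scoped Polynomial

variable {F : Type*} [Field F] {W : WeierstrassCurve.Affine F}

instance : Module.Finite F[X] W.CoordinateRing :=
  .of_basis (CoordinateRing.basis W)

variable (W) in
theorem trdeg_coordinateRing : Algebra.trdeg F W.CoordinateRing = 1 := by
  rw [← trdeg_add_eq F F[X] (A := W.CoordinateRing), trdeg_eq_zero (R := F[X]), add_zero,
    Polynomial.trdeg_of_isDomain]

variable (W) in
theorem trdeg_functionField : Algebra.trdeg F W.FunctionField = 1 := by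
  have : Algebra.IsAlgebraic W.CoordinateRing W.FunctionField :=
    IsLocalization.isAlgebraic _ (nonZeroDivisors W.CoordinateRing)
  rw [← trdeg_add_eq F W.CoordinateRing (A := W.FunctionField), trdeg_coordinateRing,
    trdeg_eq_zero (R := W.CoordinateRing), add_zero]

theorem squarefree_toPoly_twoTorsionPolynomial [W.IsElliptic] (h2 : (2 : F) ≠ 0) :
    Squarefree W.twoTorsionPolynomial.toPoly := by
  have leading : W.twoTorsionPolynomial.a ≠ 0 := by
    change (4 : F) ≠ 0
    rw [show (4 : F) = 2 ^ 2 by norm_num]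
    exact pow_ne_zero 2 h2
  let φ := algebraMap F (AlgebraicClosure F)
  have splits : (W.twoTorsionPolynomial.toPoly.map φ).Splits := IsAlgClosed.splits _
  have discr : W.twoTorsionPolynomial.discr ≠ 0 :=
    W.twoTorsionPolynomial_discr_ne_zero h2.isUnit W.isUnit_Δ
  rw [Cubic.discr_ne_zero_iff_roots_nodup leading splits, Cubic.map_roots,
    Polynomial.nodup_roots_iff_of_splits (Polynomial.map_ne_zero
      (Cubic.ne_zero_of_a_ne_zero leading)) splits, Polynomial.separable_map] at discr
  exact discr.squarefree

theorem polynomial_comp_negPolynomial : W.polynomial.comp W.negPolynomial = W.polynomial := by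
  simp only [polynomial, negPolynomial, Polynomial.add_comp, Polynomial.sub_comp,
    Polynomial.mul_comp, Polynomial.pow_comp, Polynomial.C_comp, Polynomial.X_comp]
  ring

variable (W) in
/-- The involution `(x, y) ↦ (x, -y - a₁x - a₃)` of the coordinate ring, induced by `P ↦ -P`. -/
def negAlgHom : W.CoordinateRing →ₐ[F[X]] W.CoordinateRing :=
  AdjoinRoot.liftAlgHom W.polynomial (Algebra.ofId F[X] W.CoordinateRing)
    (CoordinateRing.mk W W.negPolynomial) (by
      change W.polynomial.eval₂ ((CoordinateRing.mk W).comp Polynomial.C) _ = 0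
      rw [← Polynomial.hom_eval₂, ← Polynomial.comp, polynomial_comp_negPolynomial]
      exact AdjoinRoot.mk_self)

theorem negAlgHom_mk (p : F[X][X]) :
    negAlgHom W (CoordinateRing.mk W p) = CoordinateRing.mk W (p.comp W.negPolynomial) := by
  rw [Polynomial.comp, Polynomial.hom_eval₂]
  rfl

theorem negAlgHom_comp_negAlgHom : (negAlgHom W).comp (negAlgHom W) = AlgHom.id F[X] _ := by
  refine AdjoinRoot.algHom_ext ?_
  change negAlgHom W (negAlgHom W (CoordinateRing.mk W .X)) = CoordinateRing.mk W .X
  rw [negAlgHom_mk, negAlgHom_mk, Polynomial.X_comp]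
  congr 1
  simp [negPolynomial]

theorem negAlgHom_mk_polynomialY :
    negAlgHom W (CoordinateRing.mk W W.polynomialY) = -CoordinateRing.mk W W.polynomialY := by
  rw [negAlgHom_mk, ← map_neg]
  congr 1
  simp only [polynomialY, negPolynomial, Polynomial.add_comp, Polynomial.mul_comp,
    Polynomial.C_comp, Polynomial.X_comp, map_ofNat, Polynomial.ofNat_comp]
  ring

variable (W) in
theorem exists_algHom_mk_polynomialY_eq_neg : ∃ σ : W.FunctionField →ₐ[F[X]] W.FunctionField,
    σ (algebraMap W.CoordinateRing _ (CoordinateRing.mk W W.polynomialY)) =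
      -algebraMap W.CoordinateRing _ (CoordinateRing.mk W W.polynomialY) := by
  let e : W.CoordinateRing ≃ₐ[F[X]] W.CoordinateRing :=
    .ofAlgHom (negAlgHom W) (negAlgHom W) negAlgHom_comp_negAlgHom negAlgHom_comp_negAlgHom
  refine ⟨(IsFractionRing.algEquivOfAlgEquiv e : W.FunctionField ≃ₐ[F[X]] W.FunctionField), ?_⟩
  have : e (CoordinateRing.mk W W.polynomialY) = _ := negAlgHom_mk_polynomialY
  simp [this]

theorem two_mul_smul_basis (p q : F[X]) : 2 * (p • 1 + q • CoordinateRing.mk W .X) =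
    algebraMap F[X] W.CoordinateRing (2 * p - q * (.C W.a₁ * .X + .C W.a₃)) +
      algebraMap F[X] W.CoordinateRing q * CoordinateRing.mk W W.polynomialY := by
  change _ = CoordinateRing.mk W (.C _) + CoordinateRing.mk W (.C q) * _
  simp only [CoordinateRing.smul, polynomialY, map_add, map_sub, map_mul, map_ofNat]
  ring

theorem exists_mul_eq_add_mul_mk_polynomialY (h2 : (2 : F[X]) ≠ 0) (z : W.FunctionField) :
    ∃ s p q : F[X], s ≠ 0 ∧ algebraMap F[X] W.FunctionField s * z =
      algebraMap F[X] W.FunctionField p + algebraMap F[X] W.FunctionField q *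
        algebraMap W.CoordinateRing _ (CoordinateRing.mk W W.polynomialY) := by
  obtain ⟨r, s, hs, rfl⟩ := IsFractionRing.div_surjective (A := W.CoordinateRing) z
  obtain ⟨c, d, hd, hdc⟩ := Algebra.IsAlgebraic.exists_smul_eq_mul F[X] r
    (nonZeroDivisors.ne_zero hs)
  obtain ⟨p, q, rfl⟩ := CoordinateRing.exists_smul_basis_eq c
  have hs' : algebraMap W.CoordinateRing W.FunctionField s ≠ 0 := by
    simpa using nonZeroDivisors.ne_zero hs
  have cleared : algebraMap F[X] W.CoordinateRing (2 * d) * r = s *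
      (algebraMap F[X] W.CoordinateRing (2 * p - q * (.C W.a₁ * .X + .C W.a₃)) +
        algebraMap F[X] W.CoordinateRing q * CoordinateRing.mk W W.polynomialY) := by
    rw [← two_mul_smul_basis, map_mul, map_ofNat, mul_assoc, ← Algebra.smul_def, hdc]
    ring
  refine ⟨2 * d, 2 * p - q * (.C W.a₁ * .X + .C W.a₃), q, mul_ne_zero h2 hd, ?_⟩
  rw [← mul_div_assoc, div_eq_iff hs', mul_comm _ (algebraMap _ _ s)]
  simpa only [map_mul, map_add, ← IsScalarTower.algebraMap_apply] using
    congrArg (algebraMap W.CoordinateRing W.FunctionField) cleared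

theorem isIntegrallyClosed_coordinateRing [W.IsElliptic] (h2 : (2 : F) ≠ 0) :
    IsIntegrallyClosed W.CoordinateRing := by
  refine (isIntegrallyClosed_iff W.FunctionField).mpr fun {z} hz => ?_
  have h2' : IsUnit (2 : F[X]) := h2.isUnit.map Polynomial.C
  have sq : algebraMap W.CoordinateRing W.FunctionField (CoordinateRing.mk W W.polynomialY) ^ 2 =
      algebraMap F[X] _ W.twoTorsionPolynomial.toPoly := by
    rw [← map_pow]
    exact congrArg _ (CoordinateRing.mk_ψ₂_sq W)
  obtain ⟨σ, hσ⟩ := exists_algHom_mk_polynomialY_eq_neg W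
  obtain ⟨s, p, q, hs, h⟩ := exists_mul_eq_add_mul_mk_polynomialY h2'.ne_zero z
  obtain ⟨p', q', rfl⟩ := exists_eq_add_mul_of_isIntegral h2'
    (squarefree_toPoly_twoTorsionPolynomial h2) sq hσ (isIntegral_trans z hz) hs h
  refine ⟨algebraMap F[X] _ p' + algebraMap F[X] _ q' * CoordinateRing.mk W W.polynomialY, ?_⟩
  rw [map_add, map_mul]
  rfl

end CoordinateRing

section Sections

open WeierstrassCurve.Affine
open scoped Polynomial

variable {F : Type*} [Field F] (W : WeierstrassCurve.Affine F)

/-- The linear parametrization of the sections of `𝒪(m∞)` on a Weierstrass curve, by the pairs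
`(p, q)` such that `p(x) + q(x) y` has a pole of order at most `m` at infinity, that is,
`2 deg p ≤ m` and `2 deg q + 3 ≤ m`. -/
def sectionsMap (m : ℕ) :
    (Polynomial.degreeLT F (m / 2 + 1) × Polynomial.degreeLT F ((m - 1) / 2)) →ₗ[F]
      W.CoordinateRing :=
  LinearMap.coprod
    ((LinearMap.toSpanSingleton F[X] _ 1).restrictScalars F ∘ₗ Submodule.subtype _)
    ((LinearMap.toSpanSingleton F[X] _ (CoordinateRing.mk W .X)).restrictScalars F ∘ₗ
      Submodule.subtype _)

/-- The sections of `𝒪(m∞)` on a Weierstrass curve: the functions with a pole of order at most `m`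
at infinity and no other pole. -/
def sections (m : ℕ) : Submodule F W.CoordinateRing :=
  LinearMap.range (sectionsMap W m)

instance (m : ℕ) : FiniteDimensional F (sections W m) :=
  LinearMap.finiteDimensional_range _

theorem finrank_sections {m : ℕ} (hm : 1 ≤ m) : Module.finrank F (sections W m) = m := by
  have injective : Function.Injective (sectionsMap W m) := by
    refine (injective_iff_map_eq_zero _).mpr ?_
    rintro ⟨⟨p, hp⟩, ⟨q, hq⟩⟩ h
    obtain ⟨rfl, rfl⟩ := CoordinateRing.smul_basis_eq_zero (W' := W) (p := p) (q := q) h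
    rfl
  rw [sections, LinearMap.finrank_range_of_inj injective, Module.finrank_prod,
    (Polynomial.degreeLTEquiv F _).finrank_eq, (Polynomial.degreeLTEquiv F _).finrank_eq,
    Module.finrank_fin_fun, Module.finrank_fin_fun]
  omega

variable {W}

theorem mem_sections_smul_basis_iff {m : ℕ} {p q : F[X]} :
    p • 1 + q • CoordinateRing.mk W .X ∈ sections W m ↔
      p.degree < (m / 2 + 1 : ℕ) ∧ q.degree < ((m - 1) / 2 : ℕ) := by
  simp only [← Polynomial.mem_degreeLT]
  constructor
  · rintro ⟨⟨p', q'⟩, h⟩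
    replace h : p'.1 • 1 + q'.1 • CoordinateRing.mk W .X = p • 1 + q • CoordinateRing.mk W .X := h
    have : (p'.1 - p) • 1 + (q'.1 - q) • CoordinateRing.mk W .X = 0 := by
      rw [sub_smul, sub_smul, sub_add_sub_comm, h, sub_self]
    obtain ⟨hp, hq⟩ := CoordinateRing.smul_basis_eq_zero this
    exact ⟨sub_eq_zero.mp hp ▸ p'.2, sub_eq_zero.mp hq ▸ q'.2⟩
  · rintro ⟨hp, hq⟩
    exact ⟨⟨⟨p, hp⟩, ⟨q, hq⟩⟩, rfl⟩

theorem mem_sections_iff {m : ℕ} (hm : 1 ≤ m) {r : W.CoordinateRing} :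
    r ∈ sections W m ↔ (Algebra.norm F[X] r).natDegree ≤ m := by
  obtain ⟨p, q, rfl⟩ := CoordinateRing.exists_smul_basis_eq r
  rw [mem_sections_smul_basis_iff, Polynomial.natDegree_le_iff_degree_le,
    CoordinateRing.degree_norm_smul_basis, max_le_iff]
  refine and_congr ?_ ?_
  · rcases eq_or_ne p 0 with rfl | hp
    · simp
    rw [Polynomial.degree_eq_natDegree hp, two_nsmul]
    norm_cast
    omega
  · rcases eq_or_ne q 0 with rfl | hq
    · simp
    rw [Polynomial.degree_eq_natDegree hq, two_nsmul]
    norm_cast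
    omega

theorem one_mem_sections {m : ℕ} (hm : 1 ≤ m) : 1 ∈ sections W m :=
  (mem_sections_iff hm).mpr (by simp)

section Valuation

variable {Γ : Type*} [LinearOrderedCommGroupWithZero Γ] {v : Valuation W.CoordinateRing Γ}
  [v.IsTrivialOn F] (hx : 1 < v (algebraMap F[X] _ .X))

include hx

theorem valuation_algebraMap_eq {p : F[X]} (hp : p ≠ 0) :
    v (algebraMap F[X] _ p) = v (algebraMap F[X] _ .X) ^ p.natDegree := by
  rw [← Polynomial.valuation_aeval_eq_valuation_X_pow_natDegree_of_one_lt_valuation_X _ hx hp,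
    Polynomial.aeval_algebraMap_apply, Polynomial.aeval_X_left_apply]

theorem valuation_algebraMap_le {p : F[X]} {n : ℕ} (hp : p.natDegree ≤ n) :
    v (algebraMap F[X] _ p) ≤ v (algebraMap F[X] _ .X) ^ n := by
  rcases eq_or_ne p 0 with rfl | h0
  · simp
  · exact (valuation_algebraMap_eq hx h0).trans_le (pow_le_pow_right₀ hx.le hp)

theorem valuation_mk_Y_sq :
    v (CoordinateRing.mk W .X) ^ 2 = v (algebraMap F[X] _ .X) ^ 3 := by
  set x := algebraMap F[X] W.CoordinateRing .X
  set y := CoordinateRing.mk W .X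
  let l : F[X] := .C W.a₁ * .X + .C W.a₃
  let c : F[X] := .X ^ 3 + .C W.a₂ * .X ^ 2 + .C W.a₄ * .X + .C W.a₆
  have equation : y * (y + algebraMap F[X] _ l) = algebraMap F[X] _ c :=
    AdjoinRoot.mk_eq_mk.mpr ⟨1, by
      simp only [l, c, polynomial, Polynomial.algebraMap_eq]
      ring⟩
  have natDegree_c : c.natDegree = 3 := by simp only [c]; compute_degree!
  have v_l : v (algebraMap F[X] _ l) ≤ v x :=
    (valuation_algebraMap_le hx (Polynomial.natDegree_linear_le)).trans_eq (pow_one _)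
  have v_c : v y * v (y + algebraMap F[X] _ l) = v x ^ 3 := by
    rw [← map_mul, equation, valuation_algebraMap_eq hx
      (Polynomial.ne_zero_of_natDegree_gt (n := 2) (by omega)), natDegree_c]
  have v_x_lt : v x < v y := by
    by_contra! hle
    refine (pow_lt_pow_right₀ hx (by norm_num : 2 < 3)).not_ge ?_
    rw [← v_c, sq]
    exact mul_le_mul' hle (v.map_add_le hle v_l)
  rw [← v_c, v.map_add_eq_of_lt_left (v_l.trans_lt v_x_lt), sq]

theorem valuation_sq_eq {r : W.CoordinateRing} (hr : r ≠ 0) :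
    v r ^ 2 = v (algebraMap F[X] _ .X) ^ (Algebra.norm F[X] r).natDegree := by
  obtain ⟨p, q, rfl⟩ := CoordinateRing.exists_smul_basis_eq r
  have v_p (hp : p ≠ 0) : v (p • 1) ^ 2 = v (algebraMap F[X] _ .X) ^ (2 * p.natDegree) := by
    rw [Algebra.smul_def, mul_one, valuation_algebraMap_eq hx hp, ← pow_mul, mul_comm]
  have v_q (hq : q ≠ 0) : v (q • CoordinateRing.mk W .X) ^ 2 =
      v (algebraMap F[X] _ .X) ^ (2 * q.natDegree + 3) := by
    rw [Algebra.smul_def, map_mul, mul_pow, valuation_mk_Y_sq hx, valuation_algebraMap_eq hx hq,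
      ← pow_mul, mul_comm _ 2, pow_add]
  rw [Polynomial.natDegree, CoordinateRing.degree_norm_smul_basis]
  rcases eq_or_ne p 0 with rfl | hp <;> rcases eq_or_ne q 0 with rfl | hq
  · simp at hr
  · rw [zero_smul, zero_add, v_q hq, Polynomial.degree_eq_natDegree hq, Polynomial.degree_zero]
    rfl
  · rw [zero_smul, add_zero, v_p hp, Polynomial.degree_eq_natDegree hp, Polynomial.degree_zero]
    rfl
  · have v_ne : v (p • 1) ≠ v (q • CoordinateRing.mk W .X) := fun h => by
      have := pow_right_injective₀ (zero_lt_one.trans hx) hx.ne'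
        ((v_p hp).symm.trans ((congrArg (· ^ 2) h).trans (v_q hq)))
      omega
    rw [v.map_add_of_distinct_val v_ne, (pow_left_mono 2).map_max, v_p hp, v_q hq,
      ← (pow_right_mono₀ hx.le).map_max, Polynomial.degree_eq_natDegree hp,
      Polynomial.degree_eq_natDegree hq]
    rfl

theorem mem_sections_of_valuation_le {m : ℕ} (hm : 1 ≤ m) {r s : W.CoordinateRing}
    (hs : s ∈ sections W m) (h : v r ≤ v s) : r ∈ sections W m := by
  rcases eq_or_ne r 0 with rfl | hr
  · exact zero_mem _
  have h2 := pow_le_pow_left₀ zero_le h 2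
  rw [valuation_sq_eq hx hr] at h2
  have hs0 : s ≠ 0 := by
    rintro rfl
    rw [map_zero, zero_pow two_ne_zero] at h2
    exact (pow_pos (zero_lt_one.trans hx) _).not_ge h2
  rw [valuation_sq_eq hx hs0, pow_le_pow_iff_right₀ hx] at h2
  exact (mem_sections_iff hm).mpr (h2.trans ((mem_sections_iff hm).mp hs))

end Valuation

end Sections

section ExistenceOfPlaces

variable {B K : Type*} [CommRing B] [Field K] [Algebra ℂ B] [Algebra ℂ K] [Algebra B K]
  [IsScalarTower ℂ B K]

theorem exists_place_one_lt_valuation_of_not_isIntegral {z : K} (hz : ¬ IsIntegral B z) :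
    ∃ P : Place K, (∀ b : B, P.localRing.valuation (algebraMap B K b) ≤ 1) ∧
      1 < P.localRing.valuation z := by
  obtain ⟨A, hA, hzA⟩ := Subring.exists_le_valuationSubring_of_isIntegrallyClosedIn
    (R := (integralClosure B K).toSubring) hz
  have algebraMap_mem (b : B) : algebraMap B K b ∈ A := hA ((integralClosure B K).algebraMap_mem b)
  refine ⟨⟨A, fun c => ?_, fun h => hzA (h ▸ ValuationSubring.mem_top z)⟩,
    fun b => (A.valuation_le_one_iff _).mpr (algebraMap_mem b),
    lt_of_not_ge fun h => hzA ((A.valuation_le_one_iff z).mp h)⟩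
  rw [IsScalarTower.algebraMap_apply ℂ B K]
  exact algebraMap_mem _

theorem exists_place_valuation_lt_one_of_ne_top [FaithfulSMul B K] {I : Ideal B} (hI : I ≠ ⊤)
    {h : B} (hhI : h ∈ I) (hh : h ≠ 0) :
    ∃ P : Place K, ∀ b ∈ I, P.localRing.valuation (algebraMap B K b) < 1 := by
  have injective : Function.Injective (algebraMap B K) := FaithfulSMul.algebraMap_injective B K
  let e : B ≃+* (algebraMap B K).range := RingEquiv.ofBijective (algebraMap B K).rangeRestrict
    ⟨fun a b hab => injective (congrArg Subtype.val hab), RingHom.rangeRestrict_surjective _⟩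
  have hI' : I.comap e.symm.toRingHom ≠ ⊤ := fun hI' => hI <| by
    rw [Ideal.eq_top_iff_one] at hI' ⊢
    simpa using hI'
  obtain ⟨A, hA, hAI⟩ := Ideal.image_subset_nonunits_valuationSubring _ hI'
  have valuation_lt_one {b : B} (hb : b ∈ I) : A.valuation (algebraMap B K b) < 1 :=
    A.mem_nonunits_iff.mp (hAI ⟨e b, by simpa using hb, rfl⟩)
  refine ⟨⟨A, fun c => ?_, fun hA => ?_⟩, fun b hb => valuation_lt_one hb⟩
  · rw [IsScalarTower.algebraMap_apply ℂ B K]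
    exact hA ⟨_, rfl⟩
  · have h0 : A.valuation (algebraMap B K h) ≠ 0 := by
      simpa using (map_ne_zero_iff _ injective).mpr hh
    refine (valuation_lt_one hhI).not_ge ?_
    rw [← inv_le_one₀ (zero_lt_iff.mpr h0), ← map_inv₀, A.valuation_le_one_iff, hA]
    exact ValuationSubring.mem_top _

end ExistenceOfPlaces

/-! ### Morphisms as quotients of sections -/

section Relations

theorem valuation_mul_le_of_sum_eq_zero {R Γ : Type*} [Ring R]
    [LinearOrderedCommGroupWithZero Γ] (v : Valuation R Γ) {f : R} {N : ℕ} {H : ℕ → R}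
    (h : ∑ j ∈ Finset.range (N + 1), f ^ j * H j = 0) {γ : Γ} (hγ : ∀ j ≤ N, v (H j) ≤ γ) :
    v (f * H N) ≤ γ := by
  rw [map_mul]
  rcases le_or_gt (v f) 1 with hf | hf
  · exact (mul_le_of_le_one_left zero_le hf).trans (hγ N le_rfl)
  rcases N with _ | N
  · rw [Finset.sum_range_one, pow_zero, one_mul] at h
    simp [h]
  rw [Finset.sum_range_succ, add_comm, add_eq_zero_iff_eq_neg] at h
  have : v f ^ N * (v f * v (H (N + 1))) ≤ v f ^ N * γ := by
    calc v f ^ N * (v f * v (H (N + 1))) = v (f ^ (N + 1) * H (N + 1)) := by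
          rw [map_mul, map_pow, pow_succ, mul_assoc]
      _ = v (∑ j ∈ Finset.range (N + 1), f ^ j * H j) := by rw [h, Valuation.map_neg]
      _ ≤ v f ^ N * γ := v.map_sum_le fun j hj => by
          rw [map_mul, map_pow]
          rw [Finset.mem_range] at hj
          exact mul_le_mul' (pow_le_pow_right₀ hf.le (by omega)) (hγ j (by omega))
  exact (mul_le_mul_iff_right₀ (pow_pos (one_pos.trans hf) N)).mp this

variable {K : Type*} [Field K] [Algebra ℂ K] {f : K}

theorem morphismDegree_inv (f : K) : morphismDegree f⁻¹ = morphismDegree f := by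
  have : IntermediateField.adjoin ℂ {f⁻¹} = IntermediateField.adjoin ℂ {f} := by
    refine le_antisymm ?_ ?_ <;> rw [IntermediateField.adjoin_simple_le_iff]
    · exact inv_mem (IntermediateField.mem_adjoin_simple_self ℂ f)
    · simpa using inv_mem (IntermediateField.mem_adjoin_simple_self ℂ f⁻¹)
  rw [morphismDegree, morphismDegree, this]

open IntermediateField.algebraAdjoinAdjoin in
theorem exists_polynomial_relation (hf : 0 < morphismDegree f) {ι : Type*} [Fintype ι]
    (hι : morphismDegree f < Fintype.card ι) (b : ι → K) :
    ∃ p : ι → Polynomial ℂ, p ≠ 0 ∧ ∑ i, Polynomial.aeval f (p i) * b i = 0 := by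
  have : FiniteDimensional (IntermediateField.adjoin ℂ {f}) K := Module.finite_of_finrank_pos hf
  have dependent : ¬ LinearIndependent (Algebra.adjoin ℂ {f}) b := fun h => by
    rw [LinearIndependent.iff_fractionRing (Algebra.adjoin ℂ {f})
      (IntermediateField.adjoin ℂ {f})] at h
    exact h.fintype_card_le_finrank.not_gt hι
  obtain ⟨c, hc, i₀, hi₀⟩ := Fintype.not_linearIndependent_iff.mp dependent
  have (i : ι) : ∃ p : Polynomial ℂ, Polynomial.aeval f p = (c i : K) :=
    (Algebra.adjoin_singleton_eq_range_aeval ℂ f).le (c i).2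
  choose p hp using this
  refine ⟨p, fun h => hi₀ (Subtype.ext ?_), ?_⟩
  · rw [← hp, h, Pi.zero_apply, map_zero, ZeroMemClass.coe_zero]
  · rw [← hc]
    exact Finset.sum_congr rfl fun i _ => by rw [hp]; rfl

theorem exists_sum_pow_mul_eq_zero (hf : 0 < morphismDegree f) {U : Type*} [AddCommGroup U]
    [Module ℂ U] (hU : morphismDegree f < Module.finrank ℂ U) (c : U →ₗ[ℂ] K) :
    ∃ (N : ℕ) (H : ℕ → U), H N ≠ 0 ∧ ∑ j ∈ Finset.range (N + 1), f ^ j * c (H j) = 0 := by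
  have : FiniteDimensional ℂ U := Module.finite_of_finrank_pos (hf.trans hU)
  let b := Module.finBasis ℂ U
  obtain ⟨p, hp, hsum⟩ := exists_polynomial_relation hf (by simpa using hU) fun i => c (b i)
  obtain ⟨i₀, hi₀⟩ := Function.ne_iff.mp hp
  obtain ⟨i₁, hi₁, hmax⟩ := ({i | p i ≠ 0} : Set _).toFinite.exists_maximalFor
    (fun i => (p i).natDegree) _ ⟨i₀, hi₀⟩
  have natDegree_lt (i) : (p i).natDegree < (p i₁).natDegree + 1 := by
    rcases eq_or_ne (p i) 0 with h | h
    · simp [h]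
    · exact Nat.lt_succ_of_le ((le_total _ _).elim (fun hle => hmax h hle) id)
  refine ⟨(p i₁).natDegree, fun j => ∑ i, (p i).coeff j • b i, fun h => ?_, ?_⟩
  · exact Polynomial.leadingCoeff_ne_zero.mpr hi₁
      (Fintype.linearIndependent_iff.mp b.linearIndependent _ h i₁)
  · rw [← hsum]
    simp only [map_sum, map_smul, Finset.mul_sum]
    rw [Finset.sum_comm]
    refine Finset.sum_congr rfl fun i _ => ?_
    rw [Polynomial.aeval_eq_sum_range' (natDegree_lt i), Finset.sum_mul]
    exact Finset.sum_congr rfl fun j _ => by rw [smul_mul_assoc, mul_smul_comm]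

theorem finrank_quotient_span_le_morphismDegree {B : Type*} [CommRing B] [Algebra ℂ B]
    [Algebra B K] [IsScalarTower ℂ B K] [FaithfulSMul B K] (hf : 0 < morphismDegree f) {g h : B}
    (hfgh : f * algebraMap B K h = algebraMap B K g) (hgh : IsCoprime g h) :
    Module.finrank ℂ (B ⧸ Ideal.span {h}) ≤ morphismDegree f := by
  by_contra! hlt
  let π := (Ideal.Quotient.mkₐ ℂ (Ideal.span {h})).toLinearMap
  obtain ⟨s, hs⟩ := π.exists_rightInverse_of_surjective
    (LinearMap.range_eq_top.mpr (Ideal.Quotient.mkₐ_surjective ℂ _))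
  obtain ⟨N, H, hH, hsum⟩ := exists_sum_pow_mul_eq_zero hf hlt
    ((IsScalarTower.toAlgHom ℂ B K).toLinearMap ∘ₗ s)
  have homogenized : ∑ j ∈ Finset.range (N + 1), g ^ j * h ^ (N - j) * s (H j) = 0 := by
    refine FaithfulSMul.algebraMap_injective B K ?_
    rw [map_zero, ← mul_zero (algebraMap B K h ^ N), ← hsum, map_sum, Finset.mul_sum]
    refine Finset.sum_congr rfl fun j hj => ?_
    have hj : j + (N - j) = N := by grind
    simp only [map_mul, map_pow, ← hfgh, LinearMap.comp_apply, AlgHom.toLinearMap_apply,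
      IsScalarTower.coe_toAlgHom', mul_pow]
    rw [← hj, pow_add, hj]
    ring
  have h_dvd : h ∣ g ^ N * s (H N) := by
    rw [Finset.sum_range_succ, Nat.sub_self, pow_zero, mul_one, add_eq_zero_iff_neg_eq']
      at homogenized
    rw [← dvd_neg, homogenized]
    refine Finset.dvd_sum fun j hj => ?_
    have : N - j ≠ 0 := by grind
    exact ((dvd_pow_self h this).mul_left _).mul_right _
  have mk_s : Ideal.Quotient.mk _ (s (H N)) = H N := LinearMap.congr_fun hs (H N)
  refine hH ?_
  rw [← mk_s]
  exact Ideal.Quotient.eq_zero_iff_mem.mpr (Ideal.mem_span_singleton.mpr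
    (hgh.symm.pow_right.dvd_of_dvd_mul_left h_dvd))

end Relations

section Sections

open WeierstrassCurve.Affine
open scoped Polynomial

/-- The space `sections W m`, inside the function field. -/
def rationalSections {F : Type*} [Field F] (W : WeierstrassCurve.Affine F) (m : ℕ) :
    Submodule F W.FunctionField :=
  (sections W m).map (IsScalarTower.toAlgHom F W.CoordinateRing W.FunctionField).toLinearMap

instance {F : Type*} [Field F] (W : WeierstrassCurve.Affine F) (m : ℕ) :
    FiniteDimensional F (rationalSections W m) :=
  Module.Finite.map _ _

theorem finrank_rationalSections {F : Type*} [Field F] (W : WeierstrassCurve.Affine F) {m : ℕ}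
    (hm : 1 ≤ m) : Module.finrank F (rationalSections W m) = m :=
  (Submodule.equivMapOfInjective
    (IsScalarTower.toAlgHom F W.CoordinateRing W.FunctionField).toLinearMap
    (IsFractionRing.injective _ _) (sections W m)).finrank_eq.symm.trans (finrank_sections W hm)

variable {W : WeierstrassCurve.Affine ℂ}

theorem mem_rationalSections {m : ℕ} {z : W.FunctionField} :
    z ∈ rationalSections W m ↔ ∃ r ∈ sections W m, algebraMap _ _ r = z :=
  Iff.rfl

variable (W) in
theorem exists_place_one_lt_valuation_X :
    ∃ P : Place W.FunctionField, 1 < P.localRing.valuation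
      (algebraMap W.CoordinateRing _ (algebraMap ℂ[X] _ .X)) := by
  obtain ⟨P, -, hP⟩ := exists_place_one_lt_valuation_of_not_isIntegral (B := ℂ)
    (z := algebraMap W.CoordinateRing W.FunctionField (algebraMap ℂ[X] _ .X)) <| by
      rw [isIntegral_algebraMap_iff (IsFractionRing.injective _ _),
        isIntegral_algebraMap_iff (FaithfulSMul.algebraMap_injective ℂ[X] W.CoordinateRing)]
      exact fun h => Polynomial.transcendental_X ℂ h.isAlgebraic
  exact ⟨P, hP⟩

theorem mem_rationalSections_of_forall_valuation_le [W.IsElliptic] {m : ℕ} (hm : 1 ≤ m)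
    {z : W.FunctionField} (hz : ∀ P : Place W.FunctionField, ∃ s ∈ rationalSections W m,
      P.localRing.valuation z ≤ P.localRing.valuation s) : z ∈ rationalSections W m := by
  have integral : IsIntegral W.CoordinateRing z := by
    by_contra hz_int
    obtain ⟨P, hB, hP⟩ := exists_place_one_lt_valuation_of_not_isIntegral hz_int
    obtain ⟨_, ⟨s, -, rfl⟩, hle⟩ := hz P
    exact (hP.trans_le hle).not_ge (hB s)
  have := isIntegrallyClosed_coordinateRing (W := W) two_ne_zero
  obtain ⟨r, rfl⟩ := IsIntegrallyClosed.isIntegral_iff.mp integral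
  obtain ⟨P, hP⟩ := exists_place_one_lt_valuation_X W
  obtain ⟨_, ⟨s, hs, rfl⟩, hle⟩ := hz P
  let v := P.localRing.valuation.comap (algebraMap W.CoordinateRing W.FunctionField)
  have : v.IsTrivialOn ℂ := ⟨fun c hc => by
    rw [Valuation.comap_apply, ← IsScalarTower.algebraMap_apply]
    exact Valuation.IsTrivialOn.eq_one c hc⟩
  exact ⟨r, mem_sections_of_valuation_le (v := v) hP hm hs hle, rfl⟩

theorem exists_mem_sections_mul_eq [W.IsElliptic] {f : W.FunctionField}
    (hf : 0 < morphismDegree f) :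
    ∃ g ∈ sections W (morphismDegree f + 1), ∃ h ∈ sections W (morphismDegree f + 1), h ≠ 0 ∧
      f * algebraMap _ _ h = algebraMap _ _ g := by
  obtain ⟨N, H, hH, hsum⟩ := exists_sum_pow_mul_eq_zero hf
    (by rw [finrank_rationalSections W (by omega)]; omega)
    (rationalSections W (morphismDegree f + 1)).subtype
  have mem : f * (H N : W.FunctionField) ∈ rationalSections W (morphismDegree f + 1) := by
    refine mem_rationalSections_of_forall_valuation_le (by omega) fun P => ?_
    obtain ⟨j, -, hj⟩ := Finset.exists_max_image (Finset.range (N + 1))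
      (fun j => P.localRing.valuation (H j : W.FunctionField)) ⟨0, by simp⟩
    exact ⟨H j, (H j).2, valuation_mul_le_of_sum_eq_zero _ hsum fun i hi =>
      hj i (Finset.mem_range.mpr (by omega))⟩
  obtain ⟨g, hg, hg_eq⟩ := mem
  obtain ⟨h, hh, hh_eq⟩ := (H N).2
  refine ⟨g, hg, h, hh, ?_, ?_⟩
  · rintro rfl
    exact hH (Subtype.ext (hh_eq.symm.trans (map_zero _)))
  · exact (congrArg (f * ·) hh_eq).trans hg_eq.symm

theorem mem_sections_of_isCoprime {f : W.FunctionField} (hf : 0 < morphismDegree f)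
    {g h : W.CoordinateRing} (hfgh : f * algebraMap _ _ h = algebraMap _ _ g)
    (hgh : IsCoprime g h) : h ∈ sections W (morphismDegree f) := by
  rw [mem_sections_iff hf]
  rcases eq_or_ne h 0 with rfl | hh
  · simp
  · rw [← finrank_quotient_span_eq_natDegree_norm (CoordinateRing.basis W) hh]
    exact finrank_quotient_span_le_morphismDegree hf hfgh hgh

theorem mem_sections_and_mem_sections_of_isCoprime {f : W.FunctionField}
    (hf : 0 < morphismDegree f) {g h : W.CoordinateRing}
    (hfgh : f * algebraMap _ _ h = algebraMap _ _ g) (hgh : IsCoprime g h) :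
    g ∈ sections W (morphismDegree f) ∧ h ∈ sections W (morphismDegree f) := by
  refine ⟨?_, mem_sections_of_isCoprime hf hfgh hgh⟩
  rcases eq_or_ne f 0 with rfl | hf0
  · rw [zero_mul, eq_comm, map_eq_zero_iff _ (IsFractionRing.injective _ _)] at hfgh
    exact hfgh ▸ zero_mem _
  · rw [← morphismDegree_inv] at hf ⊢
    exact mem_sections_of_isCoprime hf (by rw [← hfgh, inv_mul_cancel_left₀ hf0]) hgh.symm

end Sections

/-! ### Linear systems and divisors -/

section PolarSystem

variable {K : Type*} [Field K] [Algebra ℂ K]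

theorem Place.valuation_pos_of_maximalIdeal_eq_span {P : Place K} {t : P.localRing}
    (ht : IsLocalRing.maximalIdeal P.localRing = Ideal.span {t}) :
    0 < P.localRing.valuation (t : K) := by
  rw [zero_lt_iff, Ne, map_eq_zero]
  intro ht0
  rw [show t = 0 from Subtype.ext ht0, Ideal.span_singleton_zero] at ht
  obtain ⟨z, hz⟩ := P.exists_one_lt_valuation
  have hz_inv : P.localRing.valuation z⁻¹ < 1 := by
    rw [map_inv₀]
    exact inv_lt_one_of_one_lt₀ hz
  let w : P.localRing := ⟨z⁻¹, (P.localRing.valuation_le_one_iff _).mp hz_inv.le⟩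
  have hw : w ∈ IsLocalRing.maximalIdeal P.localRing :=
    (P.localRing.valuation_lt_one_iff w).mpr hz_inv
  rw [ht, Ideal.mem_bot] at hw
  have hz0 : z = 0 := inv_eq_zero.mp (congrArg Subtype.val hw)
  simp [hz0] at hz

theorem Place.HasOrder.valuation_eq {P : Place K} {t : P.localRing}
    (ht : IsLocalRing.maximalIdeal P.localRing = Ideal.span {t}) {g : K} {n : ℤ}
    (hg : P.HasOrder g n) : P.localRing.valuation g = P.localRing.valuation (t : K) ^ n := by
  obtain ⟨t', u, ht', rfl⟩ := hg
  have associated : Associated t' t := by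
    rw [← Ideal.span_singleton_eq_span_singleton, ← ht, ht']
  obtain ⟨w, rfl⟩ := associated
  have valuation_unit (x : P.localRingˣ) : P.localRing.valuation ((x : P.localRing) : K) = 1 :=
    (P.localRing.valuation_eq_one_iff _).mp x.isUnit
  rw [map_mul, valuation_unit, one_mul, map_zpow₀, MulMemClass.coe_mul, map_mul, valuation_unit,
    mul_one]

/-- The complete linear system of the polar divisor of `f`: the functions whose poles are bounded
by those of `f`. -/
def polarSystem (f : K) : Submodule ℂ K :=
  ⨅ P : Place K, P.closedBall (max 1 (P.localRing.valuation f))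

theorem mem_polarSystem {f z : K} : z ∈ polarSystem f ↔
    ∀ P : Place K, P.localRing.valuation z ≤ max 1 (P.localRing.valuation f) :=
  Submodule.mem_iInf _

theorem PullbackIso.mem_quotients_polarSystem {f f₀ : K} {D : Place K →₀ ℤ}
    (hf : PullbackIso f D) (hf₀ : PullbackIso f₀ D) : f ∈ quotients (polarSystem f₀) := by
  obtain ⟨g, hg, hfg⟩ := hf
  obtain ⟨g₀, hg₀, hfg₀⟩ := hf₀
  have valuation_le (P : Place K) :
      P.localRing.valuation (g₀ / g) ≤ max 1 (P.localRing.valuation f₀) ∧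
        P.localRing.valuation (f * (g₀ / g)) ≤ max 1 (P.localRing.valuation f₀) := by
    obtain ⟨m, hm, hmg⟩ := hfg P
    obtain ⟨m₀, hm₀, hmg₀⟩ := hfg₀ P
    obtain ⟨t, -, ht, -⟩ := id hm
    have hτ0 := Place.valuation_pos_of_maximalIdeal_eq_span ht
    have hτ1 := (P.localRing.valuation_le_one_iff _).mpr t.2
    rw [map_mul, map_div₀, hm.valuation_eq ht, hm₀.valuation_eq ht, hmg.valuation_eq ht,
      hmg₀.valuation_eq ht, ← zpow_sub₀ hτ0.ne', ← zpow_add₀ hτ0.ne']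
    set τ := P.localRing.valuation (t : K)
    have zpow_le {a : ℤ} (ha : min 0 m₀ ≤ a) : τ ^ a ≤ max 1 (τ ^ m₀) := by
      refine (zpow_le_zpow_right_of_le_one₀ hτ0 hτ1 ha).trans ?_
      rcases min_choice 0 m₀ with h | h <;> simp [h]
    exact ⟨zpow_le (by omega), zpow_le (by omega)⟩
  exact ⟨g₀ / g, mem_polarSystem.mpr fun P => (valuation_le P).1, div_ne_zero hg₀ hg,
    mem_polarSystem.mpr fun P => (valuation_le P).2⟩

theorem span_pair_ne_top_of_not_isCoprime {B : Type*} [CommRing B] {g h : B}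
    (hgh : ¬ IsCoprime g h) : Ideal.span {g, h} ≠ ⊤ :=
  fun h_top => hgh (Ideal.mem_span_pair.mp ((Ideal.eq_top_iff_one _).mp h_top))

theorem valuation_mul_le_max_of_mem_polarSystem {f z g h : K} (hz : z ∈ polarSystem f)
    (hfgh : f * h = g) (P : Place K) :
    P.localRing.valuation (z * h) ≤ max (P.localRing.valuation h) (P.localRing.valuation g) := by
  calc P.localRing.valuation (z * h)
      ≤ max 1 (P.localRing.valuation f) * P.localRing.valuation h := by
        rw [map_mul]
        exact mul_le_mul_left (mem_polarSystem.mp hz P) _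
    _ = max (P.localRing.valuation h) (P.localRing.valuation g) := by
        rw [max_mul, one_mul, ← map_mul, hfgh]

theorem one_notMem_map_mulRight_polarSystem {B : Type*} [CommRing B] [Algebra ℂ B] [Algebra B K]
    [IsScalarTower ℂ B K] [FaithfulSMul B K] {f : K} {g h : B}
    (hfgh : f * algebraMap B K h = algebraMap B K g) (hh : h ≠ 0) (hgh : ¬ IsCoprime g h) :
    1 ∉ (polarSystem f).map (LinearMap.mulRight ℂ (algebraMap B K h)) := by
  rintro ⟨z, hz, hzh : z * algebraMap B K h = 1⟩
  obtain ⟨P, hP⟩ := exists_place_valuation_lt_one_of_ne_top (K := K)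
    (span_pair_ne_top_of_not_isCoprime hgh) (Ideal.subset_span (by simp)) hh
  have one_le := valuation_mul_le_max_of_mem_polarSystem hz hfgh P
  rw [hzh, map_one] at one_le
  exact one_le.not_gt (max_lt (hP h (Ideal.subset_span (by simp)))
    (hP g (Ideal.subset_span (by simp))))

end PolarSystem

section EllipticCurve

open WeierstrassCurve.Affine
open scoped Polynomial

variable {W : WeierstrassCurve.Affine ℂ} [W.IsElliptic]

theorem map_mulRight_polarSystem_le {f : W.FunctionField} {g h : W.CoordinateRing}
    (hfgh : f * algebraMap _ _ h = algebraMap _ _ g) {m : ℕ} (hm : 1 ≤ m) (hg : g ∈ sections W m)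
    (hh : h ∈ sections W m) :
    (polarSystem f).map (LinearMap.mulRight ℂ (algebraMap _ W.FunctionField h)) ≤
      rationalSections W m := by
  rintro _ ⟨z, hz, rfl⟩
  refine mem_rationalSections_of_forall_valuation_le hm fun P => ?_
  rcases le_max_iff.mp (valuation_mul_le_max_of_mem_polarSystem hz hfgh P) with hle | hle
  · exact ⟨_, ⟨h, hh, rfl⟩, hle⟩
  · exact ⟨_, ⟨g, hg, rfl⟩, hle⟩

theorem finiteDimensional_polarSystem_and_finrank_le {f : W.FunctionField}
    (hf : 0 < morphismDegree f) :
    FiniteDimensional ℂ (polarSystem f) ∧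
      Module.finrank ℂ (polarSystem f) ≤ morphismDegree f := by
  obtain ⟨g, hg, h, hh, hh0, hfgh⟩ := exists_mem_sections_mul_eq hf
  let e := (polarSystem f).equivMapOfInjective
    (LinearMap.mulRight ℂ (algebraMap _ W.FunctionField h))
    (mul_left_injective₀ ((map_ne_zero_iff _ (IsFractionRing.injective _ _)).mpr hh0))
  have map_le := map_mulRight_polarSystem_le hfgh (by omega) hg hh
  have := Submodule.finiteDimensional_of_le map_le
  refine ⟨Module.Finite.equiv e.symm, ?_⟩
  rw [e.finrank_eq]
  by_cases hgh : IsCoprime g h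
  · obtain ⟨hg', hh'⟩ := mem_sections_and_mem_sections_of_isCoprime hf hfgh hgh
    exact (Submodule.finrank_mono (map_mulRight_polarSystem_le hfgh hf hg' hh')).trans_eq
      (finrank_rationalSections W hf)
  · have one_mem : (1 : W.FunctionField) ∈ rationalSections W (morphismDegree f + 1) :=
      mem_rationalSections.mpr ⟨1, one_mem_sections (by omega), map_one _⟩
    have := Submodule.finrank_lt_finrank_of_lt (lt_of_le_of_ne map_le fun h_eq =>
      one_notMem_map_mulRight_polarSystem hfgh hh0 hgh (h_eq ▸ one_mem))
    rwa [finrank_rationalSections W (by omega), Nat.lt_succ_iff] at this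

end EllipticCurve

/-! ### Morphisms with prescribed values -/

theorem exists_algHom_forall_eq_zero_of_ne_top {k B : Type*} [Field k] [IsAlgClosed k]
    [CommRing B] [Algebra k B] [Algebra.FiniteType k B] {I : Ideal B} (hI : I ≠ ⊤) :
    ∃ φ : B →ₐ[k] k, ∀ b ∈ I, φ b = 0 := by
  obtain ⟨M, hM, hIM⟩ := Ideal.exists_le_maximal I hI
  let _ : Field (B ⧸ M) := Ideal.Quotient.field M
  have : Module.Finite k (B ⧸ M) := finite_of_finite_type_of_isJacobsonRing _ _
  let ψ : (B ⧸ M) →ₐ[k] k := IsAlgClosed.lift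
  refine ⟨ψ.comp (Ideal.Quotient.mkₐ k M), fun b hb => ?_⟩
  rw [AlgHom.comp_apply, Ideal.Quotient.mkₐ_eq_mk, Ideal.Quotient.eq_zero_iff_mem.mpr (hIM hb),
    map_zero]

section PrescribedValues

open scoped Polynomial

variable {W : WeierstrassCurve.Affine ℂ} {ι : Type*}

instance : Algebra.FiniteType ℂ W.CoordinateRing :=
  Algebra.FiniteType.trans (S := ℂ[X]) inferInstance inferInstance

theorem eventually_generic_forall_quotients_rationalSections_not_takesValue
    (Q : ι → Place W.FunctionField) {m : ℕ} (hm : 1 ≤ m) (hι : 2 * m ≤ Nat.card ι) :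
    ∀ᶠ π in generic ι ℂ, ∀ f ∈ quotients (rationalSections W m),
      ¬ ∀ i, (Q i).TakesValue f ![π i, 1] :=
  eventually_generic_forall_quotients_not_takesValue (trdeg_functionField W).le Q _
    (by rwa [finrank_rationalSections W hm])

variable [W.IsElliptic]

theorem eventually_generic_forall_morphismDegree_two_not_takesValue
    (Q : ι → Place W.FunctionField) (hι : 6 ≤ Nat.card ι) :
    ∀ᶠ π in generic ι ℂ, ∀ f, morphismDegree f = 2 → ¬ ∀ i, (Q i).TakesValue f ![π i, 1] := by
  filter_upwards [eventually_generic_forall_quotients_rationalSections_not_takesValue Q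
    (m := 3) (by omega) hι] with π hπ f hf
  obtain ⟨g, hg, h, hh, hh0, hfgh⟩ := exists_mem_sections_mul_eq (f := f) (by omega)
  rw [hf] at hg hh
  exact hπ f ⟨_, ⟨h, hh, rfl⟩, (map_ne_zero_iff _ (IsFractionRing.injective _ _)).mpr hh0,
    g, hg, hfgh.symm⟩

theorem eventually_generic_forall_morphismDegree_three_not_takesValue
    (Q : ι → Place W.FunctionField) (hι : 7 ≤ Nat.card ι) :
    ∀ᶠ π in generic ι ℂ, ∀ f, morphismDegree f = 3 → ¬ ∀ i, (Q i).TakesValue f ![π i, 1] := by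
  filter_upwards [eventually_generic_forall_quotients_rationalSections_not_takesValue Q
      (m := 3) (by omega) (by omega),
    eventually_generic_forall_common_zero_not_takesValue (trdeg_functionField W).le
      (trdeg_coordinateRing W).le Q (sections W 4)
      (one_mem_sections (by omega)) (by rw [finrank_sections W] <;> omega)]
    with π hπ_coprime hπ_common f hf
  obtain ⟨g, hg, h, hh, hh0, hfgh⟩ := exists_mem_sections_mul_eq (f := f) (by omega)
  by_cases hgh : IsCoprime g h
  · obtain ⟨hg', hh'⟩ := mem_sections_and_mem_sections_of_isCoprime (by omega) hfgh hgh
    rw [hf] at hg' hh'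
    exact hπ_coprime f ⟨_, ⟨h, hh', rfl⟩,
      (map_ne_zero_iff _ (IsFractionRing.injective _ _)).mpr hh0, g, hg', hfgh.symm⟩
  · obtain ⟨φ, hφ⟩ := exists_algHom_forall_eq_zero_of_ne_top (k := ℂ)
      (span_pair_ne_top_of_not_isCoprime hgh)
    rw [hf] at hg hh
    exact hπ_common φ g hg h hh (hφ g (Ideal.subset_span (by simp)))
      (hφ h (Ideal.subset_span (by simp))) hh0 f hfgh

theorem eventually_generic_forall_pullbackIso_not_takesValue (Q : ι → Place W.FunctionField)
    (D : Place W.FunctionField →₀ ℤ) {d : ℕ} (hd : 0 < d) (hι : 2 * d ≤ Nat.card ι) :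
    ∀ᶠ π in generic ι ℂ, ∀ f, morphismDegree f = d → PullbackIso f D →
      ¬ ∀ i, (Q i).TakesValue f ![π i, 1] := by
  by_cases hex : ∃ f₀ : W.FunctionField, morphismDegree f₀ = d ∧ PullbackIso f₀ D
  · obtain ⟨f₀, rfl, hf₀⟩ := hex
    obtain ⟨_, finrank_le⟩ := finiteDimensional_polarSystem_and_finrank_le hd
    filter_upwards [eventually_generic_forall_quotients_not_takesValue (trdeg_functionField W).le
      Q (polarSystem f₀) (by omega)] with π hπ f _ hf
    exact hπ f (hf.mem_quotients_polarSystem hf₀)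
  · exact .of_forall fun π f hfd hf => absurd ⟨f, hfd, hf⟩ hex

theorem eventually_generic_forall_not_takesValue (Q : ι → Place W.FunctionField)
    (D : Place W.FunctionField →₀ ℤ) :
    ∀ᶠ π in generic ι ℂ, ∀ f, 2 ≤ morphismDegree f → morphismDegree f ≤ 4 →
      (morphismDegree f = 4 → PullbackIso f D) → 4 + morphismDegree f ≤ Nat.card ι →
        ¬ ∀ i, (Q i).TakesValue f ![π i, 1] := by
  have degree_two : ∀ᶠ π in generic ι ℂ, 6 ≤ Nat.card ι → _ :=
    Filter.eventually_imp_distrib_left.mpr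
      (eventually_generic_forall_morphismDegree_two_not_takesValue Q)
  have degree_three : ∀ᶠ π in generic ι ℂ, 7 ≤ Nat.card ι → _ :=
    Filter.eventually_imp_distrib_left.mpr
      (eventually_generic_forall_morphismDegree_three_not_takesValue Q)
  have degree_four : ∀ᶠ π in generic ι ℂ, 8 ≤ Nat.card ι → _ :=
    Filter.eventually_imp_distrib_left.mpr
      (eventually_generic_forall_pullbackIso_not_takesValue Q D (d := 4) (by omega))
  filter_upwards [degree_two, degree_three, degree_four] with π h₂ h₃ h₄ f h2 h4 hD hι
  obtain hf | hf | hf : morphismDegree f = 2 ∨ morphismDegree f = 3 ∨ morphismDegree f = 4 := by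
    omega
  · exact h₂ (by omega) f hf
  · exact h₃ (by omega) f hf
  · exact h₄ (by omega) f hf (hD hf)

theorem eventually_generic_not_exists_morphism [Finite ι] (Q : ι → Place W.FunctionField)
    (D : Place W.FunctionField →₀ ℤ) :
    ∀ᶠ π in generic ι ℂ, ¬ ∃ f : W.FunctionField,
      (2 ≤ morphismDegree f ∧ morphismDegree f ≤ 4 ∧ (morphismDegree f = 4 → PullbackIso f D)) ∧
        4 + morphismDegree f ≤ {i | (Q i).TakesValue f ![π i, 1]}.ncard := by
  have forall_subset (s : Set ι) : ∀ᶠ π in generic ι ℂ, ∀ f, 2 ≤ morphismDegree f →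
      morphismDegree f ≤ 4 → (morphismDegree f = 4 → PullbackIso f D) →
        4 + morphismDegree f ≤ Nat.card s → ¬ ∀ i : s, (Q i).TakesValue f ![π i, 1] :=
    (tendsto_comp_generic Subtype.val_injective).eventually
      (eventually_generic_forall_not_takesValue (Q ∘ Subtype.val) D)
  filter_upwards [Filter.eventually_all.mpr forall_subset] with π hπ
  rintro ⟨f, ⟨h2, h4, hD⟩, hcard⟩
  exact hπ {i | (Q i).TakesValue f ![π i, 1]} f h2 h4 hD hcard fun i => i.2

end PrescribedValues

end PolarPolyhedra

end

theorem mainTheorem5_general :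
    PolarPolyhedra.Nondegenerate 3 3 2 8 ∧
    PolarPolyhedra.ForGeneralPoints 1 8 (fun p =>
      ¬ ∃ Γ, PolarPolyhedra.IsGrove p PolarPolyhedra.octad Γ) ∧
    ∀ (W : WeierstrassCurve ℂ) [W.IsElliptic]
      (D : PolarPolyhedra.Place W.toAffine.FunctionField →₀ ℤ) {ι : Type*} [Finite ι]
      (Q : ι → PolarPolyhedra.Place W.toAffine.FunctionField),
      ∀ᶠ π in PolarPolyhedra.generic ι ℂ, ¬ ∃ f : W.toAffine.FunctionField,
        (2 ≤ PolarPolyhedra.morphismDegree f ∧ PolarPolyhedra.morphismDegree f ≤ 4 ∧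
          (PolarPolyhedra.morphismDegree f = 4 → PolarPolyhedra.PullbackIso f D)) ∧
        4 + PolarPolyhedra.morphismDegree f ≤ {i | (Q i).TakesValue f ![π i, 1]}.ncard :=
  ⟨PolarPolyhedra.nondegenerate_three_three_two_eight,
    PolarPolyhedra.forGeneralPoints_not_exists_isGrove,
    fun _ _ D _ _ Q => PolarPolyhedra.eventually_generic_not_exists_morphism Q D⟩

theorem mainTheorem5 :
    PolarPolyhedra.Nondegenerate 3 3 2 8 ∧
    PolarPolyhedra.ForGeneralPoints 1 8 (fun p =>
      ¬ ∃ Γ, PolarPolyhedra.IsGrove p PolarPolyhedra.octad Γ) ∧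
    (∀ (W : WeierstrassCurve ℂ) [W.IsElliptic]
      (D : PolarPolyhedra.Place W.toAffine.FunctionField →₀ ℤ)
      (Q : Fin 8 → PolarPolyhedra.Place W.toAffine.FunctionField),
      (D.sum fun _ m => m) = 4 → Function.Injective Q →
      ∃ p : Fin 8 → Fin 2 → ℂ, (∀ i, p i ≠ 0) ∧
        ¬ ∃ f : W.toAffine.FunctionField,
          (2 ≤ PolarPolyhedra.morphismDegree f ∧ PolarPolyhedra.morphismDegree f ≤ 4 ∧
            (PolarPolyhedra.morphismDegree f = 4 → PolarPolyhedra.PullbackIso f D)) ∧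
          4 + PolarPolyhedra.morphismDegree f ≤ {i | (Q i).TakesValue f (p i)}.ncard) := by
  obtain ⟨octahedra, noGrove, noMorphism⟩ := mainTheorem5_general
  refine ⟨octahedra, noGrove, fun W _ D Q _ _ => ?_⟩
  obtain ⟨π, hπ⟩ := (noMorphism W D Q).exists
  exact ⟨fun i => ![π i, 1], fun i h => one_ne_zero (congrFun h 1), hπ⟩
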